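/- **Theorem (hydrodynamic limit and phase transition).** Let $\varphi,\psi:\mathbb R\to\mathbb R$ be smooth and $1$-periodic, with $(\varphi')^2+\psi^2$ not identically zero, and let $u$ be the classical solution on $\mathbb R\times[0,\infty)$ of $\partial_t^2u=\partial_x^2u$, $u(x,0)=\varphi(x)$, $\partial_tu(x,0)=\psi(x)$. Let $H=L^2[0,1)$ with inner product $[\cdot,\cdot]_H$ and norm $\|\cdot\|_H$. For $n,N\ge1$ consider the ring with vertices $k\in\mathbb Z/n\mathbb Z$ and edges $\langle k,k+1\rangle$, all vertices having mass $1/n$ and all edges having weight $n$. Let $f^{n,N}_t$ be the continuous-time Markov jump process whose states $f$ assign an integer $f(k)$ to each vertex and an integer $f(\langle k,k+1\rangle)$ to each edge (the coordinate of a vector field in the positive direction of the ring), with the following transitions: for each vertex $k$, at rate $n|f(k)|$, $f(\langle k-1,k\rangle)$ increases by $\operatorname{sgn} f(k)$ and $f(\langle k,k+1\rangle)$ decreases by $\operatorname{sgn} f(k)$; for each edge $\langle k,k+1\rangle$, at rate $n|f(\langle k,k+1\rangle)|$, $f(k)$ increases by $\operatorname{sgn}f(\langle k,k+1\rangle)$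 and $f(k+1)$ decreases by $\operatorname{sgn}f(\langle k,k+1\rangle)$. The initial state is $$f^{n,N}_0(k)=\lfloor N\psi(k/n)\rfloor,\qquad f^{n,N}_0(\langle k,k+1\rangle)=\lfloor Nn(\varphi((k+1)/n)-\varphi(k/n))\rfloor,\qquad 0\le k\le n-1 .$$ For $x\in[0,1)$ and $t\ge0$ put $$v^{n,N}(x,t)=\tfrac1N f^{n,N}_t(\lfloor nx\rfloor),\quad w^{n,N}(x,t)=\tfrac1N f^{n,N}_t(\langle\lfloor nx\rfloor,\lfloor nx\rfloor+1\rangle),\quad u^{n,N}(x,t)=\varphi(x)+\int_0^tv^{n,N}(x,s)\,ds,$$ $$Err^{n,N}(t)=\mathbb E\|v^{n,N}(\cdot,t)-\partial_tu(\cdot,t)\|_H^2+\mathbb E\|w^{n,N}(\cdot,t)-\partial_xu(\cdot,t)\|_H^2 .$$ Let $(n,N)=(n_j,N_j)$ be any sequence of pairs of positive integers with $n_j\to\infty$ and $N_j\to\infty$. 1. If $N/n\to\infty$, then for every $T\ge0$, $\ \sup_{0\le t\le T}Err^{n,N}(t)\to0\ $ and $\ \mathbb E\big(\sup_{0\le t\le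 T}\|u^{n,N}(\cdot,t)-u(\cdot,t)\|_H^2\big)\to0$. 2. If $N/n\to C\in(0,\infty)$, then for every $t\ge0$ the sequence $Err^{n,N}(t)$ is bounded, and for every $t>0$ it does not converge to $0$. Moreover, for every $\eta\in H$ and $T\ge0$, $\ \mathbb E\big(\sup_{0\le t\le T}[u^{n,N}(\cdot,t)-u(\cdot,t),\eta]_H^2\big)\to0$. 3. If $N/n\to0$, then for every $t>0$ the sequence $Err^{n,N}(t)$ has finite terms and is unbounded. -/

import Mathlib

open MeasureTheory ProbabilityTheory Filter Set
open scoped ENNReal NNReal Topology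

/-- A finite weighted graph in which every edge is given a reference orientation, from `src e` to
`tgt e`. The mass of the vertex `x` is `m x` and the weight of the edge `e` is `k e`. A vector field
on the edges, whose value at `e = ⟨x, y⟩` is a multiple of the unit vector pointing from `x = src e`
to `y = tgt e`, is identified with its real coordinate along that unit vector. -/
structure WeightedGraph (V E : Type*) where
  src : E → V
  tgt : E → V
  m : V → ℝ
  k : E → ℝ
  m_pos : ∀ x, 0 < m x
  k_nonneg : ∀ e, 0 ≤ k e

namespace WeightedGraph

variable {V E : Type*}

/-- Integer-valued fields on vertices and edges: the state space of the particle system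
(on a finite graph every field has finite support). -/
abbrev State (V E : Type*) : Type _ := (V → ℤ) × (E → ℤ)

/-- The state after a jump caused by the vertex `x`: the vector field `sgn (f x) • e_{yx}` is added
on every edge `⟨x, y⟩` at `x`. The coordinate of `e_{yx}` is `1` if the reference orientation of the
edge points to `x` and `-1` if it starts from `x`. -/
def vertexJump [DecidableEq V] (G : WeightedGraph V E) (f : State V E) (x : V) : State V E :=
  (f.1, fun e => f.2 e +
    (f.1 x).sign * ((if G.tgt e = x then 1 else 0) - (if G.src e = x then 1 else 0)))

/-- The state after a jump caused by the edge `e = ⟨x, y⟩`: `sgn (f e · e_{xy}) (δ_x - δ_y)` is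
added to `f`. -/
def edgeJump [DecidableEq V] (G : WeightedGraph V E) (f : State V E) (e : E) : State V E :=
  (fun z => f.1 z +
    (f.2 e).sign * ((if z = G.src e then 1 else 0) - (if z = G.tgt e then 1 else 0)), f.2)

/-- The infinitesimal generator of the interacting particle system (without boundary vertices). -/
noncomputable def generator [Fintype V] [Fintype E] [DecidableEq V]
    (G : WeightedGraph V E) (F : State V E → ℝ) (f : State V E) : ℝ :=
  (∑ x, |(f.1 x : ℝ)| / G.m x * (F (G.vertexJump f x) - F f)) +
    ∑ e, G.k e * |(f.2 e : ℝ)| * (F (G.edgeJump f e) - F f)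

/-- `X` is (a realization of) the interacting particle system on `G` started from `f₀`: a process
with right-continuous step paths, with finitely many jumps in bounded time intervals, that solves
the martingale problem for `G.generator`, with the finitely supported functions on the countable
state space as test functions, and the initial state `f₀`. -/
structure IsIPS [Fintype V] [Fintype E] [DecidableEq V]
    (G : WeightedGraph V E) (f₀ : State V E) {Ω : Type*} [mΩ : MeasurableSpace Ω]
    (P : Measure Ω) (X : ℝ≥0 → Ω → State V E) : Prop where
  initial : ∀ᵐ ω ∂P, X 0 ω = f₀
  right_continuous : ∀ ω t, ∀ᶠ s in 𝓝[>] t, X s ω = X t ω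
  left_limits : ∀ ω t, 0 < t → ∃ g, ∀ᶠ s in 𝓝[<] t, X s ω = g
  martingale_problem : ∃ ℱ : Filtration ℝ≥0 mΩ,
    (∀ t g, MeasurableSet[ℱ t] {ω | X t ω = g}) ∧
    ∀ F : State V E → ℝ, F.support.Finite →
      Martingale (fun t ω => F (X t ω) - F (X 0 ω) -
        ∫ s in (0 : ℝ)..t, G.generator F (X s.toNNReal ω)) ℱ P

end WeightedGraph

open WeightedGraph

/-- The ring with vertices `0, …, n - 1` (modulo `n`) and edges `⟨k, k + 1⟩`, where the edge
`⟨k, k + 1⟩` is named `k` and oriented from `k` to `k + 1` (the positive direction `e₊` of the ring);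
all masses are `1 / n` and all edge weights are `n`. -/
noncomputable def ringGraph (n : ℕ) [NeZero n] : WeightedGraph (ZMod n) (ZMod n) where
  src k := k
  tgt k := k + 1
  m _ := 1 / n
  k _ := n
  m_pos _ := one_div_pos.mpr (Nat.cast_pos.mpr (NeZero.pos n))
  k_nonneg _ := Nat.cast_nonneg n

/-- The initial state on the ring: `⌊N ψ(k/n)⌋` at the vertex `k` and
`⌊N n (φ((k+1)/n) - φ(k/n))⌋` at the edge `⟨k, k + 1⟩`. -/
noncomputable def ringInitial (φ ψ : ℝ → ℝ) (n N : ℕ) : State (ZMod n) (ZMod n) :=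
  (fun k => ⌊(N : ℝ) * ψ ((k.val : ℝ) / n)⌋,
   fun k => ⌊(N : ℝ) * n * (φ (((k.val : ℝ) + 1) / n) - φ ((k.val : ℝ) / n))⌋)

/-- The velocity field `v^{n,N}(x) = f(⌊n x⌋) / N` of a state `f`. -/
noncomputable def velocityField (n N : ℕ) (f : State (ZMod n) (ZMod n)) (x : ℝ) : ℝ :=
  (f.1 (⌊(n : ℝ) * x⌋ : ZMod n) : ℝ) / N

/-- The strain field `w^{n,N}(x) = f(⟨⌊n x⌋, ⌊n x⌋ + 1⟩) · e₊ / N` of a state `f`. -/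
noncomputable def strainField (n N : ℕ) (f : State (ZMod n) (ZMod n)) (x : ℝ) : ℝ :=
  (f.2 (⌊(n : ℝ) * x⌋ : ZMod n) : ℝ) / N

/-- The displacement field `u^{n,N}(x,t) = φ(x) + ∫₀ᵗ v^{n,N}(x,s) ds` along a path `X`. -/
noncomputable def displacementField (φ : ℝ → ℝ) (n N : ℕ)
    (X : ℝ≥0 → State (ZMod n) (ZMod n)) (x : ℝ) (t : ℝ≥0) : ℝ :=
  φ x + ∫ s in (0 : ℝ)..t, velocityField n N (X s.toNNReal) x

/-- `u` (a function of `x` and `t`) is a classical solution on `ℝ × [0, ∞)` of the Cauchy problem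
`∂ₜ² u = ∂ₓ² u`, `u(x,0) = φ(x)`, `∂ₜ u(x,0) = ψ(x)`. -/
structure IsClassicalWaveSolution (φ ψ : ℝ → ℝ) (u : ℝ → ℝ → ℝ) : Prop where
  smooth : ContDiffOn ℝ 2 (fun p : ℝ × ℝ => u p.1 p.2) (univ ×ˢ Ici 0)
  equation : ∀ x t : ℝ, 0 < t →
    iteratedDeriv 2 (fun s => u x s) t = iteratedDeriv 2 (fun y => u y t) x
  initial_value : ∀ x, u x 0 = φ x
  initial_velocity : ∀ x, derivWithin (fun s => u x s) (Ici 0) 0 = ψ x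

/-- `∂ₜ u(x,t)` for `t ≥ 0` (one-sided at `t = 0`). -/
noncomputable def timeDeriv (u : ℝ → ℝ → ℝ) (x t : ℝ) : ℝ :=
  derivWithin (fun s => u x s) (Ici 0) t

/-- `∂ₓ u(x,t)`. -/
noncomputable def spaceDeriv (u : ℝ → ℝ → ℝ) (x t : ℝ) : ℝ :=
  deriv (fun y => u y t) x

/-- The squared norm of `H = L²[0,1)`. -/
noncomputable def normSqH (g : ℝ → ℝ) : ℝ≥0∞ := ∫⁻ x in Ico (0 : ℝ) 1, ‖g x‖ₑ ^ 2

/-- The inner product of `H = L²[0,1)`. -/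
noncomputable def innerH (g h : ℝ → ℝ) : ℝ := ∫ x in Ico (0 : ℝ) 1, g x * h x

/-- The error `𝔼 ‖v^{n,N}(·,t) - ∂ₜu(·,t)‖_H² + 𝔼 ‖w^{n,N}(·,t) - ∂ₓu(·,t)‖_H²`. -/
noncomputable def meanSqError (u : ℝ → ℝ → ℝ) (n N : ℕ) {Ω : Type*} [MeasurableSpace Ω]
    (P : Measure Ω) (X : ℝ≥0 → Ω → State (ZMod n) (ZMod n)) (t : ℝ≥0) : ℝ≥0∞ :=
  (∫⁻ ω, normSqH (fun x => velocityField n N (X t ω) x - timeDeriv u x t) ∂P) +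
    ∫⁻ ω, normSqH (fun x => strainField n N (X t ω) x - spaceDeriv u x t) ∂P

set_option linter.unusedSectionVars false

/-! ### Differential inequalities and primitives on the half-line -/

/-! Collect the vertex and edge values in a vector c of length 2n. Coordinate i fires at rate n|c_i|
and adds sgn(c_i) times row i of a skew-symmetric matrix J; for n ≥ 2 each row has one entry 1, one
entry -1 and zeros elsewhere. Since |a| sgn a = a, the drift is linear although the rates are not,
and the mean m = E c solves m' = n Jᵀm, a finite-difference form of ∂ₜv = ∂ₓw, ∂ₜw = ∂ₓv. Skewness
conserves |m|². Hence the rounding error O(1/N) and the consistency error O(1/n) are not amplified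
by the large factor n, and m/N is close to the d'Alembert solution however n and N are related
(`sum_mean_error_le`, `meanBias_le`).

The fluctuations decide the regime, because Err is total variance plus squared bias
(`meanSqError_eq`). In the trace of the covariance the skew drift cancels again, and only the jump
noise remains: its derivative is n Σ_k E|c_k| |J_k|², which is 2n Σ_k E|c_k| for n ≥ 2. On bounded
time intervals the sum is of order nN. The upper bound, with a constant depending on n/N, follows
from 2|a| ≤ a²/N + N and Gronwall (`sum_moment_le`, `sum_cov_le`). The lower bound holds since
E|c_k| ≥ |m_k| and m/N is near a nonzero wave of conserved energy (`le_sum_absMean`). After division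
by nN² the total variance is comparable to (n/N)t, so it vanishes, stays of order one, or diverges
according to the limit of N/n.

In the critical regime the variance persists but is spread over many directions. The drift does not
change the Hilbert–Schmidt norm of the covariance matrix either, and the noise makes its square at
most of order n²·nN² (`sum_cov_sq_le`); relative to the scale nN² the norm is of order (n/N²)^(1/2),
which tends to 0. It bounds the variance of [v, η]_H for each fixed η. Cauchy–Schwarz in time then
carries both kinds of velocity estimate over to the displacement, uniformly on [0, T].

Two preliminaries are needed. The martingale problem only admits finitely supported test functions,
so Dynkin's formula is extended to polynomial growth by means of the Lyapunov function 1 + Σ|c_i|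
(`SolvesDynkin.hasDerivWithinAt`). The given classical solution is identified with d'Alembert's
formula along characteristics (`timeDeriv_add_spaceDeriv`). -/

lemma le_exp_mul_of_deriv_le {y y' : ℝ → ℝ} {a b : ℝ} (ha : 0 ≤ a) (hb : 0 ≤ b) {T : ℝ}
    (hy : ∀ t, 0 ≤ t → HasDerivWithinAt y (y' t) (Ici 0) t)
    (h : ∀ t, 0 ≤ t → t ≤ T → y' t ≤ a * y t + b) (hT : 0 ≤ T) :
    y T ≤ (y 0 + b * T) * Real.exp (a * T) := by
  have hz : ∀ t, 0 ≤ t → HasDerivWithinAt (fun t => y t * Real.exp (-(a * t)) - b * t)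
      (y' t * Real.exp (-(a * t)) + y t * (Real.exp (-(a * t)) * (-(a * 1))) - b * 1) (Ici 0) t := by
    intro t ht
    have h1 : HasDerivAt (fun t => Real.exp (-(a * t))) (Real.exp (-(a * t)) * (-(a * 1))) t :=
      (((hasDerivAt_id t).const_mul a).neg).exp
    exact ((hy t ht).mul h1.hasDerivWithinAt).sub
      (((hasDerivAt_id t).const_mul b).hasDerivWithinAt)
  -- Integrating factor: the derivative is (y' - a y) e^(-at) - b ≤ b (e^(-at) - 1) ≤ 0.
  have hanti : AntitoneOn (fun t => y t * Real.exp (-(a * t)) - b * t) (Icc 0 T) := by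
    apply antitoneOn_of_deriv_nonpos (convex_Icc 0 T)
    · intro t ht
      exact ((hz t ht.1).continuousWithinAt).mono Icc_subset_Ici_self
    · intro t ht
      rw [interior_Icc] at ht
      exact ((hz t ht.1.le).hasDerivAt (Ici_mem_nhds ht.1)).differentiableAt.differentiableWithinAt
    · intro t ht
      rw [interior_Icc] at ht
      rw [((hz t ht.1.le).hasDerivAt (Ici_mem_nhds ht.1)).deriv]
      have h1 := h t ht.1.le ht.2.le
      have h2 : Real.exp (-(a * t)) ≤ 1 := by
        rw [Real.exp_le_one_iff]; nlinarith [mul_nonneg ha ht.1.le]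
      have h3 := Real.exp_pos (-(a * t))
      nlinarith [mul_nonneg (sub_nonneg.2 h1) h3.le, mul_nonneg hb (sub_nonneg.2 h2)]
  have h0 := hanti (left_mem_Icc.2 hT) (right_mem_Icc.2 hT) hT
  simp only [mul_zero, neg_zero, Real.exp_zero, mul_one, sub_zero] at h0
  rw [Real.exp_neg] at h0
  have he := Real.exp_pos (a * T)
  have : y T * (Real.exp (a * T))⁻¹ ≤ y 0 + b * T := by linarith
  rwa [← div_eq_mul_inv, div_le_iff₀ he] at this

lemma add_mul_le_of_deriv_ge {y y' : ℝ → ℝ} {b T : ℝ}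
    (hy : ∀ t, 0 ≤ t → HasDerivWithinAt y (y' t) (Ici 0) t)
    (h : ∀ t, 0 ≤ t → t ≤ T → b ≤ y' t) (hT : 0 ≤ T) : y 0 + b * T ≤ y T := by
  have := le_exp_mul_of_deriv_le (y := fun t => -(y t) + b * t) (y' := fun t => -(y' t) + b * 1)
    (a := 0) (b := 0) (T := T) le_rfl le_rfl
    (fun t ht => (hy t ht).neg.add ((hasDerivAt_id t).const_mul b).hasDerivWithinAt)
    (fun t ht hT => by have := h t ht hT; linarith) hT
  simp at this
  linarith

lemma eq_of_deriv_eq_zero {y : ℝ → ℝ} {T : ℝ}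
    (hy : ∀ t, 0 ≤ t → HasDerivWithinAt y 0 (Ici 0) t) (hT : 0 ≤ T) : y T = y 0 := by
  apply le_antisymm
  · have := le_exp_mul_of_deriv_le (a := 0) (b := 0) le_rfl le_rfl hy (T := T) (by simp) hT
    simpa using this
  · have := add_mul_le_of_deriv_ge (b := 0) (T := T) hy (by simp) hT
    simpa using this

/-- Replacing the integrand by s ↦ g (max s 0) makes it continuous on the whole line, so the
fundamental theorem of calculus applies also at the endpoint 0. -/
lemma hasDerivWithinAt_of_eq_integral {y g : ℝ → ℝ} {y₀ : ℝ} (hg : ContinuousOn g (Ici 0))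
    (h : ∀ t, 0 ≤ t → y t = y₀ + ∫ s in (0 : ℝ)..t, g s) {t : ℝ} (ht : 0 ≤ t) :
    HasDerivWithinAt y (g t) (Ici 0) t := by
  have hc : Continuous (fun s => g (max s 0)) :=
    hg.comp_continuous (by fun_prop) (fun s => mem_Ici.2 (le_max_right _ _))
  have h1 : HasDerivAt (fun t => y₀ + ∫ s in (0 : ℝ)..t, g (max s 0)) (g (max t 0)) t :=
    (hc.integral_hasStrictDerivAt 0 t).hasDerivAt.const_add y₀
  rw [max_eq_left ht] at h1
  have key : ∀ t, 0 ≤ t → y t = y₀ + ∫ s in (0 : ℝ)..t, g (max s 0) := by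
    intro t ht
    rw [h t ht]
    congr 1
    apply intervalIntegral.integral_congr
    intro s hs
    rw [uIcc_of_le ht] at hs
    simp [max_eq_left hs.1]
  exact h1.hasDerivWithinAt.congr (fun s hs => key s hs) (key t ht)

lemma continuousOn_of_eq_integral {y g : ℝ → ℝ} {y₀ : ℝ} (hm : Measurable g)
    (hb : ∀ T, 0 ≤ T → ∃ M, ∀ s ∈ Icc 0 T, |g s| ≤ M)
    (h : ∀ t, 0 ≤ t → y t = y₀ + ∫ s in (0 : ℝ)..t, g s) : ContinuousOn y (Ici 0) := by
  intro t ht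
  have ht : 0 ≤ t := ht
  obtain ⟨M, hM⟩ := hb (t + 1) (by linarith)
  have hint : IntegrableOn g (uIcc 0 (t + 1)) := by
    rw [uIcc_of_le (by linarith)]
    exact Measure.integrableOn_of_bounded (M := M) (by simp) hm.aestronglyMeasurable
      ((ae_restrict_iff' measurableSet_Icc).2 (ae_of_all _ hM))
  have hc := (intervalIntegral.continuousOn_primitive_interval hint).const_add y₀
  rw [uIcc_of_le (by linarith)] at hc
  have hc' : ContinuousOn y (Icc 0 (t + 1)) := hc.congr (fun s hs => h s hs.1)
  refine (hc' t ⟨ht, by linarith⟩).mono_of_mem_nhdsWithin ?_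
  rw [← Ici_inter_Iic]
  exact inter_mem_nhdsWithin _ (Iic_mem_nhds (by linarith))

/-! ### Pure jump processes and Dynkin's formula -/

section Jump

variable {ι S Ω : Type*} [Fintype ι]

/-- The generator of the jump process with transitions `x ↦ τ i x` at rates `r i x`. -/
def jumpGenerator (r : ι → S → ℝ) (τ : ι → S → S) (F : S → ℝ) (x : S) : ℝ :=
  ∑ i, r i x * (F (τ i x) - F x)

/-- A function with finite sublevel sets that controls the rates and has bounded increments. -/
structure IsLyapunov (r : ι → S → ℝ) (τ : ι → S → S) (h : S → ℝ) (K : ℝ) : Prop where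
  one_le : ∀ x, 1 ≤ h x
  finite_sublevel : ∀ R, {x | h x ≤ R}.Finite
  rate_nonneg : ∀ i x, 0 ≤ r i x
  rate_le : ∀ i x, r i x ≤ K * h x
  abs_jump_le : ∀ i x, |h (τ i x) - h x| ≤ 2

/-- A jointly measurable process that satisfies Dynkin's formula for finitely supported test
functions. -/
structure SolvesDynkin [MeasurableSpace S] [MeasurableSpace Ω] (r : ι → S → ℝ) (τ : ι → S → S)
    (x₀ : S) (P : Measure Ω) (X : ℝ → Ω → S) : Prop where
  measurable : Measurable (fun p : ℝ × Ω => X p.1 p.2)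
  dynkin : ∀ F : S → ℝ, F.support.Finite → ∀ t, 0 ≤ t →
    ∫ ω, F (X t ω) ∂P = F x₀ + ∫ ω, (∫ s in (0 : ℝ)..t, jumpGenerator r τ F (X s ω)) ∂P

variable [MeasurableSpace S] [DiscreteMeasurableSpace S] [MeasurableSpace Ω]
  {r : ι → S → ℝ} {τ : ι → S → S} {h : S → ℝ} {K : ℝ} {x₀ : S} {P : Measure Ω}
  [IsProbabilityMeasure P] {X : ℝ → Ω → S}

lemma IsLyapunov.K_nonneg [Nonempty ι] (hL : IsLyapunov r τ h K) (x : S) : 0 ≤ K := by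
  have h1 := hL.rate_nonneg (Classical.arbitrary ι) x
  have h2 := hL.rate_le (Classical.arbitrary ι) x
  have h3 := hL.one_le x
  by_contra! h4
  nlinarith

/-- A jump changes `h` by at most 2, so the generator of a function supported in {h ≤ R} vanishes
where h > R + 2. Finitely supported functions are thus stable under the generator, which can
therefore be iterated. -/
lemma IsLyapunov.finite_support_generator (hL : IsLyapunov r τ h K) {F : S → ℝ}
    (hF : F.support.Finite) : (jumpGenerator r τ F).support.Finite := by
  obtain ⟨R, hR⟩ : ∃ R, ∀ x ∈ F.support, h x ≤ R := by
    obtain ⟨R, hR⟩ := (hF.image h).bddAbove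
    exact ⟨R, fun x hx => hR (mem_image_of_mem _ hx)⟩
  refine (hL.finite_sublevel (R + 2)).subset ?_
  intro x hx
  by_contra hx2
  simp only [mem_ofPred_eq, not_le] at hx2
  apply hx
  refine Finset.sum_eq_zero fun i _ => ?_
  have h1 : F x = 0 := by
    by_contra hne
    have := hR x hne
    linarith
  have h2 : F (τ i x) = 0 := by
    by_contra hne
    have := hR _ hne
    have h3 := (abs_le.1 (hL.abs_jump_le i x)).1
    linarith
  simp [h1, h2]

lemma exists_bound_of_finite_support {F : S → ℝ} (hF : F.support.Finite) :
    ∃ M, ∀ x, |F x| ≤ M := by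
  obtain ⟨M, hM⟩ := (hF.image (fun x => |F x|)).bddAbove
  refine ⟨max M 0, fun x => ?_⟩
  by_cases hx : F x = 0
  · simp [hx]
  · exact le_max_of_le_left (hM (mem_image_of_mem (fun x => |F x|) hx))

lemma SolvesDynkin.measurable_comp (hX : SolvesDynkin r τ x₀ P X) (F : S → ℝ) :
    Measurable (fun p : ℝ × Ω => F (X p.1 p.2)) :=
  (Measurable.of_discrete (f := F)).comp hX.measurable

lemma SolvesDynkin.measurable_apply (hX : SolvesDynkin r τ x₀ P X) (F : S → ℝ) (t : ℝ) :
    Measurable (fun ω => F (X t ω)) :=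
  (hX.measurable_comp F).comp measurable_prodMk_left

lemma SolvesDynkin.measurable_expectation (hX : SolvesDynkin r τ x₀ P X) (F : S → ℝ) :
    Measurable (fun t => ∫ ω, F (X t ω) ∂P) :=
  ((hX.measurable_comp F).stronglyMeasurable.integral_prod_right).measurable

lemma abs_expectation_le (Y : Ω → ℝ) {M : ℝ} (hM : ∀ x, |Y x| ≤ M) : |∫ ω, Y ω ∂P| ≤ M := by
  have := norm_integral_le_of_norm_le_const (μ := P) (f := Y) (ae_of_all _ hM)
  simpa using this

lemma SolvesDynkin.expectation_eq (hX : SolvesDynkin r τ x₀ P X) (hL : IsLyapunov r τ h K)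
    {F : S → ℝ} (hF : F.support.Finite) {t : ℝ} (ht : 0 ≤ t) :
    ∫ ω, F (X t ω) ∂P =
      F x₀ + ∫ s in (0 : ℝ)..t, ∫ ω, jumpGenerator r τ F (X s ω) ∂P := by
  obtain ⟨M, hM⟩ := exists_bound_of_finite_support (hL.finite_support_generator hF)
  rw [hX.dynkin F hF t ht]
  congr 1
  simp only [intervalIntegral.integral_of_le ht]
  rw [integral_integral_swap]
  refine Integrable.of_bound (C := M) ?_ (ae_of_all _ fun p => hM _)
  exact ((hX.measurable_comp _).comp measurable_swap).aestronglyMeasurable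

/-- Dynkin's formula is used twice: applied to the generator of `F` it shows that the integrand in
the formula for `F` is continuous in time, so that the formula may be differentiated. -/
lemma SolvesDynkin.hasDerivWithinAt_of_finite (hX : SolvesDynkin r τ x₀ P X)
    (hL : IsLyapunov r τ h K) {F : S → ℝ} (hF : F.support.Finite) {t : ℝ} (ht : 0 ≤ t) :
    HasDerivWithinAt (fun t => ∫ ω, F (X t ω) ∂P) (∫ ω, jumpGenerator r τ F (X t ω) ∂P)
      (Ici 0) t := by
  have hF1 := hL.finite_support_generator hF
  obtain ⟨M, hM⟩ := exists_bound_of_finite_support (hL.finite_support_generator hF1)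
  refine hasDerivWithinAt_of_eq_integral (y₀ := F x₀)
    (g := fun t => ∫ ω, jumpGenerator r τ F (X t ω) ∂P) ?_
    (fun t ht => hX.expectation_eq hL hF ht) ht
  exact continuousOn_of_eq_integral (hX.measurable_expectation _)
    (fun T _ => ⟨M, fun s _ => abs_expectation_le _ fun ω => hM _⟩)
    (fun t ht => hX.expectation_eq hL hF1 ht)

/-! ### Polynomial moments, and Dynkin's formula for test functions of polynomial growth -/

lemma exists_mul_pow_sub_pow_le (p : ℕ) :
    ∃ C : ℝ, 0 ≤ C ∧ ∀ x : ℝ, 1 ≤ x → x * ((x + 2) ^ p - x ^ p) ≤ C * x ^ p := by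
  induction p with
  | zero => exact ⟨0, le_rfl, by simp⟩
  | succ p ih =>
    obtain ⟨C, hC, h⟩ := ih
    refine ⟨3 * C + 2, by linarith, fun x hx => ?_⟩
    have h1 := h x hx
    have h2 : 0 ≤ x ^ p := by positivity
    have h3 : x * ((x + 2) ^ (p + 1) - x ^ (p + 1)) =
      (x + 2) * (x * ((x + 2) ^ p - x ^ p)) + 2 * (x ^ p * x) := by ring
    rw [h3]
    have h4 : (x + 2) * (x * ((x + 2) ^ p - x ^ p)) ≤ (x + 2) * (C * x ^ p) :=
      mul_le_mul_of_nonneg_left h1 (by linarith)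
    have h5 : (x + 2) * (C * x ^ p) ≤ (3 * x) * (C * x ^ p) :=
      mul_le_mul_of_nonneg_right (by linarith) (by positivity)
    calc _ ≤ (3 * x) * (C * x ^ p) + 2 * (x ^ p * x) := by linarith
      _ = (3 * C + 2) * x ^ (p + 1) := by ring

/-- The constant does not depend on the truncation level `R`, which is what survives the limit R →
∞. The rates grow linearly in `h` and jumps are bounded, so the generator multiplies h^p by at most
a constant. Subtracting `R` leaves the generator unchanged and gives the truncated power finite
support when p ≥ 1. -/
lemma IsLyapunov.exists_generator_min_le [Nonempty ι] (hL : IsLyapunov r τ h K) (x₁ : S) (p : ℕ) :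
    ∃ C, 0 ≤ C ∧ ∀ R, 0 ≤ R → ∀ x,
      jumpGenerator r τ (fun x => min (h x ^ p) R - R) x ≤ C * min (h x ^ p) R := by
  obtain ⟨C, hC, hp⟩ := exists_mul_pow_sub_pow_le p
  have hK := hL.K_nonneg x₁
  refine ⟨Fintype.card ι * (K * C), by positivity, fun R hR x => ?_⟩
  have hx := hL.one_le x
  have hmin : 0 ≤ min (h x ^ p) R := le_min (by positivity) hR
  rw [mul_assoc, ← nsmul_eq_mul]
  refine Finset.sum_le_card_nsmul _ _ _ fun i _ => ?_
  beta_reduce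
  by_cases hxR : h x ^ p ≤ R
  · rw [min_eq_left hxR]
    have h1 : h (τ i x) ≤ h x + 2 := by linarith [(abs_le.1 (hL.abs_jump_le i x)).2]
    have h2 : h (τ i x) ^ p ≤ (h x + 2) ^ p :=
      pow_le_pow_left₀ (by linarith [hL.one_le (τ i x)]) h1 p
    have h3 : h x ^ p ≤ (h x + 2) ^ p := pow_le_pow_left₀ (by linarith) (by linarith) p
    calc r i x * (min (h (τ i x) ^ p) R - R - (h x ^ p - R))
        ≤ r i x * ((h x + 2) ^ p - h x ^ p) :=
          mul_le_mul_of_nonneg_left (by linarith [min_le_left (h (τ i x) ^ p) R])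
            (hL.rate_nonneg i x)
      _ ≤ (K * h x) * ((h x + 2) ^ p - h x ^ p) :=
          mul_le_mul_of_nonneg_right (hL.rate_le i x) (by linarith)
      _ = K * (h x * ((h x + 2) ^ p - h x ^ p)) := by ring
      _ ≤ K * (C * h x ^ p) := mul_le_mul_of_nonneg_left (hp _ hx) hK
      _ = K * C * h x ^ p := by ring
  -- Above the truncation level the truncated power is maximal, so no jump can increase it.
  · rw [min_eq_right (not_le.1 hxR).le]
    have : r i x * (min (h (τ i x) ^ p) R - R - (R - R)) ≤ 0 :=
      mul_nonpos_of_nonneg_of_nonpos (hL.rate_nonneg i x)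
        (by linarith [min_le_right (h (τ i x) ^ p) R])
    exact this.trans (by positivity)

/-- Gronwall for the truncated powers gives a bound uniform in the truncation level, and monotone
convergence removes the truncation. -/
lemma SolvesDynkin.exists_lintegral_pow_le [Nonempty ι] (hX : SolvesDynkin r τ x₀ P X)
    (hL : IsLyapunov r τ h K) (p : ℕ) (T : ℝ) :
    ∃ M : ℝ≥0, ∀ t ∈ Icc 0 T, ∫⁻ ω, ENNReal.ofReal (h (X t ω) ^ p) ∂P ≤ M := by
  obtain ⟨C, hC, hgen⟩ := hL.exists_generator_min_le x₀ (p + 1)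
  have hone : 0 ≤ h x₀ := by linarith [hL.one_le x₀]
  refine ⟨(h x₀ ^ (p + 1) * Real.exp (C * T)).toNNReal, fun t ht => ?_⟩
  have hmeas : ∀ R : ℝ, Measurable fun ω => min (h (X t ω) ^ (p + 1)) R := fun R =>
    hX.measurable_apply (fun x => min (h x ^ (p + 1)) R) t
  have hbound : ∀ R : ℝ, 0 ≤ R →
      ∫⁻ ω, ENNReal.ofReal (min (h (X t ω) ^ (p + 1)) R) ∂P ≤
        ENNReal.ofReal (h x₀ ^ (p + 1) * Real.exp (C * T)) := by
    intro R hR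
    have hnn : ∀ x, 0 ≤ min (h x ^ (p + 1)) R := fun x =>
      le_min (pow_nonneg (by linarith [hL.one_le x]) _) hR
    have hint : ∀ s, Integrable (fun ω => min (h (X s ω) ^ (p + 1)) R) P := fun s =>
      Integrable.of_bound
        (hX.measurable_apply (fun x => min (h x ^ (p + 1)) R) s).aestronglyMeasurable R
        (ae_of_all _ fun ω => by
          rw [Real.norm_eq_abs, abs_of_nonneg (hnn _)]; exact min_le_right _ _)
    rw [← ofReal_integral_eq_lintegral_ofReal (hint t) (ae_of_all _ fun ω => hnn _)]
    apply ENNReal.ofReal_le_ofReal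
    -- The exponent p + 1 instead of p ensures h ≤ h^(p+1), so the support lies in a sublevel set of
    -- `h`; for exponent 0 it could be the whole state space.
    have hsupp : (fun x => min (h x ^ (p + 1)) R - R).support.Finite := by
      refine (hL.finite_sublevel R).subset fun x hx => ?_
      by_contra hxR
      simp only [mem_ofPred_eq, not_le] at hxR
      apply hx
      have h1 : h x ^ 1 ≤ h x ^ (p + 1) := pow_le_pow_right₀ (hL.one_le x) (by omega)
      simp only
      rw [min_eq_right (by linarith [pow_one (h x)]), sub_self]
    obtain ⟨M', hM'⟩ := exists_bound_of_finite_support (hL.finite_support_generator hsupp)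
    have hE : ∀ s, ∫ ω, (min (h (X s ω) ^ (p + 1)) R - R) ∂P =
        ∫ ω, min (h (X s ω) ^ (p + 1)) R ∂P - R := fun s => by
      rw [integral_sub (hint s) (integrable_const _)]; simp
    have hd : ∀ s, 0 ≤ s → HasDerivWithinAt (fun t => ∫ ω, min (h (X t ω) ^ (p + 1)) R ∂P)
        (∫ ω, jumpGenerator r τ (fun x => min (h x ^ (p + 1)) R - R) (X s ω) ∂P) (Ici 0) s := by
      intro s hs
      have := (hX.hasDerivWithinAt_of_finite hL hsupp hs).add_const R
      refine this.congr (fun s _ => ?_) ?_ <;> simp [hE]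
    have hle := le_exp_mul_of_deriv_le hC le_rfl hd (T := t) (fun s _ _ => by
      rw [add_zero, ← integral_const_mul]
      refine integral_mono ?_ ((hint s).const_mul C) (fun ω => hgen R hR _)
      exact Integrable.of_bound (hX.measurable_apply _ s).aestronglyMeasurable M'
        (ae_of_all _ fun ω => hM' _)) ht.1
    have h0 : ∫ ω, min (h (X 0 ω) ^ (p + 1)) R ∂P ≤ h x₀ ^ (p + 1) := by
      have h1 := hX.expectation_eq hL hsupp (t := 0) le_rfl
      simp only [hE, intervalIntegral.integral_same, add_zero] at h1
      have h2 := min_le_left (h x₀ ^ (p + 1)) R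
      linarith
    refine hle.trans ?_
    rw [zero_mul, add_zero]
    gcongr
    exact ht.2
  calc ∫⁻ ω, ENNReal.ofReal (h (X t ω) ^ p) ∂P
      ≤ ∫⁻ ω, ⨆ m : ℕ, ENNReal.ofReal (min (h (X t ω) ^ (p + 1)) m) ∂P := by
        refine lintegral_mono fun ω => ?_
        obtain ⟨m, hm⟩ := exists_nat_ge (h (X t ω) ^ (p + 1))
        refine le_trans ?_ (le_iSup _ m)
        rw [min_eq_left hm]
        exact ENNReal.ofReal_le_ofReal (pow_le_pow_right₀ (hL.one_le _) (by omega))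
    _ = ⨆ m : ℕ, ∫⁻ ω, ENNReal.ofReal (min (h (X t ω) ^ (p + 1)) m) ∂P := by
        refine lintegral_iSup (fun m => (hmeas m).ennreal_ofReal) ?_
        intro a b hab ω
        exact ENNReal.ofReal_le_ofReal (min_le_min le_rfl (Nat.cast_le.2 hab))
    _ ≤ _ := iSup_le fun m => hbound m (Nat.cast_nonneg m)

/-- `F` grows at most polynomially with respect to `h`. -/
def HasPolyGrowth (h F : S → ℝ) : Prop := ∃ C : ℝ, ∃ p : ℕ, 0 ≤ C ∧ ∀ x, |F x| ≤ C * h x ^ p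

lemma SolvesDynkin.exists_expectation_bound [Nonempty ι] (hX : SolvesDynkin r τ x₀ P X)
    (hL : IsLyapunov r τ h K) (p : ℕ) (T : ℝ) :
    ∃ M : ℝ, ∀ t ∈ Icc 0 T, Integrable (fun ω => h (X t ω) ^ p) P ∧
      ∫ ω, h (X t ω) ^ p ∂P ≤ M := by
  obtain ⟨M, hM⟩ := hX.exists_lintegral_pow_le hL p T
  have hnn : ∀ x, 0 ≤ h x ^ p := fun x => pow_nonneg (by linarith [hL.one_le x]) _
  refine ⟨M, fun t ht => ⟨⟨(hX.measurable_apply (fun x => h x ^ p) t).aestronglyMeasurable, ?_⟩, ?_⟩⟩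
  · rw [hasFiniteIntegral_iff_ofReal (ae_of_all _ fun ω => hnn _)]
    exact (hM t ht).trans_lt ENNReal.coe_lt_top
  · rw [integral_eq_lintegral_of_nonneg_ae (ae_of_all _ fun ω => hnn _)
      (hX.measurable_apply (fun x => h x ^ p) t).aestronglyMeasurable]
    exact ENNReal.toReal_le_of_le_ofReal M.2 (by simpa using hM t ht)

lemma SolvesDynkin.integrable [Nonempty ι] (hX : SolvesDynkin r τ x₀ P X)
    (hL : IsLyapunov r τ h K) {F : S → ℝ} (hF : HasPolyGrowth h F) {t : ℝ} (ht : 0 ≤ t) :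
    Integrable (fun ω => F (X t ω)) P := by
  obtain ⟨C, p, hC, hF⟩ := hF
  obtain ⟨M, hM⟩ := hX.exists_expectation_bound hL p t
  exact (((hM t ⟨ht, le_rfl⟩).1).const_mul C).mono' (hX.measurable_apply F t).aestronglyMeasurable
    (ae_of_all _ fun ω => hF _)

lemma SolvesDynkin.exists_abs_expectation_le [Nonempty ι] (hX : SolvesDynkin r τ x₀ P X)
    (hL : IsLyapunov r τ h K) {F : S → ℝ} (hF : HasPolyGrowth h F) (T : ℝ) :
    ∃ M, ∀ t ∈ Icc 0 T, |∫ ω, F (X t ω) ∂P| ≤ M := by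
  obtain ⟨C, p, hC, hF⟩ := hF
  obtain ⟨M, hM⟩ := hX.exists_expectation_bound hL p T
  refine ⟨C * M, fun t ht => ?_⟩
  calc |∫ ω, F (X t ω) ∂P| ≤ ∫ ω, C * h (X t ω) ^ p ∂P :=
        (Real.norm_eq_abs _).symm.le.trans
          (norm_integral_le_of_norm_le ((hM t ht).1.const_mul C) (ae_of_all _ fun ω => hF _))
    _ = C * ∫ ω, h (X t ω) ^ p ∂P := integral_const_mul _ _
    _ ≤ C * M := mul_le_mul_of_nonneg_left (hM t ht).2 hC

lemma IsLyapunov.abs_generator_le [Nonempty ι] (hL : IsLyapunov r τ h K) {F : S → ℝ} {C : ℝ}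
    {p : ℕ} (hC : 0 ≤ C) (hF : ∀ x, |F x| ≤ C * h x ^ p) (x : S) :
    |jumpGenerator r τ F x| ≤ Fintype.card ι * (K * (C * (3 ^ p + 1))) * h x ^ (p + 1) := by
  have hx := hL.one_le x
  have hK := hL.K_nonneg x
  rw [mul_assoc, ← nsmul_eq_mul]
  refine (Finset.abs_sum_le_sum_abs _ _).trans (Finset.sum_le_card_nsmul _ _ _ fun i _ => ?_)
  have h1 : h (τ i x) ≤ 3 * h x := by linarith [(abs_le.1 (hL.abs_jump_le i x)).2]
  have h2 : h (τ i x) ^ p ≤ (3 * h x) ^ p :=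
    pow_le_pow_left₀ (by linarith [hL.one_le (τ i x)]) h1 p
  rw [mul_pow] at h2
  have h3 : |F (τ i x) - F x| ≤ C * (3 ^ p + 1) * h x ^ p := by
    calc |F (τ i x) - F x| ≤ |F (τ i x)| + |F x| := abs_sub _ _
      _ ≤ C * h (τ i x) ^ p + C * h x ^ p := add_le_add (hF _) (hF _)
      _ ≤ C * (3 ^ p * h x ^ p) + C * h x ^ p := by gcongr
      _ = _ := by ring
  rw [abs_mul, abs_of_nonneg (hL.rate_nonneg i x)]
  calc r i x * |F (τ i x) - F x| ≤ (K * h x) * (C * (3 ^ p + 1) * h x ^ p) :=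
        mul_le_mul (hL.rate_le i x) h3 (abs_nonneg _) (by positivity)
    _ = _ := by ring

lemma HasPolyGrowth.generator [Nonempty ι] (hL : IsLyapunov r τ h K) {F : S → ℝ}
    (hF : HasPolyGrowth h F) : HasPolyGrowth h (jumpGenerator r τ F) := by
  obtain ⟨C, p, hC, hF⟩ := hF
  by_cases hS : Nonempty S
  · have hK := hL.K_nonneg hS.some
    exact ⟨_, p + 1, by positivity, hL.abs_generator_le hC hF⟩
  · exact ⟨0, 0, le_rfl, fun x => (hS ⟨x⟩).elim⟩

/-- `F` is cut off to {h ≤ m}. At each state the truncations and their generators are eventually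
equal to the untruncated ones, and the moment bounds dominate both sides, including the time
integral. -/
lemma SolvesDynkin.expectation_eq_of_polyGrowth [Nonempty ι] (hX : SolvesDynkin r τ x₀ P X)
    (hL : IsLyapunov r τ h K) {F : S → ℝ} (hF : HasPolyGrowth h F) {t : ℝ} (ht : 0 ≤ t) :
    ∫ ω, F (X t ω) ∂P =
      F x₀ + ∫ s in (0 : ℝ)..t, ∫ ω, jumpGenerator r τ F (X s ω) ∂P := by
  obtain ⟨C, p, hC, hF⟩ := hF
  set Fm : ℕ → S → ℝ := fun m => indicator {x | h x ≤ m} F with hFm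
  have hsupp : ∀ m, (Fm m).support.Finite := fun m =>
    (hL.finite_sublevel m).subset support_indicator_subset
  have hFmb : ∀ m x, |Fm m x| ≤ C * h x ^ p := fun m x =>
    (norm_indicator_le_norm_self F x).trans (hF x)
  have hlim : ∀ x, ∀ᶠ m : ℕ in atTop, Fm m x = F x := by
    intro x
    obtain ⟨m₀, hm₀⟩ := exists_nat_ge (h x)
    filter_upwards [eventually_ge_atTop m₀] with m hm
    exact indicator_of_mem (show x ∈ {x | h x ≤ m} from hm₀.trans (Nat.cast_le.2 hm)) F
  have hlimG : ∀ x, ∀ᶠ m : ℕ in atTop, jumpGenerator r τ (Fm m) x = jumpGenerator r τ F x := by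
    intro x
    filter_upwards [hlim x, eventually_all.2 fun i => hlim (τ i x)] with m h1 h2
    simp [jumpGenerator, h1, h2]
  have htend : ∀ x, Tendsto (fun m => Fm m x) atTop (𝓝 (F x)) := fun x =>
    tendsto_const_nhds.congr' ((hlim x).mono fun m hm => hm.symm)
  have htendG : ∀ x, Tendsto (fun m => jumpGenerator r τ (Fm m) x) atTop
      (𝓝 (jumpGenerator r τ F x)) := fun x =>
    tendsto_const_nhds.congr' ((hlimG x).mono fun m hm => hm.symm)
  obtain ⟨M, hM⟩ := hX.exists_expectation_bound hL p t
  obtain ⟨M', hM'⟩ := hX.exists_expectation_bound hL (p + 1) t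
  set C' := Fintype.card ι * (K * (C * (3 ^ p + 1))) with hC'
  have hK := hL.K_nonneg x₀
  have hC'0 : 0 ≤ C' := by positivity
  have hG : ∀ m x, |jumpGenerator r τ (Fm m) x| ≤ C' * h x ^ (p + 1) := fun m x =>
    hL.abs_generator_le hC (hFmb m) x
  have h1 : Tendsto (fun m => ∫ ω, Fm m (X t ω) ∂P) atTop (𝓝 (∫ ω, F (X t ω) ∂P)) :=
    tendsto_integral_of_dominated_convergence (fun ω => C * h (X t ω) ^ p)
      (fun m => (hX.measurable_apply _ t).aestronglyMeasurable)
      ((hM t ⟨ht, le_rfl⟩).1.const_mul C) (fun m => ae_of_all _ fun ω => hFmb m _)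
      (ae_of_all _ fun ω => htend _)
  have h2 : Tendsto (fun m => Fm m x₀ + ∫ s in (0 : ℝ)..t, ∫ ω, jumpGenerator r τ (Fm m) (X s ω) ∂P)
      atTop (𝓝 (F x₀ + ∫ s in (0 : ℝ)..t, ∫ ω, jumpGenerator r τ F (X s ω) ∂P)) := by
    refine (htend x₀).add ?_
    refine intervalIntegral.tendsto_integral_filter_of_dominated_convergence (fun _ => C' * M')
      (Eventually.of_forall fun m => (hX.measurable_expectation _).aestronglyMeasurable)
      (Eventually.of_forall fun m => ae_of_all _ fun s hs => ?_)
      (by simp) (ae_of_all _ fun s hs => ?_)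
    · rw [uIoc_of_le ht] at hs
      have hs' : s ∈ Icc 0 t := ⟨hs.1.le, hs.2⟩
      calc ‖∫ ω, jumpGenerator r τ (Fm m) (X s ω) ∂P‖ ≤ ∫ ω, C' * h (X s ω) ^ (p + 1) ∂P :=
            norm_integral_le_of_norm_le ((hM' s hs').1.const_mul C') (ae_of_all _ fun ω => hG m _)
        _ = C' * ∫ ω, h (X s ω) ^ (p + 1) ∂P := integral_const_mul _ _
        _ ≤ C' * M' := mul_le_mul_of_nonneg_left (hM' s hs').2 hC'0
    · rw [uIoc_of_le ht] at hs
      have hs' : s ∈ Icc 0 t := ⟨hs.1.le, hs.2⟩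
      exact tendsto_integral_of_dominated_convergence (fun ω => C' * h (X s ω) ^ (p + 1))
        (fun m => (hX.measurable_apply _ s).aestronglyMeasurable)
        ((hM' s hs').1.const_mul C') (fun m => ae_of_all _ fun ω => hG m _)
        (ae_of_all _ fun ω => htendG _)
  refine tendsto_nhds_unique h1 (h2.congr fun m => ?_)
  exact (hX.expectation_eq hL (hsupp m) ht).symm

theorem SolvesDynkin.hasDerivWithinAt [Nonempty ι] (hX : SolvesDynkin r τ x₀ P X)
    (hL : IsLyapunov r τ h K) {F : S → ℝ} (hF : HasPolyGrowth h F) {t : ℝ} (ht : 0 ≤ t) :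
    HasDerivWithinAt (fun t => ∫ ω, F (X t ω) ∂P) (∫ ω, jumpGenerator r τ F (X t ω) ∂P)
      (Ici 0) t := by
  have hF1 := hF.generator hL
  refine hasDerivWithinAt_of_eq_integral (y₀ := F x₀)
    (g := fun t => ∫ ω, jumpGenerator r τ F (X t ω) ∂P) ?_
    (fun t ht => hX.expectation_eq_of_polyGrowth hL hF ht) ht
  exact continuousOn_of_eq_integral (hX.measurable_expectation _)
    (fun T _ => hX.exists_abs_expectation_le hL (hF1.generator hL) T)
    (fun t ht => hX.expectation_eq_of_polyGrowth hL hF1 ht)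

lemma SolvesDynkin.expectation_zero [Nonempty ι] (hX : SolvesDynkin r τ x₀ P X)
    (hL : IsLyapunov r τ h K) {F : S → ℝ} (hF : HasPolyGrowth h F) :
    ∫ ω, F (X 0 ω) ∂P = F x₀ := by
  simpa using hX.expectation_eq_of_polyGrowth hL hF le_rfl

end Jump

/-! ### Moments of jump systems with linear, skew-symmetric drift -/

lemma sum_sum_eq_zero_of_antisymm {ι : Type*} [Fintype ι] {a : ι → ι → ℝ}
    (h : ∀ i j, a i j = -a j i) : ∑ i, ∑ j, a i j = 0 := by
  have h1 : ∑ i, ∑ j, a i j = -∑ i, ∑ j, a i j := by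
    conv_lhs => rw [Finset.sum_comm]
    simp only [← Finset.sum_neg_distrib]
    exact Finset.sum_congr rfl fun i _ => Finset.sum_congr rfl fun j _ => h j i
  linarith

section Moments

variable {ι S Ω : Type*} [Fintype ι]

/-- A system of coordinates `c` on the state space, in which the transition `i` happens at rate
`κ |c i|` and adds `σ i = sgn (c i)` times the `i`-th row of a skew-symmetric matrix `J`. -/
structure IsSkewJumpSystem (κ : ℝ) (J : ι → ι → ℝ) (c σ : S → ι → ℝ) (r : ι → S → ℝ)
    (τ : ι → S → S) : Prop where
  nonneg : 0 ≤ κ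
  rate : ∀ i x, r i x = κ * |c x i|
  jump : ∀ i x j, c (τ i x) j = c x j + σ x i * J i j
  abs_mul_sign : ∀ x i, |c x i| * σ x i = c x i
  abs_sign_le : ∀ x i, |σ x i| ≤ 1
  abs_mul_sign_sq : ∀ x i, |c x i| * σ x i ^ 2 = |c x i|
  antisymm : ∀ i j, J i j = -J j i
  abs_le_one : ∀ i j, |J i j| ≤ 1
  sum_abs_le : ∀ i, ∑ j, |J i j| ≤ 2
  finite_sublevel : ∀ R, {x | 1 + ∑ i, |c x i| ≤ R}.Finite

variable {κ : ℝ} {J : ι → ι → ℝ} {c σ : S → ι → ℝ} {r : ι → S → ℝ} {τ : ι → S → S}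

namespace IsSkewJumpSystem

/-- The increment bound 2 is the bound on the absolute row sums of `J`, because the jump is a row
multiplied by a number of absolute value at most 1. -/
lemma isLyapunov (hJ : IsSkewJumpSystem κ J c σ r τ) :
    IsLyapunov r τ (fun x => 1 + ∑ i, |c x i|) κ where
  one_le x := by
    have : 0 ≤ ∑ i, |c x i| := Finset.sum_nonneg fun i _ => abs_nonneg _
    linarith
  finite_sublevel := hJ.finite_sublevel
  rate_nonneg i x := by rw [hJ.rate]; exact mul_nonneg hJ.nonneg (abs_nonneg _)
  rate_le i x := by
    rw [hJ.rate]
    have : |c x i| ≤ ∑ i, |c x i| :=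
      Finset.single_le_sum (f := fun i => |c x i|) (fun i _ => abs_nonneg _) (Finset.mem_univ i)
    exact mul_le_mul_of_nonneg_left (by linarith) hJ.nonneg
  abs_jump_le i x := by
    rw [add_sub_add_left_eq_sub, ← Finset.sum_sub_distrib]
    refine (Finset.abs_sum_le_sum_abs _ _).trans (le_trans ?_ (hJ.sum_abs_le i))
    refine Finset.sum_le_sum fun j _ => (abs_abs_sub_abs_le_abs_sub _ _).trans ?_
    rw [hJ.jump, add_sub_cancel_left, abs_mul]
    exact mul_le_of_le_one_left (abs_nonneg _) (hJ.abs_sign_le x i)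

lemma abs_coord_le (c : S → ι → ℝ) (i : ι) (x : S) : |c x i| ≤ 1 + ∑ i, |c x i| := by
  have : |c x i| ≤ ∑ i, |c x i| :=
    Finset.single_le_sum (f := fun i => |c x i|) (fun i _ => abs_nonneg _) (Finset.mem_univ i)
  linarith

lemma polyGrowth_coord (c : S → ι → ℝ) (i : ι) :
    HasPolyGrowth (fun x => 1 + ∑ i, |c x i|) (fun x => c x i) :=
  ⟨1, 1, zero_le_one, fun x => by simpa using abs_coord_le c i x⟩

lemma polyGrowth_abs_coord (c : S → ι → ℝ) (i : ι) :
    HasPolyGrowth (fun x => 1 + ∑ i, |c x i|) (fun x => |c x i|) :=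
  ⟨1, 1, zero_le_one, fun x => by simpa using abs_coord_le c i x⟩

lemma polyGrowth_mul (c : S → ι → ℝ) (i j : ι) :
    HasPolyGrowth (fun x => 1 + ∑ i, |c x i|) (fun x => c x i * c x j) :=
  ⟨1, 2, zero_le_one, fun x => by
    rw [one_mul, abs_mul, sq]
    exact mul_le_mul (abs_coord_le c i x) (abs_coord_le c j x) (abs_nonneg _)
      ((abs_nonneg _).trans (abs_coord_le c i x))⟩

/-- The identity |c| σ = c removes the absolute value from the rate. This is the reason why the
equation of the means is closed and linear. -/
lemma generator_coord (hJ : IsSkewJumpSystem κ J c σ r τ) (i : ι) (x : S) :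
    jumpGenerator r τ (fun x => c x i) x = κ * ∑ k, c x k * J k i := by
  rw [jumpGenerator, Finset.mul_sum]
  refine Finset.sum_congr rfl fun k _ => ?_
  rw [hJ.rate, hJ.jump, add_sub_cancel_left]
  linear_combination κ * J k i * hJ.abs_mul_sign x k

/-- The first sum is the linear drift acting on each factor. The second is the quadratic variation
of the jumps: since |c| σ² = |c|, the absolute value stays, and the second moments are not closed.
-/
lemma generator_mul (hJ : IsSkewJumpSystem κ J c σ r τ) (i j : ι) (x : S) :
    jumpGenerator r τ (fun x => c x i * c x j) x =
      κ * ∑ k, (c x k * c x i * J k j + c x k * c x j * J k i) +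
        κ * ∑ k, |c x k| * (J k i * J k j) := by
  rw [jumpGenerator, ← mul_add, ← Finset.sum_add_distrib, Finset.mul_sum]
  refine Finset.sum_congr rfl fun k _ => ?_
  rw [hJ.rate, hJ.jump, hJ.jump]
  linear_combination κ * (c x i * J k j + c x j * J k i) * hJ.abs_mul_sign x k +
    κ * J k i * J k j * hJ.abs_mul_sign_sq x k

end IsSkewJumpSystem

variable [MeasurableSpace Ω]

/-- The mean of the `i`-th coordinate at time `t`. -/
noncomputable def coordMean (c : S → ι → ℝ) (P : Measure Ω) (X : ℝ → Ω → S) (t : ℝ) (i : ι) : ℝ :=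
  ∫ ω, c (X t ω) i ∂P

/-- The mean of the absolute value of the `i`-th coordinate at time `t`. -/
noncomputable def coordAbsMean (c : S → ι → ℝ) (P : Measure Ω) (X : ℝ → Ω → S) (t : ℝ)
    (i : ι) : ℝ :=
  ∫ ω, |c (X t ω) i| ∂P

/-- The mixed second moment of two coordinates at time `t`. -/
noncomputable def coordMoment (c : S → ι → ℝ) (P : Measure Ω) (X : ℝ → Ω → S) (t : ℝ)
    (i j : ι) : ℝ :=
  ∫ ω, c (X t ω) i * c (X t ω) j ∂P

/-- The covariance of two coordinates at time `t`. -/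
noncomputable def coordCov (c : S → ι → ℝ) (P : Measure Ω) (X : ℝ → Ω → S) (t : ℝ)
    (i j : ι) : ℝ :=
  coordMoment c P X t i j - coordMean c P X t i * coordMean c P X t j

variable [MeasurableSpace S] [DiscreteMeasurableSpace S]
  {x₀ : S} {P : Measure Ω} [IsProbabilityMeasure P] {X : ℝ → Ω → S} [Nonempty ι]

lemma coordMoment_comm (t : ℝ) (i j : ι) : coordMoment c P X t i j = coordMoment c P X t j i := by
  simp only [coordMoment, mul_comm]

lemma coordCov_comm (t : ℝ) (i j : ι) : coordCov c P X t i j = coordCov c P X t j i := by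
  rw [coordCov, coordCov, coordMoment_comm, mul_comm (coordMean c P X t i)]

lemma coordAbsMean_nonneg (t : ℝ) (i : ι) : 0 ≤ coordAbsMean c P X t i :=
  integral_nonneg fun _ => abs_nonneg _

lemma abs_coordMean_le (t : ℝ) (i : ι) : |coordMean c P X t i| ≤ coordAbsMean c P X t i :=
  abs_integral_le_integral_abs

namespace IsSkewJumpSystem

lemma integrable_coord (hJ : IsSkewJumpSystem κ J c σ r τ) (hX : SolvesDynkin r τ x₀ P X)
    {t : ℝ} (ht : 0 ≤ t) (i : ι) : Integrable (fun ω => c (X t ω) i) P :=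
  hX.integrable hJ.isLyapunov (polyGrowth_coord c i) ht

lemma integrable_mul (hJ : IsSkewJumpSystem κ J c σ r τ) (hX : SolvesDynkin r τ x₀ P X)
    {t : ℝ} (ht : 0 ≤ t) (i j : ι) : Integrable (fun ω => c (X t ω) i * c (X t ω) j) P :=
  hX.integrable hJ.isLyapunov (polyGrowth_mul c i j) ht

lemma hasDerivWithinAt_mean (hJ : IsSkewJumpSystem κ J c σ r τ) (hX : SolvesDynkin r τ x₀ P X)
    {t : ℝ} (ht : 0 ≤ t) (i : ι) :
    HasDerivWithinAt (fun t => coordMean c P X t i) (κ * ∑ k, coordMean c P X t k * J k i)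
      (Ici 0) t := by
  have := hX.hasDerivWithinAt hJ.isLyapunov (polyGrowth_coord c i) ht
  refine this.congr_deriv ?_
  rw [integral_congr_ae (ae_of_all _ fun ω => hJ.generator_coord i (X t ω)), integral_const_mul, integral_finsetSum _ fun k _ => (hJ.integrable_coord hX ht k).mul_const _]
  simp only [integral_mul_const, coordMean]

lemma hasDerivWithinAt_moment (hJ : IsSkewJumpSystem κ J c σ r τ) (hX : SolvesDynkin r τ x₀ P X)
    {t : ℝ} (ht : 0 ≤ t) (i j : ι) :
    HasDerivWithinAt (fun t => coordMoment c P X t i j)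
      (κ * ∑ k, (coordMoment c P X t k i * J k j + coordMoment c P X t k j * J k i) +
        κ * ∑ k, coordAbsMean c P X t k * (J k i * J k j)) (Ici 0) t := by
  have := hX.hasDerivWithinAt hJ.isLyapunov (polyGrowth_mul c i j) ht
  refine this.congr_deriv ?_
  rw [integral_congr_ae (ae_of_all _ fun ω => hJ.generator_mul i j (X t ω))]
  have h1 : ∀ k, Integrable (fun ω => c (X t ω) k * c (X t ω) i * J k j +
      c (X t ω) k * c (X t ω) j * J k i) P := fun k =>
    ((hJ.integrable_mul hX ht k i).mul_const _).add ((hJ.integrable_mul hX ht k j).mul_const _)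
  have h2 : ∀ k, Integrable (fun ω => |c (X t ω) k| * (J k i * J k j)) P := fun k =>
    (hJ.integrable_coord hX ht k).abs.mul_const _
  rw [integral_add ((integrable_finsetSum _ fun k _ => h1 k).const_mul κ)
    ((integrable_finsetSum _ fun k _ => h2 k).const_mul κ), integral_const_mul, integral_const_mul,
    integral_finsetSum _ fun k _ => h1 k, integral_finsetSum _ fun k _ => h2 k]
  congr 2
  · refine Finset.sum_congr rfl fun k _ => ?_
    rw [integral_add ((hJ.integrable_mul hX ht k i).mul_const _)
      ((hJ.integrable_mul hX ht k j).mul_const _), integral_mul_const, integral_mul_const]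
    rfl
  · refine Finset.sum_congr rfl fun k _ => ?_
    rw [integral_mul_const]
    rfl

/-- The products of means obey the drift part of the moment equation exactly, so the covariance
solves the same linear equation with the same noise source, now from zero initial data. -/
lemma hasDerivWithinAt_cov (hJ : IsSkewJumpSystem κ J c σ r τ) (hX : SolvesDynkin r τ x₀ P X)
    {t : ℝ} (ht : 0 ≤ t) (i j : ι) :
    HasDerivWithinAt (fun t => coordCov c P X t i j)
      (κ * ∑ k, (coordCov c P X t k i * J k j + coordCov c P X t k j * J k i) +
        κ * ∑ k, coordAbsMean c P X t k * (J k i * J k j)) (Ici 0) t := by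
  have := (hJ.hasDerivWithinAt_moment hX ht i j).sub
    ((hJ.hasDerivWithinAt_mean hX ht i).mul (hJ.hasDerivWithinAt_mean hX ht j))
  refine this.congr_deriv ?_
  have : κ * ∑ k, (coordCov c P X t k i * J k j + coordCov c P X t k j * J k i) =
      κ * ∑ k, (coordMoment c P X t k i * J k j + coordMoment c P X t k j * J k i) -
        (κ * (∑ k, coordMean c P X t k * J k i) * coordMean c P X t j +
          coordMean c P X t i * (κ * ∑ k, coordMean c P X t k * J k j)) := by
    simp only [Finset.mul_sum, Finset.sum_mul, ← Finset.sum_add_distrib,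
      ← Finset.sum_sub_distrib]
    refine Finset.sum_congr rfl fun k _ => ?_
    rw [coordCov, coordCov]
    ring
  rw [this]
  ring

lemma mean_zero (hJ : IsSkewJumpSystem κ J c σ r τ) (hX : SolvesDynkin r τ x₀ P X) (i : ι) :
    coordMean c P X 0 i = c x₀ i :=
  hX.expectation_zero hJ.isLyapunov (polyGrowth_coord c i)

lemma moment_zero (hJ : IsSkewJumpSystem κ J c σ r τ) (hX : SolvesDynkin r τ x₀ P X) (i j : ι) :
    coordMoment c P X 0 i j = c x₀ i * c x₀ j :=
  hX.expectation_zero hJ.isLyapunov (polyGrowth_mul c i j)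

lemma cov_zero (hJ : IsSkewJumpSystem κ J c σ r τ) (hX : SolvesDynkin r τ x₀ P X) (i j : ι) :
    coordCov c P X 0 i j = 0 := by
  rw [coordCov, hJ.mean_zero hX, hJ.mean_zero hX, hJ.moment_zero hX, sub_self]

/-- The drift matrix is skew, hence the quadratic form in the derivative of the energy of the mean
vanishes. -/
lemma sum_mean_sq_eq (hJ : IsSkewJumpSystem κ J c σ r τ) (hX : SolvesDynkin r τ x₀ P X)
    {t : ℝ} (ht : 0 ≤ t) : ∑ i, coordMean c P X t i ^ 2 = ∑ i, c x₀ i ^ 2 := by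
  have hd : ∀ t, 0 ≤ t → HasDerivWithinAt (fun t => ∑ i, coordMean c P X t i ^ 2) 0 (Ici 0) t := by
    intro t ht
    refine (HasDerivWithinAt.fun_sum fun i _ =>
      ((hJ.hasDerivWithinAt_mean hX ht i).fun_pow 2)).congr_deriv ?_
    have h0 : ∑ i, ∑ k, coordMean c P X t i * coordMean c P X t k * J k i = 0 :=
      sum_sum_eq_zero_of_antisymm fun i k => by rw [hJ.antisymm k i]; ring
    calc _ = 2 * κ * ∑ i, ∑ k, coordMean c P X t i * coordMean c P X t k * J k i := by
          rw [Finset.mul_sum]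
          refine Finset.sum_congr rfl fun i _ => ?_
          simp only [mul_assoc, ← Finset.mul_sum]
          simp
          ring
      _ = 0 := by rw [h0, mul_zero]
  have := eq_of_deriv_eq_zero hd ht
  rw [this]
  simp only [hJ.mean_zero hX]

/-- By skewness the transport terms cancel in the trace; energy is created by the jump noise alone.
-/
lemma hasDerivWithinAt_sum_moment (hJ : IsSkewJumpSystem κ J c σ r τ)
    (hX : SolvesDynkin r τ x₀ P X) {t : ℝ} (ht : 0 ≤ t) :
    HasDerivWithinAt (fun t => ∑ i, coordMoment c P X t i i)
      (κ * ∑ k, coordAbsMean c P X t k * ∑ i, J k i ^ 2) (Ici 0) t := by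
  refine (HasDerivWithinAt.fun_sum fun i _ => hJ.hasDerivWithinAt_moment hX ht i i).congr_deriv ?_
  have h0 : ∑ i, ∑ k, coordMoment c P X t k i * J k i = 0 :=
    sum_sum_eq_zero_of_antisymm fun i k => by
      rw [hJ.antisymm k i, coordMoment_comm t k i]; ring
  have h1 : ∑ i, ∑ k, coordAbsMean c P X t k * (J k i * J k i) =
      ∑ k, coordAbsMean c P X t k * ∑ i, J k i ^ 2 := by
    rw [Finset.sum_comm]
    simp only [Finset.mul_sum, sq]
  simp only [Finset.sum_add_distrib, ← Finset.mul_sum]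
  rw [h0, h1]
  ring

lemma sum_moment_eq (hJ : IsSkewJumpSystem κ J c σ r τ) (hX : SolvesDynkin r τ x₀ P X)
    {t : ℝ} (ht : 0 ≤ t) :
    ∑ i, coordMoment c P X t i i = ∑ i, coordCov c P X t i i + ∑ i, c x₀ i ^ 2 := by
  rw [← hJ.sum_mean_sq_eq hX ht, ← Finset.sum_add_distrib]
  refine Finset.sum_congr rfl fun i _ => ?_
  rw [coordCov]; ring

/-- The arithmetic–geometric inequality, with a free scale `l` at which particle numbers are
compared with their squares; on the ring the natural choice is l = N. -/
lemma absMean_le (hJ : IsSkewJumpSystem κ J c σ r τ) (hX : SolvesDynkin r τ x₀ P X)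
    {t l : ℝ} (ht : 0 ≤ t) (hl : 0 < l) (i : ι) :
    2 * coordAbsMean c P X t i ≤ coordMoment c P X t i i / l + l := by
  rw [coordAbsMean, coordMoment, ← integral_const_mul, ← integral_div]
  have h1 := (hJ.integrable_mul hX ht i i).div_const l
  calc ∫ ω, 2 * |c (X t ω) i| ∂P ≤ ∫ ω, (c (X t ω) i * c (X t ω) i / l + l) ∂P := by
        refine integral_mono ((hJ.integrable_coord hX ht i).abs.const_mul 2)
          (h1.add (integrable_const _)) fun ω => ?_
        change 2 * |c (X t ω) i| ≤ c (X t ω) i * c (X t ω) i / l + l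
        rw [div_add' _ _ _ hl.ne', le_div_iff₀ hl, ← abs_mul_abs_self (c (X t ω) i)]
        nlinarith [sq_nonneg (|c (X t ω) i| - l)]
    _ = _ := by rw [integral_add h1 (integrable_const _)]; simp

lemma absMean_sq_le (hJ : IsSkewJumpSystem κ J c σ r τ) (hX : SolvesDynkin r τ x₀ P X)
    {t : ℝ} (ht : 0 ≤ t) (i : ι) :
    coordAbsMean c P X t i ^ 2 ≤ coordMoment c P X t i i := by
  rcases (coordAbsMean_nonneg (c := c) (P := P) (X := X) t i).eq_or_lt with h | h
  · rw [← h, coordMoment]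
    simpa using integral_nonneg (μ := P) fun ω => mul_self_nonneg (c (X t ω) i)
  · have := hJ.absMean_le hX ht h i
    have h2 : coordAbsMean c P X t i ≤ coordMoment c P X t i i / coordAbsMean c P X t i := by
      linarith
    rw [le_div_iff₀ h] at h2
    nlinarith

lemma sum_sq_le (hJ : IsSkewJumpSystem κ J c σ r τ) (k : ι) : ∑ i, J k i ^ 2 ≤ 2 := by
  refine le_trans (Finset.sum_le_sum fun i _ => ?_) (hJ.sum_abs_le k)
  rw [← sq_abs]
  nlinarith [abs_nonneg (J k i), hJ.abs_le_one k i]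

/-- The expected energy grows at most exponentially. -/
lemma sum_moment_le (hJ : IsSkewJumpSystem κ J c σ r τ) (hX : SolvesDynkin r τ x₀ P X)
    {t l : ℝ} (ht : 0 ≤ t) (hl : 0 < l) :
    ∑ i, coordMoment c P X t i i ≤
      (∑ i, c x₀ i ^ 2 + κ * l * Fintype.card ι * t) * Real.exp (κ / l * t) := by
  have hκ := hJ.nonneg
  have := le_exp_mul_of_deriv_le (a := κ / l) (b := κ * l * Fintype.card ι) (by positivity)
    (by positivity) (fun t ht => hJ.hasDerivWithinAt_sum_moment hX ht) (T := t)
    (fun t ht _ => by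
      calc κ * ∑ k, coordAbsMean c P X t k * ∑ i, J k i ^ 2
          ≤ κ * ∑ k, (coordMoment c P X t k k / l + l) := by
            refine mul_le_mul_of_nonneg_left (Finset.sum_le_sum fun k _ => ?_) hκ
            have h1 := hJ.absMean_le hX ht hl k
            have h2 := hJ.sum_sq_le k
            have h3 := coordAbsMean_nonneg (c := c) (P := P) (X := X) t k
            nlinarith
        _ = κ / l * ∑ k, coordMoment c P X t k k + κ * l * Fintype.card ι := by
            rw [Finset.sum_add_distrib, ← Finset.sum_div]
            simp
            ring) ht
  simp only [hJ.moment_zero hX, ← sq] at this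
  exact this

lemma hasDerivWithinAt_sum_cov (hJ : IsSkewJumpSystem κ J c σ r τ)
    (hX : SolvesDynkin r τ x₀ P X) {t : ℝ} (ht : 0 ≤ t) :
    HasDerivWithinAt (fun t => ∑ i, coordCov c P X t i i)
      (κ * ∑ k, coordAbsMean c P X t k * ∑ i, J k i ^ 2) (Ici 0) t := by
  have h : ∀ t, 0 ≤ t → ∑ i, coordCov c P X t i i =
      ∑ i, coordMoment c P X t i i - ∑ i, c x₀ i ^ 2 := fun t ht => by
    rw [hJ.sum_moment_eq hX ht]; ring
  exact ((hJ.hasDerivWithinAt_sum_moment hX ht).sub_const _).congr (fun s hs => h s hs) (h t ht)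

lemma sum_cov_zero (hJ : IsSkewJumpSystem κ J c σ r τ) (hX : SolvesDynkin r τ x₀ P X) :
    ∑ i, coordCov c P X 0 i i = 0 :=
  Finset.sum_eq_zero fun i _ => hJ.cov_zero hX i i

/-- An upper bound of the total variance, if the expected energy is at most `B` up to time `t`. -/
lemma sum_cov_le (hJ : IsSkewJumpSystem κ J c σ r τ) (hX : SolvesDynkin r τ x₀ P X)
    {t l B : ℝ} (ht : 0 ≤ t) (hl : 0 < l)
    (hB : ∀ s, 0 ≤ s → s ≤ t → ∑ i, coordMoment c P X s i i ≤ B) :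
    ∑ i, coordCov c P X t i i ≤ κ * (B / l + l * Fintype.card ι) * t := by
  have hκ := hJ.nonneg
  have hB0 : 0 ≤ B := le_trans (Finset.sum_nonneg fun i _ =>
    integral_nonneg fun ω => mul_self_nonneg (c (X 0 ω) i)) (hB 0 le_rfl ht)
  have := le_exp_mul_of_deriv_le (a := 0) (b := κ * (B / l + l * Fintype.card ι)) le_rfl
    (by positivity) (fun t ht => hJ.hasDerivWithinAt_sum_cov hX ht) (T := t)
    (fun s hs hst => by
      rw [zero_mul, zero_add]
      refine mul_le_mul_of_nonneg_left ?_ hκ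
      calc ∑ k, coordAbsMean c P X s k * ∑ i, J k i ^ 2
          ≤ ∑ k, (coordMoment c P X s k k / l + l) := by
            refine Finset.sum_le_sum fun k _ => ?_
            have h1 := hJ.absMean_le hX hs hl k
            have h2 := hJ.sum_sq_le k
            have h3 := coordAbsMean_nonneg (c := c) (P := P) (X := X) s k
            nlinarith
        _ = (∑ k, coordMoment c P X s k k) / l + l * Fintype.card ι := by
            rw [Finset.sum_add_distrib, ← Finset.sum_div]
            simp
            ring
        _ ≤ _ := by gcongr; exact hB s hs hst) ht
  rw [hJ.sum_cov_zero hX] at this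
  simpa using this

/-- A lower bound of the total variance, if the mean absolute values are bounded below. -/
lemma le_sum_cov (hJ : IsSkewJumpSystem κ J c σ r τ) (hX : SolvesDynkin r τ x₀ P X)
    (hJ2 : ∀ k, ∑ i, J k i ^ 2 = 2) {t b : ℝ} (ht : 0 ≤ t)
    (hb : ∀ s, 0 ≤ s → s ≤ t → b ≤ ∑ i, coordAbsMean c P X s i) :
    2 * κ * b * t ≤ ∑ i, coordCov c P X t i i := by
  have := add_mul_le_of_deriv_ge (b := 2 * κ * b)
    (fun t ht => hJ.hasDerivWithinAt_sum_cov hX ht) (T := t)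
    (fun s hs hst => by
      simp only [hJ2, ← Finset.sum_mul]
      have := mul_le_mul_of_nonneg_left (hb s hs hst) hJ.nonneg
      linarith) ht
  rw [hJ.sum_cov_zero hX] at this
  simpa using this

/-- This is half the derivative of the squared Hilbert–Schmidt norm of the covariance. The drift
acts by a skew matrix on either index and so is orthogonal to the covariance itself; the noise
contributes the quadratic form of the covariance at the rows of `J`. -/
lemma sum_sum_mul_deriv_cov (hJ : IsSkewJumpSystem κ J c σ r τ) (t : ℝ) :
    ∑ i, ∑ j, coordCov c P X t i j *
      (κ * ∑ k, (coordCov c P X t k i * J k j + coordCov c P X t k j * J k i) +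
        κ * ∑ k, coordAbsMean c P X t k * (J k i * J k j)) =
      κ * ∑ k, coordAbsMean c P X t k * ∑ i, ∑ j, J k i * J k j * coordCov c P X t i j := by
  have hA : ∑ i, ∑ j, ∑ k, coordCov c P X t i j * coordCov c P X t k i * J k j = 0 := by
    rw [Finset.sum_congr rfl fun i _ => sum_sum_eq_zero_of_antisymm fun j k => by
      rw [hJ.antisymm k j, coordCov_comm t i j, coordCov_comm t k i]; ring]
    simp
  have hB : ∑ i, ∑ j, ∑ k, coordCov c P X t i j * coordCov c P X t k j * J k i = 0 := by
    rw [Finset.sum_comm, ← hA]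
    refine Finset.sum_congr rfl fun i _ => Finset.sum_congr rfl fun j _ =>
      Finset.sum_congr rfl fun k _ => ?_
    rw [coordCov_comm t j i]
  have hC : ∑ i, ∑ j, ∑ k, coordCov c P X t i j * (coordAbsMean c P X t k * (J k i * J k j)) =
      ∑ k, coordAbsMean c P X t k * ∑ i, ∑ j, J k i * J k j * coordCov c P X t i j := by
    simp only [Finset.mul_sum]
    refine (Finset.sum_congr rfl fun i _ => Finset.sum_comm).trans ?_
    rw [Finset.sum_comm]
    refine Finset.sum_congr rfl fun i _ => Finset.sum_congr rfl fun j _ =>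
      Finset.sum_congr rfl fun k _ => ?_
    ring
  calc _ = κ * ∑ i, ∑ j, ∑ k, coordCov c P X t i j * coordCov c P X t k i * J k j +
        κ * ∑ i, ∑ j, ∑ k, coordCov c P X t i j * coordCov c P X t k j * J k i +
        κ * ∑ i, ∑ j, ∑ k,
          coordCov c P X t i j * (coordAbsMean c P X t k * (J k i * J k j)) := by
        simp only [Finset.mul_sum, ← Finset.sum_add_distrib]
        refine Finset.sum_congr rfl fun i _ => Finset.sum_congr rfl fun j _ =>
          Finset.sum_congr rfl fun k _ => ?_
        ring
    _ = _ := by rw [hA, hB, hC]; ring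

/-- Cauchy–Schwarz with weights |J k i| |J k j|, of total mass at most 2 · 2 = 4, followed by |J k
j| ≤ 1. By antisymmetry the columns also have absolute sum at most 2, which gives the factor 8. -/
lemma sum_quadratic_sq_le (hJ : IsSkewJumpSystem κ J c σ r τ) (C : ι → ι → ℝ) :
    ∑ k, (∑ i, ∑ j, J k i * J k j * C i j) ^ 2 ≤ 8 * ∑ i, ∑ j, C i j ^ 2 := by
  have h1 : ∀ k, (∑ i, ∑ j, J k i * J k j * C i j) ^ 2 ≤
      4 * ∑ i, ∑ j, |J k i| * C i j ^ 2 := by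
    intro k
    have hcs := Finset.sum_sq_le_sum_mul_sum_of_sq_le_mul (Finset.univ : Finset (ι × ι))
      (r := fun p => J k p.1 * J k p.2 * C p.1 p.2) (f := fun p => |J k p.1| * |J k p.2|)
      (g := fun p => |J k p.1| * |J k p.2| * C p.1 p.2 ^ 2)
      (fun p _ => by positivity) (fun p _ => by positivity)
      (fun p _ => by
        rw [mul_pow, mul_pow, ← sq_abs (J k p.1), ← sq_abs (J k p.2)]
        exact le_of_eq (by ring))
    simp only [Fintype.sum_prod_type] at hcs
    refine hcs.trans (mul_le_mul ?_ ?_ ?_ (by norm_num))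
    · rw [← Finset.sum_mul_sum]
      have := hJ.sum_abs_le k
      have h0 : 0 ≤ ∑ j, |J k j| := Finset.sum_nonneg fun _ _ => abs_nonneg _
      nlinarith
    · refine Finset.sum_le_sum fun i _ => Finset.sum_le_sum fun j _ => ?_
      refine mul_le_mul_of_nonneg_right ?_ (sq_nonneg _)
      exact mul_le_of_le_one_right (abs_nonneg _) (hJ.abs_le_one k j)
    · exact Finset.sum_nonneg fun i _ => Finset.sum_nonneg fun j _ => by positivity
  calc ∑ k, (∑ i, ∑ j, J k i * J k j * C i j) ^ 2
      ≤ ∑ k, 4 * ∑ i, ∑ j, |J k i| * C i j ^ 2 := Finset.sum_le_sum fun k _ => h1 k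
    _ = 4 * ∑ i, (∑ k, |J k i|) * ∑ j, C i j ^ 2 := by
        rw [← Finset.mul_sum, Finset.sum_comm]
        simp only [← Finset.mul_sum, Finset.sum_mul]
    _ ≤ 4 * ∑ i, 2 * ∑ j, C i j ^ 2 := by
        refine mul_le_mul_of_nonneg_left (Finset.sum_le_sum fun i _ => ?_) (by norm_num)
        refine mul_le_mul_of_nonneg_right ?_ (Finset.sum_nonneg fun _ _ => sq_nonneg _)
        refine le_trans (Finset.sum_le_sum fun k _ => ?_) (hJ.sum_abs_le i)
        rw [hJ.antisymm k i, abs_neg]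
    _ = _ := by rw [← Finset.mul_sum]; ring

/-- A bound of the Hilbert–Schmidt norm of the covariance matrix. -/
lemma sum_cov_sq_le (hJ : IsSkewJumpSystem κ J c σ r τ) (hX : SolvesDynkin r τ x₀ P X)
    {t B : ℝ} (ht : 0 ≤ t)
    (hB : ∀ s, 0 ≤ s → s ≤ t → ∑ i, coordMoment c P X s i i ≤ B) :
    ∑ i, ∑ j, coordCov c P X t i j ^ 2 ≤ κ ^ 2 * B * t * Real.exp (8 * t) := by
  have hB0 : 0 ≤ B := le_trans (Finset.sum_nonneg fun i _ =>
    integral_nonneg fun ω => mul_self_nonneg (c (X 0 ω) i)) (hB 0 le_rfl ht)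
  have hd : ∀ t, 0 ≤ t → HasDerivWithinAt (fun t => ∑ i, ∑ j, coordCov c P X t i j ^ 2)
      (2 * (κ * ∑ k, coordAbsMean c P X t k * ∑ i, ∑ j, J k i * J k j * coordCov c P X t i j))
      (Ici 0) t := by
    intro t ht
    refine (HasDerivWithinAt.fun_sum fun i _ => HasDerivWithinAt.fun_sum fun j _ =>
      ((hJ.hasDerivWithinAt_cov hX ht i j).fun_pow 2)).congr_deriv ?_
    rw [← hJ.sum_sum_mul_deriv_cov (P := P) (X := X) t]
    simp only [Finset.mul_sum _ _ (2 : ℝ)]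
    refine Finset.sum_congr rfl fun i _ => Finset.sum_congr rfl fun j _ => ?_
    simp [mul_assoc]
  -- From 2(κ a_k)Q_k ≤ (κ a_k)² + Q_k², with a_k the mean absolute value and Q_k the quadratic form
  -- of row k. All factors κ go into the source term, so the exponential rate 8 does not depend on
  -- the size of the ring.
  have := le_exp_mul_of_deriv_le (a := 8) (b := κ ^ 2 * B) (by norm_num) (by positivity) hd
    (T := t) (fun s hs hst => by
      have h1 := hJ.sum_quadratic_sq_le (coordCov c P X s)
      have h2 : ∑ k, coordAbsMean c P X s k ^ 2 ≤ B :=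
        (Finset.sum_le_sum fun k _ => hJ.absMean_sq_le hX hs k).trans (hB s hs hst)
      calc 2 * (κ * ∑ k, coordAbsMean c P X s k *
              ∑ i, ∑ j, J k i * J k j * coordCov c P X s i j)
          = ∑ k, 2 * (κ * coordAbsMean c P X s k) *
              ∑ i, ∑ j, J k i * J k j * coordCov c P X s i j := by
            rw [Finset.mul_sum, Finset.mul_sum]
            exact Finset.sum_congr rfl fun k _ => by ring
        _ ≤ ∑ k, ((κ * coordAbsMean c P X s k) ^ 2 +
              (∑ i, ∑ j, J k i * J k j * coordCov c P X s i j) ^ 2) :=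
            Finset.sum_le_sum fun k _ => two_mul_le_add_sq _ _
        _ = κ ^ 2 * ∑ k, coordAbsMean c P X s k ^ 2 +
              ∑ k, (∑ i, ∑ j, J k i * J k j * coordCov c P X s i j) ^ 2 := by
            rw [Finset.sum_add_distrib, Finset.mul_sum]
            simp only [mul_pow]
        _ ≤ _ := by
            have := mul_le_mul_of_nonneg_left h2 (sq_nonneg κ)
            linarith) ht
  simpa [hJ.cov_zero hX] using this

/-- The variance of a linear combination of the coordinates. -/
lemma sum_cov_mul_le (η : ι → ℝ) (t : ℝ) {D : ℝ} (hD : 0 ≤ D)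
    (h : ∑ i, ∑ j, coordCov c P X t i j ^ 2 ≤ D ^ 2) :
    ∑ i, ∑ j, η i * η j * coordCov c P X t i j ≤ D * ∑ i, η i ^ 2 := by
  -- The variance is the Hilbert–Schmidt inner product of the covariance with the rank-one matrix η
  -- ⊗ η, whose norm is Σ η i ^ 2.
  have hcs := Finset.sum_mul_sq_le_sq_mul_sq (Finset.univ : Finset (ι × ι))
    (fun p => η p.1 * η p.2) (fun p => coordCov c P X t p.1 p.2)
  simp only [Fintype.sum_prod_type] at hcs
  have hη : ∑ i, ∑ j, (η i * η j) ^ 2 = (∑ i, η i ^ 2) ^ 2 := by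
    rw [sq (∑ i, η i ^ 2), Finset.sum_mul_sum]
    simp only [mul_pow]
  rw [hη] at hcs
  have h0 : 0 ≤ ∑ i, η i ^ 2 := Finset.sum_nonneg fun _ _ => sq_nonneg _
  refine abs_le_of_sq_le_sq' ?_ (by positivity) |>.2
  calc _ ≤ (∑ i, η i ^ 2) ^ 2 * ∑ i, ∑ j, coordCov c P X t i j ^ 2 := hcs
    _ ≤ (∑ i, η i ^ 2) ^ 2 * D ^ 2 := mul_le_mul_of_nonneg_left h (sq_nonneg _)
    _ = _ := by ring

end IsSkewJumpSystem

end Moments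

/-! ### The particle system on the ring as a jump system -/

section Ring

/-- Time is rounded strictly upwards to the grid of mesh 1/(m+1). The rounded process is jointly
measurable, and right continuity into a discrete space makes it eventually equal to the process at
each point. Strictness matters, since the hypothesis concerns punctured right neighbourhoods. -/
lemma measurable_uncurry_of_rightContinuous {S Ω : Type*} [Countable S] [MeasurableSpace S]
    [DiscreteMeasurableSpace S] [MeasurableSpace Ω] {X : ℝ≥0 → Ω → S}
    (hm : ∀ t, Measurable (X t)) (hr : ∀ ω t, ∀ᶠ s in 𝓝[>] t, X s ω = X t ω) :
    Measurable (fun p : ℝ≥0 × Ω => X p.1 p.2) := by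
  classical
  refine measurable_to_countable' fun g => ?_
  set d : ℕ → ℝ≥0 → ℝ≥0 := fun m s => (⌊(m + 1 : ℝ≥0) * s⌋₊ + 1 : ℝ≥0) / (m + 1) with hd
  have hdm : ∀ m, Measurable (fun p : ℝ≥0 × Ω => X (d m p.1) p.2) := by
    intro m
    have h1 : ∀ (e : ℕ → ℝ≥0) (fl : ℝ≥0 → ℕ), Measurable fl →
        Measurable (fun p : ℝ≥0 × Ω => X (e (fl p.1)) p.2) := fun e fl hfl => by
      have h2 : Measurable (fun q : ℕ × Ω => X (e q.1) q.2) :=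
        measurable_from_prod_countable_right fun k => hm (e k)
      exact h2.comp ((hfl.comp measurable_fst).prodMk measurable_snd)
    exact h1 (fun k => (k + 1 : ℝ≥0) / (m + 1)) (fun s => ⌊(m + 1 : ℝ≥0) * s⌋₊)
      (Nat.measurable_floor.comp (measurable_id.const_mul _))
  have hgt : ∀ m s, s < d m s := by
    intro m s
    rw [hd, lt_div_iff₀ (by positivity), mul_comm]
    exact Nat.lt_floor_add_one _
  have hlim : ∀ s, Tendsto (fun m => d m s) atTop (𝓝[>] s) := by
    intro s
    refine tendsto_nhdsWithin_iff.2 ⟨?_, Eventually.of_forall fun m => hgt m s⟩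
    have h0 : Tendsto (fun m : ℕ => s + 1 / ((m : ℝ≥0) + 1)) atTop (𝓝 (s + 0)) :=
      tendsto_const_nhds.add (tendsto_one_div_add_atTop_nhds_zero_nat (𝕜 := ℝ≥0))
    rw [add_zero] at h0
    refine tendsto_of_tendsto_of_tendsto_of_le_of_le tendsto_const_nhds h0
      (fun m => (hgt m s).le) fun m => ?_
    have hp : (0 : ℝ≥0) < m + 1 := by positivity
    simp only [hd]
    rw [div_le_iff₀ hp, add_mul s, one_div, inv_mul_cancel₀ hp.ne', mul_comm s]
    gcongr
    exact Nat.floor_le (by positivity)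
  have hev : ∀ p : ℝ≥0 × Ω, ∀ᶠ m in atTop, X (d m p.1) p.2 = X p.1 p.2 := fun p =>
    (hlim p.1).eventually (hr p.2 p.1)
  have hind : Measurable (fun p : ℝ≥0 × Ω => if X p.1 p.2 = g then (1 : ℝ) else 0) := by
    refine measurable_of_tendsto_metrizable
      (f := fun m (p : ℝ≥0 × Ω) => if X (d m p.1) p.2 = g then (1 : ℝ) else 0) (fun m => ?_) ?_
    · exact (Measurable.of_discrete (f := fun x : S => if x = g then (1 : ℝ) else 0)).comp (hdm m)
    · rw [tendsto_pi_nhds]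
      intro p
      refine tendsto_const_nhds.congr' ((hev p).mono fun m hm => ?_)
      simp only [hm]
  have := hind (measurableSet_singleton 1)
  convert this using 1
  ext p
  by_cases h : X p.1 p.2 = g <;> simp [h]

variable {n : ℕ} [NeZero n]

/-- The coordinates of a state on the ring. -/
def ringCoord (f : State (ZMod n) (ZMod n)) : ZMod n ⊕ ZMod n → ℝ :=
  Sum.elim (fun k => (f.1 k : ℝ)) (fun k => (f.2 k : ℝ))

/-- The signs of the coordinates of a state on the ring. -/
def ringSign (f : State (ZMod n) (ZMod n)) : ZMod n ⊕ ZMod n → ℝ :=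
  Sum.elim (fun k => ((f.1 k).sign : ℝ)) (fun k => ((f.2 k).sign : ℝ))

/-- The jump matrix of the particle system on the ring. -/
def ringJump (n : ℕ) : ZMod n ⊕ ZMod n → ZMod n ⊕ ZMod n → ℝ :=
  Sum.elim
    (fun k => Sum.elim (fun _ => 0) (fun e => (if e + 1 = k then 1 else 0) - if e = k then 1 else 0))
    (fun e => Sum.elim (fun z => (if z = e then 1 else 0) - if z = e + 1 then 1 else 0)
      (fun _ => 0))

/-- The transitions of the particle system on the ring. -/
noncomputable def ringTransition (n : ℕ) [NeZero n] :
    ZMod n ⊕ ZMod n → State (ZMod n) (ZMod n) → State (ZMod n) (ZMod n) :=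
  Sum.elim (fun k f => (ringGraph n).vertexJump f k) (fun e f => (ringGraph n).edgeJump f e)

/-- The transition rates of the particle system on the ring. -/
noncomputable def ringRate (n : ℕ) (i : ZMod n ⊕ ZMod n) (f : State (ZMod n) (ZMod n)) : ℝ :=
  n * |ringCoord f i|

lemma ringGraph_generator_eq (F : State (ZMod n) (ZMod n) → ℝ) (f : State (ZMod n) (ZMod n)) :
    (ringGraph n).generator F f = jumpGenerator (ringRate n) (ringTransition n) F f := by
  rw [generator, jumpGenerator, Fintype.sum_sum_type]
  congr 1
  refine Finset.sum_congr rfl fun k _ => ?_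
  simp [ringRate, ringCoord, ringTransition, ringGraph, mul_comm]

lemma ringGraph_isIPS_solvesDynkin {f₀ : State (ZMod n) (ZMod n)} {Ω : Type*} [MeasurableSpace Ω]
    {P : Measure Ω} [IsProbabilityMeasure P] {X : ℝ≥0 → Ω → State (ZMod n) (ZMod n)}
    (hX : (ringGraph n).IsIPS f₀ P X) :
    SolvesDynkin (ringRate n) (ringTransition n) f₀ P (fun t ω => X t.toNNReal ω) := by
  obtain ⟨ℱ, had, hM⟩ := hX.martingale_problem
  have hm : ∀ t, Measurable (X t) := fun t =>
    measurable_to_countable' fun g => ℱ.le t _ (had t g)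
  refine ⟨(measurable_uncurry_of_rightContinuous hm hX.right_continuous).comp
    ((measurable_real_toNNReal.comp measurable_fst).prodMk measurable_snd), ?_⟩
  intro F hF t ht
  lift t to ℝ≥0 using ht
  have hmart := hM F hF
  obtain ⟨M, hM⟩ := exists_bound_of_finite_support hF
  have hint : ∀ t, Integrable (fun ω => F (X t ω)) P := fun t =>
    Integrable.of_bound ((Measurable.of_discrete (f := F)).comp (hm t)).aestronglyMeasurable M
      (ae_of_all _ fun ω => hM _)
  -- The martingale vanishes at time 0, so its expectation vanishes at all times. Splitting this
  -- expectation gives Dynkin's formula; the time integral is integrable as a difference of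
  -- integrable functions.
  have h0 := hmart.setIntegral_eq (zero_le (a := t)) (MeasurableSet.univ)
  have hI := hmart.integrable t
  simp only [Measure.restrict_univ, NNReal.coe_zero, intervalIntegral.integral_same, sub_self,
    integral_zero] at h0
  have hI2 : Integrable (fun ω => ∫ s in (0 : ℝ)..t, (ringGraph n).generator F (X s.toNNReal ω)) P := by
    have := ((hint t).sub (hint 0)).sub hI
    refine this.congr (ae_of_all _ fun ω => ?_)
    simp
  have h1 := integral_sub ((hint t).sub (hint 0)) hI2
  simp only [Pi.sub_apply] at h1
  rw [← h0, integral_sub (hint t) (hint 0)] at h1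
  have h2 : ∫ ω, F (X 0 ω) ∂P = F f₀ := by
    have : (fun ω => F (X 0 ω)) =ᵐ[P] fun _ => F f₀ := hX.initial.mono fun ω hω => by
      simp only [hω]
    rw [integral_congr_ae this]
    simp
  simp only [← ringGraph_generator_eq, Real.toNNReal_coe]
  linarith

lemma ringCoord_transition (i : ZMod n ⊕ ZMod n) (f : State (ZMod n) (ZMod n))
    (j : ZMod n ⊕ ZMod n) :
    ringCoord (ringTransition n i f) j = ringCoord f j + ringSign f i * ringJump n i j := by
  rcases i with k | e <;> rcases j with j | j
  · simp [ringCoord, ringTransition, ringSign, ringJump, vertexJump]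
  · simp [ringCoord, ringTransition, ringSign, ringJump, vertexJump, ringGraph]
  · simp [ringCoord, ringTransition, ringSign, ringJump, edgeJump, ringGraph]
  · simp [ringCoord, ringTransition, ringSign, ringJump, edgeJump]

lemma ringJump_antisymm (i j : ZMod n ⊕ ZMod n) : ringJump n i j = -ringJump n j i := by
  rcases i with k | e <;> rcases j with j | j <;> simp [ringJump, eq_comm]

lemma sum_ringJump_le (i : ZMod n ⊕ ZMod n) : ∑ j, |ringJump n i j| ≤ 2 := by
  have key : ∀ a b : ZMod n → ℝ, (∑ k, |a k|) ≤ 1 → (∑ k, |b k|) ≤ 1 →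
      ∑ k, |a k - b k| ≤ 2 := fun a b ha hb => by
    calc ∑ k, |a k - b k| ≤ ∑ k, (|a k| + |b k|) := Finset.sum_le_sum fun k _ => abs_sub _ _
      _ ≤ 2 := by rw [Finset.sum_add_distrib]; linarith
  have h1 : ∀ k : ZMod n, ∑ e : ZMod n, |if e + 1 = k then (1 : ℝ) else 0| ≤ 1 := fun k => by
    simp only [← eq_sub_iff_add_eq, apply_ite abs, abs_one, abs_zero]
    simp
  have h2 : ∀ k : ZMod n, ∑ e : ZMod n, |if e = k then (1 : ℝ) else 0| ≤ 1 := fun k => by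
    simp only [apply_ite abs, abs_one, abs_zero]
    simp
  rcases i with k | e
  · simpa [Fintype.sum_sum_type, ringJump] using key _ _ (h1 k) (h2 k)
  · simpa [Fintype.sum_sum_type, ringJump] using key _ _ (h2 e) (h2 (e + 1))

lemma abs_ringJump_le (i j : ZMod n ⊕ ZMod n) : |ringJump n i j| ≤ 1 := by
  rcases i with k | e <;> rcases j with j | j <;> simp only [ringJump, Sum.elim_inl, Sum.elim_inr]
  · simp
  · split_ifs <;> simp
  · split_ifs <;> simp
  · simp

/-- For n = 1 the two neighbours coincide and the row is zero; from n = 2 on the entries 1 and -1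
sit at different places. This exact value drives the lower bound of the variance. -/
lemma sum_ringJump_sq (hn : 2 ≤ n) (i : ZMod n ⊕ ZMod n) : ∑ j, ringJump n i j ^ 2 = 2 := by
  have : Fact (1 < n) := ⟨hn⟩
  have key : ∀ a b : ZMod n, a ≠ b →
      ∑ k, ((if k = a then (1 : ℝ) else 0) - if k = b then 1 else 0) ^ 2 = 2 := fun a b hab => by
    have : ∀ k : ZMod n, ((if k = a then (1 : ℝ) else 0) - if k = b then 1 else 0) ^ 2 =
        (if k = a then (1 : ℝ) else 0) + if k = b then 1 else 0 := fun k => by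
      by_cases h1 : k = a
      · simp [h1, hab]
      · by_cases h2 : k = b <;> simp [h1, h2, Ne.symm hab]
    simp only [this, Finset.sum_add_distrib]
    simp
    norm_num
  rcases i with k | e
  · have := key (k - 1) k (by simp)
    simpa [Fintype.sum_sum_type, ringJump, eq_sub_iff_add_eq] using this
  · have := key e (e + 1) (by simp)
    simpa [Fintype.sum_sum_type, ringJump] using this

lemma int_abs_mul_sign (a : ℤ) : |(a : ℝ)| * (a.sign : ℝ) = a := by
  rcases lt_trichotomy a 0 with h | h | h
  · rw [Int.sign_eq_neg_one_of_neg h, abs_of_neg (Int.cast_lt_zero.2 h)]; simp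
  · simp [h]
  · rw [Int.sign_eq_one_of_pos h, abs_of_pos (Int.cast_pos.2 h)]; simp

lemma int_abs_sign_le (a : ℤ) : |(a.sign : ℝ)| ≤ 1 := by
  rcases lt_trichotomy a 0 with h | h | h
  · rw [Int.sign_eq_neg_one_of_neg h]; simp
  · simp [h]
  · rw [Int.sign_eq_one_of_pos h]; simp

lemma int_abs_mul_sign_sq (a : ℤ) : |(a : ℝ)| * (a.sign : ℝ) ^ 2 = |(a : ℝ)| := by
  rcases lt_trichotomy a 0 with h | h | h
  · rw [Int.sign_eq_neg_one_of_neg h]; simp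
  · simp [h]
  · rw [Int.sign_eq_one_of_pos h]; simp

lemma finite_ringCoord_sublevel (R : ℝ) :
    {f : State (ZMod n) (ZMod n) | 1 + ∑ i, |ringCoord f i| ≤ R}.Finite := by
  have hfin : ((Set.pi univ fun _ : ZMod n => Icc (-⌈R⌉) ⌈R⌉) ×ˢ
      (Set.pi univ fun _ : ZMod n => Icc (-⌈R⌉) ⌈R⌉)).Finite :=
    (Set.Finite.pi fun _ => finite_Icc _ _).prod (Set.Finite.pi fun _ => finite_Icc _ _)
  refine hfin.subset fun f hf => ?_
  have h1 : ∀ i, |ringCoord f i| ≤ R := fun i => by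
    have : |ringCoord f i| ≤ ∑ i, |ringCoord f i| :=
      Finset.single_le_sum (f := fun i => |ringCoord f i|) (fun i _ => abs_nonneg _)
        (Finset.mem_univ i)
    have hf : 1 + ∑ i, |ringCoord f i| ≤ R := hf
    linarith
  have h2 : ∀ a : ℤ, |(a : ℝ)| ≤ R → a ∈ Icc (-⌈R⌉) ⌈R⌉ := fun a ha => by
    have := abs_le.1 (ha.trans (Int.le_ceil R))
    exact ⟨by exact_mod_cast this.1, by exact_mod_cast this.2⟩
  exact ⟨fun k _ => h2 _ (h1 (Sum.inl k)), fun k _ => h2 _ (h1 (Sum.inr k))⟩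

lemma ring_isSkewJumpSystem (n : ℕ) [NeZero n] :
    IsSkewJumpSystem (n : ℝ) (ringJump n) ringCoord ringSign (ringRate n) (ringTransition n) where
  nonneg := Nat.cast_nonneg n
  rate _ _ := rfl
  jump := ringCoord_transition
  abs_mul_sign f i := by rcases i with k | k <;> exact int_abs_mul_sign _
  abs_sign_le f i := by rcases i with k | k <;> exact int_abs_sign_le _
  abs_mul_sign_sq f i := by rcases i with k | k <;> exact int_abs_mul_sign_sq _
  antisymm := ringJump_antisymm
  abs_le_one := abs_ringJump_le
  sum_abs_le := sum_ringJump_le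
  finite_sublevel := finite_ringCoord_sublevel

lemma sum_mul_ringJump_inl (a : ZMod n ⊕ ZMod n → ℝ) (k : ZMod n) :
    ∑ i, a i * ringJump n i (Sum.inl k) = a (Sum.inr k) - a (Sum.inr (k - 1)) := by
  have : ∀ e : ZMod n, (k = e + 1) ↔ e = k - 1 := fun e => by rw [eq_sub_iff_add_eq, eq_comm]
  simp [Fintype.sum_sum_type, ringJump, mul_sub, this]

lemma sum_mul_ringJump_inr (a : ZMod n ⊕ ZMod n → ℝ) (k : ZMod n) :
    ∑ i, a i * ringJump n i (Sum.inr k) = a (Sum.inl (k + 1)) - a (Sum.inl k) := by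
  simp [Fintype.sum_sum_type, ringJump, mul_sub]

end Ring

/-! ### Classical solutions of the wave equation -/

/-- The profile of the wave travelling to the left. -/
noncomputable def leftProfile (φ ψ : ℝ → ℝ) (y : ℝ) : ℝ := (ψ y + deriv φ y) / 2

/-- The profile of the wave travelling to the right. -/
noncomputable def rightProfile (φ ψ : ℝ → ℝ) (y : ℝ) : ℝ := (ψ y - deriv φ y) / 2

/-- The velocity of the d'Alembert solution. -/
noncomputable def waveVelocity (φ ψ : ℝ → ℝ) (x t : ℝ) : ℝ :=
  leftProfile φ ψ (x + t) + rightProfile φ ψ (x - t)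

/-- The strain of the d'Alembert solution. -/
noncomputable def waveStrain (φ ψ : ℝ → ℝ) (x t : ℝ) : ℝ :=
  leftProfile φ ψ (x + t) - rightProfile φ ψ (x - t)

namespace IsClassicalWaveSolution

variable {φ ψ : ℝ → ℝ} {u : ℝ → ℝ → ℝ}

lemma hasDerivWithinAt_time (hu : IsClassicalWaveSolution φ ψ u) (x : ℝ) {t : ℝ} (ht : 0 ≤ t) :
    HasDerivWithinAt (fun s => u x s)
      (fderivWithin ℝ (fun p : ℝ × ℝ => u p.1 p.2) (univ ×ˢ Ici 0) (x, t) (0, 1)) (Ici 0) t := by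
  have h1 : HasFDerivWithinAt (fun p : ℝ × ℝ => u p.1 p.2)
      (fderivWithin ℝ (fun p : ℝ × ℝ => u p.1 p.2) (univ ×ˢ Ici 0) (x, t)) (univ ×ˢ Ici 0) (x, t) :=
    (hu.smooth.differentiableOn (by norm_num) (x, t) ⟨mem_univ _, ht⟩).hasFDerivWithinAt
  have h2 : HasDerivWithinAt (fun s : ℝ => (x, s)) (0, 1) (Ici 0) t :=
    ((hasDerivAt_const t x).prodMk (hasDerivAt_id t)).hasDerivWithinAt
  exact h1.comp_hasDerivWithinAt (f := fun s : ℝ => (x, s)) t h2 fun s hs => ⟨mem_univ _, hs⟩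

lemma hasDerivAt_space (hu : IsClassicalWaveSolution φ ψ u) (x : ℝ) {t : ℝ} (ht : 0 ≤ t) :
    HasDerivAt (fun y => u y t)
      (fderivWithin ℝ (fun p : ℝ × ℝ => u p.1 p.2) (univ ×ˢ Ici 0) (x, t) (1, 0)) x := by
  have h1 : HasFDerivWithinAt (fun p : ℝ × ℝ => u p.1 p.2)
      (fderivWithin ℝ (fun p : ℝ × ℝ => u p.1 p.2) (univ ×ˢ Ici 0) (x, t)) (univ ×ˢ Ici 0) (x, t) :=
    (hu.smooth.differentiableOn (by norm_num) (x, t) ⟨mem_univ _, ht⟩).hasFDerivWithinAt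
  have h2 : HasDerivWithinAt (fun y : ℝ => (y, t)) (1, 0) univ x :=
    ((hasDerivAt_id x).prodMk (hasDerivAt_const x t)).hasDerivWithinAt
  exact hasDerivWithinAt_univ.1
    (h1.comp_hasDerivWithinAt (f := fun y : ℝ => (y, t)) x h2 fun s _ => ⟨mem_univ _, ht⟩)

lemma timeDeriv_eq (hu : IsClassicalWaveSolution φ ψ u) (x : ℝ) {t : ℝ} (ht : 0 ≤ t) :
    timeDeriv u x t =
      fderivWithin ℝ (fun p : ℝ × ℝ => u p.1 p.2) (univ ×ˢ Ici 0) (x, t) (0, 1) :=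
  (hu.hasDerivWithinAt_time x ht).derivWithin (uniqueDiffOn_Ici 0 t ht)

lemma spaceDeriv_eq (hu : IsClassicalWaveSolution φ ψ u) (x : ℝ) {t : ℝ} (ht : 0 ≤ t) :
    spaceDeriv u x t =
      fderivWithin ℝ (fun p : ℝ × ℝ => u p.1 p.2) (univ ×ˢ Ici 0) (x, t) (1, 0) :=
  (hu.hasDerivAt_space x ht).deriv

lemma contDiffOn_fderivWithin (hu : IsClassicalWaveSolution φ ψ u) :
    ContDiffOn ℝ 1 (fderivWithin ℝ (fun p : ℝ × ℝ => u p.1 p.2) (univ ×ˢ Ici 0))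
      (univ ×ˢ Ici 0) :=
  hu.smooth.fderivWithin (uniqueDiffOn_univ.prod (uniqueDiffOn_Ici 0)) (by norm_num)

/-- The combinations `∂ₜu ± ∂ₓu` are constant along the characteristics. -/
lemma timeDeriv_add_spaceDeriv (hu : IsClassicalWaveSolution φ ψ u) {ε : ℝ} (hε : ε * ε = 1)
    (x : ℝ) {t : ℝ} (ht : 0 ≤ t) :
    timeDeriv u x t + ε * spaceDeriv u x t = ψ (x + ε * t) + ε * deriv φ (x + ε * t) := by
  set S : Set (ℝ × ℝ) := univ ×ˢ Ici 0 with hS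
  set U : ℝ × ℝ → ℝ := fun p => u p.1 p.2 with hU
  set D := fderivWithin ℝ U S with hD
  have hzero : timeDeriv u (x + ε * t) 0 + ε * spaceDeriv u (x + ε * t) 0 =
      ψ (x + ε * t) + ε * deriv φ (x + ε * t) := by
    have h1 : (fun y => u y 0) = φ := funext hu.initial_value
    rw [timeDeriv, hu.initial_velocity, spaceDeriv, h1]
  rw [← hzero]
  rcases ht.eq_or_lt with rfl | htpos
  · simp
  rw [hu.timeDeriv_eq _ ht, hu.spaceDeriv_eq _ ht, hu.timeDeriv_eq _ le_rfl,
    hu.spaceDeriv_eq _ le_rfl]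
  -- The characteristic through (x, t), which starts on the axis at (x + εt, 0). `G` is the
  -- combination of derivatives that it transports.
  set γ : ℝ → ℝ × ℝ := fun s => (x + ε * (t - s), s) with hγ
  set G : ℝ → ℝ := fun s => D (γ s) (0, 1) + ε * D (γ s) (1, 0) with hG
  suffices G t = G 0 by
    simpa [hG, hγ] using this
  have hγS : ∀ s ∈ Icc 0 t, γ s ∈ S := fun s hs => ⟨mem_univ _, hs.1⟩
  have hγc : Continuous γ := by fun_prop
  have hDγ : ContinuousOn (fun s => D (γ s)) (Icc 0 t) :=
    hu.contDiffOn_fderivWithin.continuousOn.comp hγc.continuousOn hγS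
  have hGc : ContinuousOn G (Icc 0 t) :=
    (hDγ.clm_apply continuousOn_const).add (continuousOn_const.mul (hDγ.clm_apply continuousOn_const))
  have hnhds : ∀ p : ℝ × ℝ, 0 < p.2 → S ∈ 𝓝 p := fun p hp => by
    rw [hS]
    exact prod_mem_nhds univ_mem (Ici_mem_nhds hp)
  have hGd : ∀ s ∈ Ioo 0 t, HasDerivAt G 0 s := by
    intro s hs
    set P := γ s with hP
    have hP2 : 0 < P.2 := hs.1
    have hDdiff : ∀ p : ℝ × ℝ, 0 < p.2 → HasFDerivAt D (fderiv ℝ D p) p := fun p hp =>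
      ((hu.contDiffOn_fderivWithin.contDiffAt (hnhds p hp)).differentiableAt
        (by norm_num)).hasFDerivAt
    have hUd : ∀ p : ℝ × ℝ, 0 < p.2 → HasFDerivAt U (D p) p := fun p hp =>
      ((hu.smooth.differentiableOn (by norm_num) p ⟨mem_univ _, hp.le⟩).hasFDerivWithinAt).hasFDerivAt
        (hnhds p hp)
    have hsymm : ∀ v w, fderiv ℝ D P v w = fderiv ℝ D P w v := fun v w =>
      second_derivative_symmetric_of_eventually (f := U) (f' := D)
        (by
          have : ∀ᶠ p : ℝ × ℝ in 𝓝 P, 0 < p.2 :=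
            continuous_snd.continuousAt.eventually (lt_mem_nhds hP2)
          exact this.mono hUd) (hDdiff P hP2) v w
    have htt : iteratedDeriv 2 (fun s => u P.1 s) P.2 = fderiv ℝ D P (0, 1) (0, 1) := by
      rw [iteratedDeriv_succ, iteratedDeriv_one]
      have h1 : deriv (fun s => u P.1 s) =ᶠ[𝓝 P.2] fun s => D (P.1, s) (0, 1) := by
        filter_upwards [lt_mem_nhds hP2] with r hr
        exact ((hu.hasDerivWithinAt_time P.1 hr.le).hasDerivAt (Ici_mem_nhds hr)).deriv
      rw [h1.deriv_eq]
      have h2 : HasDerivAt (fun s => D (P.1, s)) (fderiv ℝ D P (0, 1)) P.2 :=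
        (hDdiff P hP2).comp_hasDerivAt (f := fun s : ℝ => (P.1, s)) P.2
          ((hasDerivAt_const P.2 P.1).prodMk (hasDerivAt_id P.2))
      exact (h2.clm_apply (hasDerivAt_const P.2 ((0, 1) : ℝ × ℝ))).deriv.trans (by simp)
    have hxx : iteratedDeriv 2 (fun y => u y P.2) P.1 = fderiv ℝ D P (1, 0) (1, 0) := by
      rw [iteratedDeriv_succ, iteratedDeriv_one]
      have h1 : deriv (fun y => u y P.2) = fun y => D (y, P.2) (1, 0) :=
        funext fun y => (hu.hasDerivAt_space y hP2.le).deriv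
      rw [h1]
      have h2 : HasDerivAt (fun y => D (y, P.2)) (fderiv ℝ D P (1, 0)) P.1 :=
        (hDdiff P hP2).comp_hasDerivAt (f := fun y : ℝ => (y, P.2)) P.1
          ((hasDerivAt_id P.1).prodMk (hasDerivAt_const P.1 P.2))
      exact (h2.clm_apply (hasDerivAt_const P.1 ((1, 0) : ℝ × ℝ))).deriv.trans (by simp)
    have heq := hu.equation P.1 P.2 hP2
    rw [htt, hxx] at heq
    have hγd : HasDerivAt γ (ε * (-1), 1) s :=
      ((((hasDerivAt_id s).const_sub t).const_mul ε).const_add x).prodMk (hasDerivAt_id s)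
    have hDd : HasDerivAt (fun s => D (γ s)) (fderiv ℝ D P (ε * (-1), 1)) s :=
      (hDdiff P hP2).comp_hasDerivAt (f := γ) s hγd
    have h3 := (hDd.clm_apply (hasDerivAt_const s ((0, 1) : ℝ × ℝ))).add
      ((hDd.clm_apply (hasDerivAt_const s ((1, 0) : ℝ × ℝ))).const_mul ε)
    refine h3.congr_deriv ?_
    -- With γ' = -ε ∂ₓ + ∂ₜ, the derivative of `G` is u_tt - ε² u_xx plus mixed terms that cancel by
    -- symmetry of the second derivative; ε² = 1 reduces it to the wave equation. The equation is
    -- known only for positive times, so the constancy on [0, t] also uses the continuity of `G` at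
    -- the ends.
    have hv : ((ε * (-1), 1) : ℝ × ℝ) = (-ε) • ((1, 0) : ℝ × ℝ) + ((0, 1) : ℝ × ℝ) := by
      simp
    rw [hv]
    simp only [map_add, map_smul, map_zero, add_zero, add_apply,
      smul_apply, smul_eq_mul]
    have hs1 := hsymm (1, 0) (0, 1)
    linear_combination heq - ε * hs1 - hε * fderiv ℝ D P (1, 0) (1, 0)
  obtain ⟨c, -, hc⟩ := exists_hasDerivAt_eq_slope G (fun _ => 0) htpos hGc hGd
  have hc' : (0 : ℝ) = (G t - G 0) / (t - 0) := hc
  rw [eq_comm, div_eq_zero_iff] at hc'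
  rcases hc' with h | h <;> linarith

lemma timeDeriv_eq_waveVelocity (hu : IsClassicalWaveSolution φ ψ u) (x : ℝ) {t : ℝ}
    (ht : 0 ≤ t) : timeDeriv u x t = waveVelocity φ ψ x t := by
  have h1 := hu.timeDeriv_add_spaceDeriv (ε := 1) (by norm_num) x ht
  have h2 := hu.timeDeriv_add_spaceDeriv (ε := -1) (by norm_num) x ht
  rw [neg_one_mul, neg_one_mul, neg_one_mul, ← sub_eq_add_neg, ← sub_eq_add_neg] at h2
  rw [waveVelocity, leftProfile, rightProfile]
  rw [one_mul, one_mul, one_mul] at h1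
  rw [← sub_eq_add_neg] at h2
  linarith

lemma spaceDeriv_eq_waveStrain (hu : IsClassicalWaveSolution φ ψ u) (x : ℝ) {t : ℝ}
    (ht : 0 ≤ t) : spaceDeriv u x t = waveStrain φ ψ x t := by
  have h1 := hu.timeDeriv_add_spaceDeriv (ε := 1) (by norm_num) x ht
  have h2 := hu.timeDeriv_add_spaceDeriv (ε := -1) (by norm_num) x ht
  rw [neg_one_mul, neg_one_mul, neg_one_mul, ← sub_eq_add_neg, ← sub_eq_add_neg] at h2
  rw [waveStrain, leftProfile, rightProfile]
  rw [one_mul, one_mul, one_mul] at h1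
  rw [← sub_eq_add_neg] at h2
  linarith

lemma eq_add_integral (hu : IsClassicalWaveSolution φ ψ u)
    (hc : ∀ x, Continuous fun t => waveVelocity φ ψ x t) (x : ℝ) {t : ℝ} (ht : 0 ≤ t) :
    u x t = φ x + ∫ s in (0 : ℝ)..t, waveVelocity φ ψ x s := by
  have hd : ∀ s, 0 ≤ s → HasDerivWithinAt (fun s => u x s) (waveVelocity φ ψ x s) (Ici 0) s :=
    fun s hs => by
      rw [← hu.timeDeriv_eq_waveVelocity x hs, hu.timeDeriv_eq x hs]
      exact hu.hasDerivWithinAt_time x hs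
  rw [intervalIntegral.integral_eq_sub_of_hasDeriv_right_of_le ht
    (f := fun s => u x s) (fun s hs => ((hd s hs.1).continuousWithinAt).mono Icc_subset_Ici_self)
    (fun s hs => (hd s hs.1.le).mono (fun r hr => (hs.1.trans hr).le))
    ((hc x).intervalIntegrable _ _), hu.initial_value]
  ring

end IsClassicalWaveSolution

/-! ### Smooth periodic profiles -/

/-- A bound of `f`, of its Lipschitz constant and of its first-order Taylor remainder. -/
structure IsTaylorBound (f : ℝ → ℝ) (K : ℝ) : Prop where
  abs_le : ∀ y, |f y| ≤ K
  lipschitz : ∀ y z, |f y - f z| ≤ K * |y - z|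
  taylor : ∀ y h, |f (y + h) - f y - h * deriv f y| ≤ K * h ^ 2

lemma IsTaylorBound.mono {f : ℝ → ℝ} {K K' : ℝ} (h : IsTaylorBound f K) (hK : K ≤ K') :
    IsTaylorBound f K' where
  abs_le y := (h.abs_le y).trans hK
  lipschitz y z := (h.lipschitz y z).trans (mul_le_mul_of_nonneg_right hK (abs_nonneg _))
  taylor y z := (h.taylor y z).trans (mul_le_mul_of_nonneg_right hK (sq_nonneg _))

lemma exists_bound_of_continuous_periodic {f : ℝ → ℝ} (hc : Continuous f)
    (hp : Function.Periodic f 1) : ∃ K, ∀ y, |f y| ≤ K := by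
  obtain ⟨K, hK⟩ := (isCompact_Icc (a := (0 : ℝ)) (b := 1)).exists_bound_of_continuousOn
    hc.continuousOn
  refine ⟨K, fun y => ?_⟩
  obtain ⟨z, hz, hyz⟩ := hp.exists_mem_Ico₀ one_pos y
  rw [hyz]
  exact hK z ⟨hz.1, hz.2.le⟩

lemma periodic_deriv {f : ℝ → ℝ} (hp : Function.Periodic f 1) :
    Function.Periodic (deriv f) 1 := fun y => by
  have h1 : (fun y => f (y + 1)) = f := funext hp
  rw [← deriv_comp_add_const, h1]

lemma abs_sub_le_of_abs_deriv_le {f : ℝ → ℝ} (hd : Differentiable ℝ f) {K : ℝ}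
    (hK : ∀ y, |deriv f y| ≤ K) (y z : ℝ) : |f y - f z| ≤ K * |y - z| := by
  have := convex_univ.norm_image_sub_le_of_norm_deriv_le (f := f) (fun x _ => hd x)
    (fun x _ => hK x) (mem_univ z) (mem_univ y)
  exact this

lemma exists_isTaylorBound {f : ℝ → ℝ} (hf : ContDiff ℝ 2 f) (hp : Function.Periodic f 1) :
    ∃ K, IsTaylorBound f K := by
  have hd : Differentiable ℝ f := hf.differentiable (by norm_num)
  have hf1 : ContDiff ℝ 1 (deriv f) := by
    have : ContDiff ℝ (1 + 1) f := by simpa [one_add_one_eq_two] using hf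
    exact ((contDiff_succ_iff_deriv).1 this).2.2
  have hd1 : Differentiable ℝ (deriv f) := hf1.differentiable (by norm_num)
  have hc2 : Continuous (deriv (deriv f)) := hf1.continuous_deriv (by norm_num)
  have hp1 := periodic_deriv hp
  obtain ⟨K0, h0⟩ := exists_bound_of_continuous_periodic hf.continuous hp
  obtain ⟨K1, h1⟩ := exists_bound_of_continuous_periodic hf1.continuous hp1
  obtain ⟨K2, h2⟩ := exists_bound_of_continuous_periodic hc2 (periodic_deriv hp1)
  have hK0 := (abs_nonneg _).trans (h0 0)
  have hK1 := (abs_nonneg _).trans (h1 0)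
  have hK2 := (abs_nonneg _).trans (h2 0)
  refine ⟨K0 + K1 + K2, fun y => (h0 y).trans (by linarith), fun y z => ?_, fun y h => ?_⟩
  · exact (abs_sub_le_of_abs_deriv_le hd h1 y z).trans
      (mul_le_mul_of_nonneg_right (by linarith) (abs_nonneg _))
  -- Mean value inequality for z ↦ f(y + z) - z f'(y) on [-|h|, |h|], where its derivative f'(y + z)
  -- - f'(y) is at most K2 |h|.
  · have hg : ∀ z ∈ Icc (-|h|) |h|,
        HasDerivWithinAt (fun z => f (y + z) - z * deriv f y) (deriv f (y + z) - 1 * deriv f y)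
          (Icc (-|h|) |h|) z := fun z _ =>
      ((((hd (y + z)).hasDerivAt).comp_const_add y z).sub
        ((hasDerivAt_id z).mul_const _)).hasDerivWithinAt
    have := (convex_Icc (-|h|) |h|).norm_image_sub_le_of_norm_hasDerivWithin_le
      (f := fun z => f (y + z) - z * deriv f y) (C := K2 * |h|) hg (fun z hz => by
        rw [one_mul]
        refine (abs_sub_le_of_abs_deriv_le hd1 h2 (y + z) y).trans ?_
        rw [add_sub_cancel_left]
        exact mul_le_mul_of_nonneg_left (abs_le.2 hz) hK2)
      (x := 0) (y := h) ⟨by simp, by simp⟩ ⟨neg_abs_le h, le_abs_self h⟩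
    simp only [add_zero, zero_mul, sub_zero, Real.norm_eq_abs] at this
    calc |f (y + h) - f y - h * deriv f y| = |f (y + h) - h * deriv f y - f y| := by
          congr 1; ring
      _ ≤ K2 * |h| * |h| := this
      _ = K2 * h ^ 2 := by rw [mul_assoc, ← sq, sq_abs]
      _ ≤ _ := mul_le_mul_of_nonneg_right (by linarith) (sq_nonneg _)

lemma IsTaylorBound.nonneg {f : ℝ → ℝ} {K : ℝ} (h : IsTaylorBound f K) : 0 ≤ K :=
  (abs_nonneg _).trans (h.abs_le 0)

/-- Smooth periodic initial data with uniform bounds of the corresponding wave profiles. -/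
structure IsWaveData (φ ψ : ℝ → ℝ) (K : ℝ) : Prop where
  left_differentiable : Differentiable ℝ (leftProfile φ ψ)
  right_differentiable : Differentiable ℝ (rightProfile φ ψ)
  left_periodic : Function.Periodic (leftProfile φ ψ) 1
  right_periodic : Function.Periodic (rightProfile φ ψ) 1
  left_bound : IsTaylorBound (leftProfile φ ψ) K
  right_bound : IsTaylorBound (rightProfile φ ψ) K
  initial_bound : IsTaylorBound φ K

lemma exists_isWaveData {φ ψ : ℝ → ℝ} (hφ : ContDiff ℝ (⊤ : ℕ∞) φ) (hψ : ContDiff ℝ (⊤ : ℕ∞) ψ)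
    (hφ_per : Function.Periodic φ 1) (hψ_per : Function.Periodic ψ 1) :
    ∃ K, IsWaveData φ ψ K := by
  -- The profiles contain φ' and must be twice continuously differentiable for the Taylor bound,
  -- hence three derivatives of φ.
  have h3 : ContDiff ℝ (2 + 1) φ := by exact_mod_cast contDiff_infty.1 hφ (2 + 1)
  have hφ' : ContDiff ℝ 2 (deriv φ) := ((contDiff_succ_iff_deriv).1 h3).2.2
  have hψ2 : ContDiff ℝ 2 ψ := by exact_mod_cast contDiff_infty.1 hψ 2
  have hφ2 : ContDiff ℝ 2 φ := by exact_mod_cast contDiff_infty.1 hφ 2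
  have hl : ContDiff ℝ 2 (leftProfile φ ψ) := (hψ2.add hφ').div_const 2
  have hr : ContDiff ℝ 2 (rightProfile φ ψ) := (hψ2.sub hφ').div_const 2
  have hpl : Function.Periodic (leftProfile φ ψ) 1 := fun y => by
    rw [leftProfile, leftProfile, hψ_per y, periodic_deriv hφ_per y]
  have hpr : Function.Periodic (rightProfile φ ψ) 1 := fun y => by
    rw [rightProfile, rightProfile, hψ_per y, periodic_deriv hφ_per y]
  obtain ⟨K1, h1⟩ := exists_isTaylorBound hl hpl
  obtain ⟨K2, h2⟩ := exists_isTaylorBound hr hpr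
  obtain ⟨K3, h3⟩ := exists_isTaylorBound hφ2 hφ_per
  exact ⟨max K1 (max K2 K3), hl.differentiable (by norm_num), hr.differentiable (by norm_num),
    hpl, hpr, h1.mono (le_max_left _ _), h2.mono (le_max_of_le_right (le_max_left _ _)),
    h3.mono (le_max_of_le_right (le_max_right _ _))⟩

namespace IsWaveData

variable {φ ψ : ℝ → ℝ} {K : ℝ}

lemma nonneg (h : IsWaveData φ ψ K) : 0 ≤ K := h.left_bound.nonneg

lemma continuous_velocity (h : IsWaveData φ ψ K) :
    Continuous fun p : ℝ × ℝ => waveVelocity φ ψ p.1 p.2 :=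
  (h.left_differentiable.continuous.comp (by fun_prop)).add
    (h.right_differentiable.continuous.comp (by fun_prop))

lemma continuous_strain (h : IsWaveData φ ψ K) :
    Continuous fun p : ℝ × ℝ => waveStrain φ ψ p.1 p.2 :=
  (h.left_differentiable.continuous.comp (by fun_prop)).sub
    (h.right_differentiable.continuous.comp (by fun_prop))

lemma abs_velocity_le (h : IsWaveData φ ψ K) (x t : ℝ) : |waveVelocity φ ψ x t| ≤ 2 * K := by
  refine (abs_add_le _ _).trans ?_
  linarith [h.left_bound.abs_le (x + t), h.right_bound.abs_le (x - t)]

lemma abs_strain_le (h : IsWaveData φ ψ K) (x t : ℝ) : |waveStrain φ ψ x t| ≤ 2 * K := by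
  refine (abs_sub _ _).trans ?_
  linarith [h.left_bound.abs_le (x + t), h.right_bound.abs_le (x - t)]

lemma abs_velocity_sub_le (h : IsWaveData φ ψ K) (x y t : ℝ) :
    |waveVelocity φ ψ x t - waveVelocity φ ψ y t| ≤ 2 * K * |x - y| := by
  have h1 := h.left_bound.lipschitz (x + t) (y + t)
  have h2 := h.right_bound.lipschitz (x - t) (y - t)
  rw [show x + t - (y + t) = x - y by ring] at h1
  rw [show x - t - (y - t) = x - y by ring] at h2
  rw [waveVelocity, waveVelocity, show ∀ a b c d : ℝ, a + b - (c + d) = a - c + (b - d) by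
    intros; ring]
  refine (abs_add_le _ _).trans ?_
  linarith

lemma abs_strain_sub_le (h : IsWaveData φ ψ K) (x y t : ℝ) :
    |waveStrain φ ψ x t - waveStrain φ ψ y t| ≤ 2 * K * |x - y| := by
  have h1 := h.left_bound.lipschitz (x + t) (y + t)
  have h2 := h.right_bound.lipschitz (x - t) (y - t)
  rw [show x + t - (y + t) = x - y by ring] at h1
  rw [show x - t - (y - t) = x - y by ring] at h2
  rw [waveStrain, waveStrain, show ∀ a b c d : ℝ, a - b - (c - d) = a - c - (b - d) by
    intros; ring]
  refine (abs_sub _ _).trans ?_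
  linarith

end IsWaveData

/-! ### The mean of the particle system and the wave equation -/

lemma card_ring_sum (n : ℕ) [NeZero n] : Fintype.card (ZMod n ⊕ ZMod n) = 2 * n := by
  rw [Fintype.card_sum, ZMod.card]; ring

/-- Periodicity absorbs the wrap-around at k = n - 1, where the representative of k + 1 drops to 0.
-/
lemma periodic_val_add_one {f : ℝ → ℝ} (hf : Function.Periodic f 1) {n : ℕ} [NeZero n]
    (k : ZMod n) : f (((k + 1).val : ℝ) / n) = f ((k.val : ℝ) / n + 1 / n) := by
  have hn : (n : ℝ) ≠ 0 := Nat.cast_ne_zero.2 (NeZero.ne n)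
  have h1 : (k + 1).val = (k.val + 1) % n := by
    rw [← ZMod.val_natCast n (k.val + 1)]
    congr 1
    simp
  have h2 : ((k.val + 1 : ℕ) : ℝ) = (n : ℝ) * ((k.val + 1) / n : ℕ) + ((k + 1).val : ℝ) := by
    rw [h1]; exact_mod_cast (Nat.div_add_mod (k.val + 1) n).symm
  have h3 : (k.val : ℝ) / n + 1 / n = ((k + 1).val : ℝ) / n + ((k.val + 1) / n : ℕ) * 1 := by
    rw [← add_div, div_eq_iff hn, add_mul, div_mul_cancel₀ _ hn]
    push_cast at h2 ⊢
    linarith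
  rw [h3]
  exact (hf.nat_mul _ _).symm

/-- The values of velocity and strain of the d'Alembert solution at the sites of the ring. -/
noncomputable def gridWave (φ ψ : ℝ → ℝ) (n : ℕ) (t : ℝ) : ZMod n ⊕ ZMod n → ℝ :=
  Sum.elim (fun k => waveVelocity φ ψ ((k.val : ℝ) / n) t)
    (fun k => waveStrain φ ψ ((k.val : ℝ) / n) t)

/-- The time derivatives of `gridWave`. -/
noncomputable def gridWaveDeriv (φ ψ : ℝ → ℝ) (n : ℕ) (t : ℝ) : ZMod n ⊕ ZMod n → ℝ :=
  Sum.elim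
    (fun k => deriv (leftProfile φ ψ) ((k.val : ℝ) / n + t) -
      deriv (rightProfile φ ψ) ((k.val : ℝ) / n - t))
    (fun k => deriv (leftProfile φ ψ) ((k.val : ℝ) / n + t) +
      deriv (rightProfile φ ψ) ((k.val : ℝ) / n - t))

namespace IsWaveData

variable {φ ψ : ℝ → ℝ} {K : ℝ} {n : ℕ} [NeZero n]

lemma velocity_periodic (h : IsWaveData φ ψ K) (t : ℝ) :
    Function.Periodic (fun x => waveVelocity φ ψ x t) 1 := fun x => by
  simp only [waveVelocity, add_right_comm x 1 t, add_sub_right_comm x 1 t, h.left_periodic _,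
    h.right_periodic _]

lemma strain_periodic (h : IsWaveData φ ψ K) (t : ℝ) :
    Function.Periodic (fun x => waveStrain φ ψ x t) 1 := fun x => by
  simp only [waveStrain, add_right_comm x 1 t, add_sub_right_comm x 1 t, h.left_periodic _,
    h.right_periodic _]

lemma hasDerivAt_gridWave (h : IsWaveData φ ψ K) (t : ℝ) (i : ZMod n ⊕ ZMod n) :
    HasDerivAt (fun t => gridWave φ ψ n t i) (gridWaveDeriv φ ψ n t i) t := by
  have hl : ∀ x, HasDerivAt (fun t => leftProfile φ ψ (x + t)) (deriv (leftProfile φ ψ) (x + t)) t :=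
    fun x => ((h.left_differentiable (x + t)).hasDerivAt).comp_const_add x t
  have hr : ∀ x, HasDerivAt (fun t => rightProfile φ ψ (x - t))
      (-deriv (rightProfile φ ψ) (x - t)) t :=
    fun x => ((h.right_differentiable (x - t)).hasDerivAt).comp_const_sub x t
  rcases i with k | k
  · exact (hl _).add (hr _)
  · exact ((hl _).sub (hr _)).congr_deriv (sub_neg_eq_add _ _)

lemma abs_mul_diff_sub_le {f : ℝ → ℝ} (h : IsTaylorBound f K) (y s : ℝ) (hn : 0 < n)
    (hs : s = 1 ∨ s = -1) :
    |s * (n * (f (y + s / n) - f y)) - deriv f y| ≤ K / n := by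
  have hn' : (0 : ℝ) < n := Nat.cast_pos.2 hn
  have hs2 : s * s = 1 := by rcases hs with rfl | rfl <;> norm_num
  have h1 := h.taylor y (s / n)
  have h2 : s * (n * (f (y + s / n) - f y)) - deriv f y =
      s * n * (f (y + s / n) - f y - s / n * deriv f y) := by
    field_simp
    linear_combination deriv f y * hs2
  have h3 : |s * n| = n := by
    rcases hs with rfl | rfl <;> simp
  rw [h2, abs_mul, h3]
  calc (n : ℝ) * |f (y + s / n) - f y - s / n * deriv f y| ≤ n * (K * (s / n) ^ 2) :=
        mul_le_mul_of_nonneg_left h1 hn'.le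
    _ = K / n * (s * s) := by field_simp
    _ = _ := by rw [hs2, mul_one]

/-- Consistency of the scheme: the exact wave, sampled on the grid, solves the equation of the means
up to O(1/n). Vertices see the backward difference of the strain, edges the forward difference of
the velocity, and each of the two travelling profiles contributes K/n. -/
lemma abs_residual_le (h : IsWaveData φ ψ K) (t : ℝ) (i : ZMod n ⊕ ZMod n) :
    |n * ∑ k, gridWave φ ψ n t k * ringJump n k i - gridWaveDeriv φ ψ n t i| ≤ 2 * K / n := by
  have hn := NeZero.pos n
  rcases i with k | k
  · have hx : ∀ t, waveStrain φ ψ (((k - 1 : ZMod n).val : ℝ) / n) t =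
        waveStrain φ ψ ((k.val : ℝ) / n - 1 / n) t := fun t => by
      have hper : Function.Periodic (fun x => waveStrain φ ψ (x - 1 / n) t) 1 := fun x => by
        have := h.strain_periodic t (x - 1 / n)
        simp only at this ⊢
        rw [← this]; congr 1; ring
      have := periodic_val_add_one hper (k - 1)
      simp only [sub_add_cancel, add_sub_cancel_right] at this
      exact this.symm
    rw [sum_mul_ringJump_inl]
    simp only [gridWave, gridWaveDeriv, Sum.elim_inr, Sum.elim_inl, hx]
    simp only [waveStrain]
    have h1 := abs_mul_diff_sub_le h.left_bound ((k.val : ℝ) / n + t) (-1) hn (Or.inr rfl)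
    have h2 := abs_mul_diff_sub_le h.right_bound ((k.val : ℝ) / n - t) (-1) hn (Or.inr rfl)
    have e1 : (k.val : ℝ) / n + t + -1 / n = (k.val : ℝ) / n - 1 / n + t := by ring
    have e2 : (k.val : ℝ) / n - t + -1 / n = (k.val : ℝ) / n - 1 / n - t := by ring
    rw [e1] at h1
    rw [e2] at h2
    rw [mul_div_assoc, two_mul]
    refine le_trans (le_of_eq ?_) ((abs_sub _ _).trans (add_le_add h1 h2))
    congr 1; ring
  · have hx : ∀ t, waveVelocity φ ψ (((k + 1 : ZMod n).val : ℝ) / n) t =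
        waveVelocity φ ψ ((k.val : ℝ) / n + 1 / n) t := fun t =>
      periodic_val_add_one (h.velocity_periodic t) k
    rw [sum_mul_ringJump_inr]
    simp only [gridWave, gridWaveDeriv, Sum.elim_inr, Sum.elim_inl, hx]
    simp only [waveVelocity]
    have h1 := abs_mul_diff_sub_le h.left_bound ((k.val : ℝ) / n + t) 1 hn (Or.inl rfl)
    have h2 := abs_mul_diff_sub_le h.right_bound ((k.val : ℝ) / n - t) 1 hn (Or.inl rfl)
    have e1 : (k.val : ℝ) / n + t + 1 / n = (k.val : ℝ) / n + 1 / n + t := by ring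
    have e2 : (k.val : ℝ) / n - t + 1 / n = (k.val : ℝ) / n + 1 / n - t := by ring
    rw [e1] at h1
    rw [e2] at h2
    rw [mul_div_assoc, two_mul]
    refine le_trans (le_of_eq ?_) ((abs_add_le _ _).trans (add_le_add h1 h2))
    congr 1; ring

lemma abs_floor_mul_div_sub_le {N : ℕ} (hN : 0 < N) (a : ℝ) :
    |(⌊(N : ℝ) * a⌋ : ℝ) / N - a| ≤ 1 / N := by
  have hN' : (0 : ℝ) < N := Nat.cast_pos.2 hN
  have h1 := Int.floor_le ((N : ℝ) * a)
  have h2 := Int.lt_floor_add_one ((N : ℝ) * a)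
  have : (⌊(N : ℝ) * a⌋ : ℝ) / N - a = (⌊(N : ℝ) * a⌋ - N * a) / N := by field_simp
  rw [this, abs_div, abs_of_pos hN']
  gcongr
  rw [abs_le]
  constructor <;> linarith

/-- Taking integer parts costs 1/N; on edges, replacing φ' by the difference quotient costs another
K/n. -/
lemma abs_ringInitial_sub_le (h : IsWaveData φ ψ K) {N : ℕ} (hN : 0 < N) (i : ZMod n ⊕ ZMod n) :
    |ringCoord (ringInitial φ ψ n N) i / N - gridWave φ ψ n 0 i| ≤ 1 / N + K / n := by
  have hn : (0 : ℝ) < n := Nat.cast_pos.2 (NeZero.pos n)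
  rcases i with k | k
  · have := abs_floor_mul_div_sub_le hN (ψ ((k.val : ℝ) / n))
    have h2 : gridWave φ ψ n 0 (Sum.inl k) = ψ ((k.val : ℝ) / n) := by
      simp only [gridWave, Sum.elim_inl, waveVelocity, leftProfile, rightProfile, add_zero, sub_zero]
      ring
    rw [h2]
    exact this.trans (le_add_of_nonneg_right (div_nonneg h.nonneg hn.le))
  · set x := (k.val : ℝ) / n with hx
    have h1 := abs_floor_mul_div_sub_le hN (n * (φ (x + 1 / n) - φ x))
    have h2 : gridWave φ ψ n 0 (Sum.inr k) = deriv φ x := by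
      simp only [gridWave, Sum.elim_inr, waveStrain, leftProfile, rightProfile, add_zero, sub_zero]
      ring
    have h3 := abs_mul_diff_sub_le (n := n) h.initial_bound x 1 (NeZero.pos n) (Or.inl rfl)
    rw [one_mul] at h3
    have h4 : ringCoord (ringInitial φ ψ n N) (Sum.inr k) =
        (⌊(N : ℝ) * (n * (φ (x + 1 / n) - φ x))⌋ : ℝ) := by
      simp only [ringCoord, ringInitial, Sum.elim_inr, hx, ← add_div, mul_assoc]
    rw [h2, h4]
    exact (abs_sub_le _ _ _).trans (add_le_add h1 h3)

end IsWaveData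

section MeanError

variable {φ ψ : ℝ → ℝ} {K : ℝ} {n : ℕ} [NeZero n] {N : ℕ} {Ω : Type*} [MeasurableSpace Ω]
  {P : Measure Ω} [IsProbabilityMeasure P] {X : ℝ → Ω → State (ZMod n) (ZMod n)}

/-- Stability of the scheme: the error solves the same skew system with the residual as source. The
term with the factor n drops out of the derivative of its energy, and 2eρ ≤ e² + ρ² leaves Gronwall
with rate 1. -/
lemma sum_mean_error_le (h : IsWaveData φ ψ K) (hN : 0 < N)
    (hX : SolvesDynkin (ringRate n) (ringTransition n) (ringInitial φ ψ n N) P X) {t : ℝ}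
    (ht : 0 ≤ t) :
    ∑ i, (coordMean ringCoord P X t i / N - gridWave φ ψ n t i) ^ 2 ≤
      (2 * n * (1 / N + K / n) ^ 2 + 8 * K ^ 2 / n * t) * Real.exp t := by
  have hn : (0 : ℝ) < n := Nat.cast_pos.2 (NeZero.pos n)
  have hJ := ring_isSkewJumpSystem n
  set e : ℝ → ZMod n ⊕ ZMod n → ℝ := fun t i =>
    coordMean ringCoord P X t i / N - gridWave φ ψ n t i with he
  set ρ : ℝ → ZMod n ⊕ ZMod n → ℝ := fun t i =>
    n * ∑ k, gridWave φ ψ n t k * ringJump n k i - gridWaveDeriv φ ψ n t i with hρ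
  have hd : ∀ t, 0 ≤ t → ∀ i, HasDerivWithinAt (fun t => e t i)
      (n * ∑ k, e t k * ringJump n k i + ρ t i) (Ici 0) t := by
    intro t ht i
    refine (((hJ.hasDerivWithinAt_mean hX ht i).div_const (N : ℝ)).sub
      (h.hasDerivAt_gridWave t i).hasDerivWithinAt).congr_deriv ?_
    simp only [he, hρ, sub_mul, Finset.sum_sub_distrib, div_mul_eq_mul_div, ← Finset.sum_div]
    ring
  have hy : ∀ t, 0 ≤ t → HasDerivWithinAt (fun t => ∑ i, e t i ^ 2) (∑ i, 2 * e t i * ρ t i)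
      (Ici 0) t := by
    intro t ht
    refine (HasDerivWithinAt.fun_sum fun i _ => (hd t ht i).fun_pow 2).congr_deriv ?_
    have h0 : ∑ i, ∑ k, e t i * e t k * ringJump n k i = 0 :=
      sum_sum_eq_zero_of_antisymm fun i k => by rw [ringJump_antisymm k i]; ring
    calc _ = 2 * n * ∑ i, ∑ k, e t i * e t k * ringJump n k i + ∑ i, 2 * e t i * ρ t i := by
          rw [Finset.mul_sum, ← Finset.sum_add_distrib]
          refine Finset.sum_congr rfl fun i _ => ?_
          simp only [mul_assoc, ← Finset.mul_sum]
          simp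
          ring
      _ = _ := by rw [h0]; ring
  have hρ2 : ∀ t i, ρ t i ^ 2 ≤ (2 * K / n) ^ 2 := fun t i =>
    sq_le_sq' (abs_le.1 (h.abs_residual_le t i)).1 (abs_le.1 (h.abs_residual_le t i)).2
  have hgr := le_exp_mul_of_deriv_le (a := 1) (b := 8 * K ^ 2 / n) zero_le_one (by positivity) hy
    (T := t) (fun s _ _ => by
      calc ∑ i, 2 * e s i * ρ s i ≤ ∑ i, (e s i ^ 2 + ρ s i ^ 2) :=
            Finset.sum_le_sum fun i _ => two_mul_le_add_sq _ _
        _ ≤ ∑ i, (e s i ^ 2 + (2 * K / n) ^ 2) :=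
            Finset.sum_le_sum fun i _ => add_le_add le_rfl (hρ2 s i)
        _ = 1 * ∑ i, e s i ^ 2 + 8 * K ^ 2 / n := by
            rw [Finset.sum_add_distrib, Finset.sum_const, Finset.card_univ, card_ring_sum,
              nsmul_eq_mul]
            push_cast
            field_simp
            ring) ht
  have h0 : ∑ i, e 0 i ^ 2 ≤ 2 * n * (1 / N + K / n) ^ 2 := by
    calc ∑ i, e 0 i ^ 2 ≤ ∑ _i : ZMod n ⊕ ZMod n, (1 / (N : ℝ) + K / n) ^ 2 := by
          refine Finset.sum_le_sum fun i _ => ?_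
          have := h.abs_ringInitial_sub_le (n := n) hN i
          simp only [he, hJ.mean_zero hX]
          exact sq_le_sq' (abs_le.1 this).1 (abs_le.1 this).2
      _ = _ := by
          rw [Finset.sum_const, Finset.card_univ, card_ring_sum, nsmul_eq_mul]
          push_cast
          ring
  rw [one_mul] at hgr
  exact hgr.trans (mul_le_mul_of_nonneg_right (by linarith) (Real.exp_pos t).le)

lemma sum_ringInitial_sq_le (h : IsWaveData φ ψ K) (hN : 0 < N) :
    ∑ i, ringCoord (ringInitial φ ψ n N) i ^ 2 ≤ 2 * n * (N : ℝ) ^ 2 * (1 + 3 * K) ^ 2 := by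
  have hN' : (1 : ℝ) ≤ N := by exact_mod_cast hN
  have hn : (1 : ℝ) ≤ n := by exact_mod_cast NeZero.pos n
  have h1 : ∀ i : ZMod n ⊕ ZMod n, ringCoord (ringInitial φ ψ n N) i ^ 2 ≤
      (N : ℝ) ^ 2 * (1 + 3 * K) ^ 2 := by
    intro i
    have h2 := h.abs_ringInitial_sub_le (n := n) hN i
    have h3 : |gridWave φ ψ n 0 i| ≤ 2 * K := by
      rcases i with k | k
      · exact h.abs_velocity_le _ _
      · exact h.abs_strain_le _ _
    have h4 : 1 / (N : ℝ) ≤ 1 := (div_le_one (by linarith)).2 hN'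
    have h5 : K / n ≤ K := div_le_self h.nonneg hn
    have h6 : |ringCoord (ringInitial φ ψ n N) i / N| ≤ 1 + 3 * K := by
      have := abs_sub_abs_le_abs_sub (ringCoord (ringInitial φ ψ n N) i / N) (gridWave φ ψ n 0 i)
      linarith
    have h7 : ringCoord (ringInitial φ ψ n N) i = N * (ringCoord (ringInitial φ ψ n N) i / N) := by
      field_simp
    rw [h7, mul_pow]
    refine mul_le_mul_of_nonneg_left ?_ (sq_nonneg _)
    exact sq_le_sq' (abs_le.1 h6).1 (abs_le.1 h6).2
  refine (Finset.sum_le_sum fun i _ => h1 i).trans (le_of_eq ?_)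
  rw [Finset.sum_const, Finset.card_univ, card_ring_sum, nsmul_eq_mul]
  push_cast
  ring

/-- The expected energy of the particle system at the scale of the initial energy. -/
lemma sum_ring_moment_le (h : IsWaveData φ ψ K) (hN : 0 < N)
    (hX : SolvesDynkin (ringRate n) (ringTransition n) (ringInitial φ ψ n N) P X) {t : ℝ}
    (ht : 0 ≤ t) :
    ∑ i, coordMoment ringCoord P X t i i ≤
      n * (N : ℝ) ^ 2 * ((2 * (1 + 3 * K) ^ 2 + 2 * (n / N) * t) * Real.exp (n / N * t)) := by
  have hN' : (0 : ℝ) < N := Nat.cast_pos.2 hN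
  refine ((ring_isSkewJumpSystem n).sum_moment_le hX ht hN').trans ?_
  rw [← mul_assoc]
  refine mul_le_mul_of_nonneg_right ?_ (Real.exp_pos _).le
  have := sum_ringInitial_sq_le (n := n) h hN
  rw [card_ring_sum]
  push_cast
  have h2 : (n : ℝ) * N ^ 2 * (2 * (1 + 3 * K) ^ 2 + 2 * (n / N) * t) =
    2 * n * N ^ 2 * (1 + 3 * K) ^ 2 + n * N * (2 * n) * t := by field_simp
  rw [h2]
  linarith

end MeanError

/-! ### Step functions on the ring and mean square errors -/

/-- Discriminant of the nonnegative quadratic polynomial l ↦ ∫ (f - l g)². -/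
lemma sq_integral_mul_le {α : Type*} [MeasurableSpace α] {μ : Measure α} {f g : α → ℝ}
    (hf : MemLp f 2 μ) (hg : MemLp g 2 μ) :
    (∫ x, f x * g x ∂μ) ^ 2 ≤ (∫ x, f x ^ 2 ∂μ) * ∫ x, g x ^ 2 ∂μ := by
  have hfg : Integrable (fun x => f x * g x) μ := hf.integrable_mul hg
  have h : ∀ l : ℝ, 0 ≤ (∫ x, g x ^ 2 ∂μ) * (l * l) + (-2 * ∫ x, f x * g x ∂μ) * l +
      ∫ x, f x ^ 2 ∂μ := by
    intro l
    have h0 : 0 ≤ ∫ x, (f x - l * g x) ^ 2 ∂μ := integral_nonneg fun x => sq_nonneg _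
    have h1 : ∫ x, (f x - l * g x) ^ 2 ∂μ =
        ∫ x, (f x ^ 2 + (-2 * l) * (f x * g x) + l * l * g x ^ 2) ∂μ :=
      integral_congr_ae (ae_of_all _ fun x => by ring)
    have h2 : Integrable (fun x => f x ^ 2 + (-2 * l) * (f x * g x)) μ :=
      hf.integrable_sq.add (hfg.const_mul _)
    rw [h1, integral_add h2 (hg.integrable_sq.const_mul _), integral_add hf.integrable_sq (hfg.const_mul _), integral_const_mul,
      integral_const_mul] at h0
    linarith
  have := discrim_le_zero h
  rw [discrim] at this
  nlinarith

lemma sq_lintegral_le {α : Type*} [MeasurableSpace α] {μ : Measure α} {f : α → ℝ≥0∞}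
    (hf : AEMeasurable f μ) : (∫⁻ x, f x ∂μ) ^ 2 ≤ μ univ * ∫⁻ x, f x ^ 2 ∂μ := by
  have h := ENNReal.lintegral_mul_le_Lp_mul_Lq μ Real.HolderConjugate.two_two hf
    (aemeasurable_const (b := (1 : ℝ≥0∞)))
  simp only [Pi.mul_apply, mul_one, ENNReal.one_rpow, lintegral_const, one_mul] at h
  have h2 : ∀ a : ℝ≥0∞, (a ^ (1 / 2 : ℝ)) ^ 2 = a := fun a => by
    rw [← ENNReal.rpow_two, ← ENNReal.rpow_mul]; norm_num
  calc (∫⁻ x, f x ∂μ) ^ 2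
      ≤ ((∫⁻ x, f x ^ (2 : ℝ) ∂μ) ^ (1 / 2 : ℝ) * μ univ ^ (1 / 2 : ℝ)) ^ 2 := by gcongr
    _ = _ := by
      rw [mul_pow, h2, h2, mul_comm]
      simp only [ENNReal.rpow_two]

section Cells

variable (n : ℕ) [NeZero n]

/-- The site of the ring that represents the point `x` of the circle. -/
noncomputable def site (x : ℝ) : ZMod n := (⌊(n : ℝ) * x⌋ : ZMod n)

/-- The points of `[0, 1)` represented by the site `k`. -/
def siteCell (k : ZMod n) : Set ℝ := Ico 0 1 ∩ {x | site n x = k}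

variable {n}

/-- On [0, 1) the integer ⌊nx⌋ lies in {0, …, n - 1}, so it is recovered from its residue class. -/
lemma siteCell_eq (k : ZMod n) :
    siteCell n k = Ico ((k.val : ℝ) / n) (((k.val : ℝ) + 1) / n) := by
  have hn : (0 : ℝ) < n := Nat.cast_pos.2 (NeZero.pos n)
  have hk : (k.val : ℝ) + 1 ≤ n := by exact_mod_cast ZMod.val_lt k
  ext x
  have hfl : x ∈ Ico ((k.val : ℝ) / n) (((k.val : ℝ) + 1) / n) ↔ ⌊(n : ℝ) * x⌋ = (k.val : ℤ) := by
    rw [Int.floor_eq_iff, mem_Ico, div_le_iff₀ hn, lt_div_iff₀ hn, mul_comm x]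
    simp
  rw [hfl]
  constructor
  · rintro ⟨hx, hs⟩
    have h0 : 0 ≤ ⌊(n : ℝ) * x⌋ := Int.floor_nonneg.2 (mul_nonneg hn.le hx.1)
    have h1 : ⌊(n : ℝ) * x⌋ < n := by
      rw [Int.floor_lt]
      push_cast
      nlinarith [hx.2]
    have hs : ((⌊(n : ℝ) * x⌋ : ℤ) : ZMod n) = k := hs
    rw [← hs, ZMod.val_intCast, Int.emod_eq_of_lt h0 h1]
  · intro h
    have hx := hfl.2 h
    refine ⟨⟨(div_nonneg (Nat.cast_nonneg _) hn.le).trans hx.1, hx.2.trans_le ?_⟩, ?_⟩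
    · rwa [div_le_one hn]
    · change ((⌊(n : ℝ) * x⌋ : ℤ) : ZMod n) = k
      rw [h]
      simp

lemma measurableSet_siteCell (k : ZMod n) : MeasurableSet (siteCell n k) := by
  rw [siteCell_eq]; exact measurableSet_Ico

lemma iUnion_siteCell : ⋃ k, siteCell n k = Ico (0 : ℝ) 1 := by
  ext x
  simp [siteCell]

lemma pairwise_disjoint_siteCell : Pairwise (Function.onFun Disjoint (siteCell n)) := by
  intro k l hkl
  refine Set.disjoint_left.2 fun x hx hy => hkl ?_
  rw [← show site n x = k from hx.2, ← show site n x = l from hy.2]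

lemma volume_real_siteCell (k : ZMod n) : volume.real (siteCell n k) = 1 / n := by
  have hn : (0 : ℝ) < n := Nat.cast_pos.2 (NeZero.pos n)
  rw [siteCell_eq, Real.volume_real_Ico_of_le (by gcongr; linarith)]
  ring

lemma volume_siteCell_ne_top (k : ZMod n) : volume (siteCell n k) ≠ ∞ := by
  rw [siteCell_eq]; simp

lemma abs_val_div_sub_le {k : ZMod n} {x : ℝ} (hx : x ∈ siteCell n k) :
    |(k.val : ℝ) / n - x| ≤ 1 / n := by
  rw [siteCell_eq, add_div] at hx
  rw [abs_le]
  have hn : (0 : ℝ) < n := Nat.cast_pos.2 (NeZero.pos n)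
  have : 0 < 1 / (n : ℝ) := by positivity
  constructor <;> linarith [hx.1, hx.2]

lemma setIntegral_eq_sum_siteCell {f : ℝ → ℝ} (hf : IntegrableOn f (Ico 0 1)) :
    ∫ x in Ico (0 : ℝ) 1, f x = ∑ k, ∫ x in siteCell n k, f x := by
  rw [← iUnion_siteCell (n := n)]
  exact integral_iUnion_fintype measurableSet_siteCell pairwise_disjoint_siteCell
    fun k => hf.mono_set fun x hx => hx.1

lemma measurable_site_comp {α : Type*} [MeasurableSpace α] {β : Type*} [MeasurableSpace β]
    {f : ZMod n → α → β} (hf : ∀ k, Measurable (f k)) :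
    Measurable (fun p : ℝ × α => f (site n p.1) p.2) := by
  have h1 : Measurable (fun q : ℤ × α => f (q.1 : ZMod n) q.2) :=
    measurable_from_prod_countable_right fun z => hf (z : ZMod n)
  exact h1.comp (((measurable_fst.const_mul _).floor).prodMk measurable_snd)

lemma measurable_comp_site (f : ZMod n → ℝ) : Measurable (fun x => f (site n x)) :=
  (Measurable.of_discrete (f := fun z : ℤ => f (z : ZMod n))).comp
    (measurable_id.const_mul _).floor

lemma abs_comp_site_le (f : ZMod n → ℝ) (x : ℝ) : |f (site n x)| ≤ ∑ k, |f k| :=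
  Finset.single_le_sum (f := fun k => |f k|) (fun _ _ => abs_nonneg _) (Finset.mem_univ _)

lemma integrableOn_of_bounded_Ico {f : ℝ → ℝ} (hf : Measurable f) {M : ℝ} (hM : ∀ x, |f x| ≤ M) :
    IntegrableOn f (Ico 0 1) :=
  Integrable.of_bound hf.aestronglyMeasurable M (ae_of_all _ hM)

lemma setIntegral_comp_site (f : ZMod n → ℝ) :
    ∫ x in Ico (0 : ℝ) 1, f (site n x) = (∑ k, f k) / n := by
  rw [setIntegral_eq_sum_siteCell (n := n)
    (integrableOn_of_bounded_Ico (measurable_comp_site f) (abs_comp_site_le f)), Finset.sum_div]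
  refine Finset.sum_congr rfl fun k _ => ?_
  rw [setIntegral_congr_fun (measurableSet_siteCell k)
    (g := fun _ => f k) fun x hx => by simp only [show site n x = k from hx.2]]
  rw [setIntegral_const, volume_real_siteCell, smul_eq_mul]
  ring

lemma enorm_sq_eq_ofReal (a : ℝ) : ‖a‖ₑ ^ 2 = ENNReal.ofReal (a ^ 2) := by
  rw [Real.enorm_eq_ofReal_abs, ← ENNReal.ofReal_pow (abs_nonneg a), sq_abs]

lemma normSqH_eq (g : ℝ → ℝ) : normSqH g = ∫⁻ x in Ico (0 : ℝ) 1, ENNReal.ofReal (g x ^ 2) := by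
  simp only [normSqH, enorm_sq_eq_ofReal]

lemma integral_sub_sq {Ω : Type*} [MeasurableSpace Ω] {P : Measure Ω} [IsProbabilityMeasure P]
    {Y : Ω → ℝ} (h1 : Integrable Y P) (h2 : Integrable (fun ω => Y ω ^ 2) P) (a : ℝ) :
    Integrable (fun ω => (Y ω - a) ^ 2) P ∧ ∫ ω, (Y ω - a) ^ 2 ∂P =
      (∫ ω, Y ω ^ 2 ∂P - (∫ ω, Y ω ∂P) ^ 2) + (∫ ω, Y ω ∂P - a) ^ 2 := by
  have h : (fun ω => (Y ω - a) ^ 2) = fun ω => Y ω ^ 2 + (-2 * a) * Y ω + a ^ 2 := by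
    funext ω; ring
  have h3 : Integrable (fun ω => Y ω ^ 2 + (-2 * a) * Y ω) P := h2.add (h1.const_mul (-2 * a))
  refine ⟨by rw [h]; exact h3.add (integrable_const _), ?_⟩
  rw [h, integral_add h3 (integrable_const _), integral_add h2 (h1.const_mul _),
    integral_const_mul]
  simp
  ring

/-- The bias-variance decomposition of the mean square distance of a random step function from a
deterministic function. -/
lemma lintegral_normSqH_eq {Ω : Type*} [MeasurableSpace Ω] {P : Measure Ω}
    [IsProbabilityMeasure P] {Y : ZMod n → Ω → ℝ} (hm : ∀ k, Measurable (Y k))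
    (h1 : ∀ k, Integrable (Y k) P) (h2 : ∀ k, Integrable (fun ω => Y k ω ^ 2) P) {g : ℝ → ℝ}
    (hg : Measurable g) {M : ℝ} (hM : ∀ x, |g x| ≤ M) :
    ∫⁻ ω, normSqH (fun x => Y (site n x) ω - g x) ∂P =
      ENNReal.ofReal ((∑ k, (∫ ω, Y k ω ^ 2 ∂P - (∫ ω, Y k ω ∂P) ^ 2)) / n +
        ∫ x in Ico (0 : ℝ) 1, (∫ ω, Y (site n x) ω ∂P - g x) ^ 2) := by
  simp only [normSqH_eq]
  have hmeas : Measurable (fun p : ℝ × Ω => ENNReal.ofReal ((Y (site n p.1) p.2 - g p.1) ^ 2)) :=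
    (((measurable_site_comp hm).sub (hg.comp measurable_fst)).pow_const 2).ennreal_ofReal
  -- By Tonelli the expectation is taken at each fixed point x, where the bias–variance identity is
  -- scalar.
  rw [lintegral_lintegral_swap
    (f := fun ω x => ENNReal.ofReal ((Y (site n x) ω - g x) ^ 2))
    ((hmeas.comp measurable_swap).aemeasurable)]
  have hin : ∀ x, ∫⁻ ω, ENNReal.ofReal ((Y (site n x) ω - g x) ^ 2) ∂P =
      ENNReal.ofReal ((∫ ω, Y (site n x) ω ^ 2 ∂P - (∫ ω, Y (site n x) ω ∂P) ^ 2) +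
        (∫ ω, Y (site n x) ω ∂P - g x) ^ 2) := fun x => by
    have := integral_sub_sq (h1 (site n x)) (h2 _) (g x)
    rw [← this.2, ofReal_integral_eq_lintegral_ofReal this.1 (ae_of_all _ fun ω => sq_nonneg _)]
  simp only [hin]
  have hV := measurable_comp_site (n := n) fun k => ∫ ω, Y k ω ^ 2 ∂P - (∫ ω, Y k ω ∂P) ^ 2
  have hE := measurable_comp_site (n := n) fun k => ∫ ω, Y k ω ∂P
  have hI1 := integrableOn_of_bounded_Ico hV 
    (abs_comp_site_le fun k => ∫ ω, Y k ω ^ 2 ∂P - (∫ ω, Y k ω ∂P) ^ 2)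
  have hI2 : IntegrableOn (fun x => (∫ ω, Y (site n x) ω ∂P - g x) ^ 2) (Ico 0 1) := by
    refine integrableOn_of_bounded_Ico ((hE.sub hg).pow_const 2)
      (M := (∑ k, |∫ ω, Y k ω ∂P| + M) ^ 2) fun x => ?_
    rw [abs_pow]
    refine pow_le_pow_left₀ (abs_nonneg _) ((abs_sub _ _).trans (add_le_add ?_ (hM x))) 2
    exact abs_comp_site_le (fun k => ∫ ω, Y k ω ∂P) x
  have hnn : ∀ x, 0 ≤ (∫ ω, Y (site n x) ω ^ 2 ∂P - (∫ ω, Y (site n x) ω ∂P) ^ 2) +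
        (∫ ω, Y (site n x) ω ∂P - g x) ^ 2 := fun x => by
    rw [← (integral_sub_sq (h1 (site n x)) (h2 _) (g x)).2]
    exact integral_nonneg fun ω => sq_nonneg _
  refine (ofReal_integral_eq_lintegral_ofReal (hI1.add hI2) (ae_of_all _ hnn)).symm.trans ?_
  congr 1
  rw [← setIntegral_comp_site]
  exact integral_add hI1 hI2

end Cells

section MeanSquare

variable {φ ψ : ℝ → ℝ} {K : ℝ} {n : ℕ} [NeZero n] {N : ℕ} {Ω : Type*} [MeasurableSpace Ω]
  {P : Measure Ω} [IsProbabilityMeasure P] {X : ℝ → Ω → State (ZMod n) (ZMod n)}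
  {x₀ : State (ZMod n) (ZMod n)}

lemma coordCov_self (t : ℝ) (i : ZMod n ⊕ ZMod n) :
    coordCov ringCoord P X t i i =
      ∫ ω, ringCoord (X t ω) i ^ 2 ∂P - (∫ ω, ringCoord (X t ω) i ∂P) ^ 2 := by
  simp only [coordCov, coordMoment, coordMean, sq]

lemma SolvesDynkin.lintegral_normSqH_ring
    (hX : SolvesDynkin (ringRate n) (ringTransition n) x₀ P X) {t : ℝ} (ht : 0 ≤ t)
    (ι : ZMod n → ZMod n ⊕ ZMod n) {g : ℝ → ℝ} (hg : Measurable g) {M : ℝ}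
    (hM : ∀ x, |g x| ≤ M) :
    ∫⁻ ω, normSqH (fun x => ringCoord (X t ω) (ι (site n x)) / N - g x) ∂P =
      ENNReal.ofReal ((∑ k, coordCov ringCoord P X t (ι k) (ι k)) / (n * N ^ 2) +
        ∫ x in Ico (0 : ℝ) 1, (coordMean ringCoord P X t (ι (site n x)) / N - g x) ^ 2) := by
  have hJ := ring_isSkewJumpSystem n
  have h1 : ∀ k, Integrable (fun ω => ringCoord (X t ω) (ι k) / (N : ℝ)) P := fun k =>
    (hJ.integrable_coord hX ht _).div_const _
  have h2 : ∀ k, Integrable (fun ω => (ringCoord (X t ω) (ι k) / (N : ℝ)) ^ 2) P := fun k => by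
    have := (hJ.integrable_mul hX ht (ι k) (ι k)).div_const ((N : ℝ) ^ 2)
    refine this.congr (ae_of_all _ fun ω => ?_)
    change ringCoord (X t ω) (ι k) * ringCoord (X t ω) (ι k) / (N : ℝ) ^ 2 =
      (ringCoord (X t ω) (ι k) / (N : ℝ)) ^ 2
    rw [div_pow, sq (ringCoord (X t ω) (ι k))]
  have hm : ∀ k, Measurable (fun ω => ringCoord (X t ω) (ι k) / (N : ℝ)) := fun k =>
    (hX.measurable_apply (fun x => ringCoord x (ι k)) t).div_const _
  rw [lintegral_normSqH_eq hm h1 h2 hg hM]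
  congr 2
  · rw [mul_comm (n : ℝ), ← div_div]
    congr 1
    rw [Finset.sum_div]
    refine Finset.sum_congr rfl fun k _ => ?_
    rw [coordCov_self]
    simp only [div_pow, integral_div, sub_div]
  · simp only [integral_div]
    rfl

/-- The total variance of the rescaled particle system. -/
noncomputable def totalVariance (n N : ℕ) [NeZero n] (P : Measure Ω)
    (X : ℝ → Ω → State (ZMod n) (ZMod n)) (t : ℝ) : ℝ :=
  (∑ i, coordCov ringCoord P X t i i) / (n * N ^ 2)

/-- The squared distance of the mean of the rescaled particle system from the d'Alembert
solution. -/
noncomputable def meanBias (φ ψ : ℝ → ℝ) (n N : ℕ) [NeZero n] (P : Measure Ω)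
    (X : ℝ → Ω → State (ZMod n) (ZMod n)) (t : ℝ) : ℝ :=
  (∫ x in Ico (0 : ℝ) 1,
    (coordMean ringCoord P X t (Sum.inl (site n x)) / N - waveVelocity φ ψ x t) ^ 2) +
  ∫ x in Ico (0 : ℝ) 1,
    (coordMean ringCoord P X t (Sum.inr (site n x)) / N - waveStrain φ ψ x t) ^ 2

lemma meanBias_nonneg (t : ℝ) : 0 ≤ meanBias φ ψ n N P X t :=
  add_nonneg (integral_nonneg fun _ => sq_nonneg _) (integral_nonneg fun _ => sq_nonneg _)

lemma IsSkewJumpSystem.cov_self_nonneg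
    (hX : SolvesDynkin (ringRate n) (ringTransition n) x₀ P X) {t : ℝ} (ht : 0 ≤ t)
    (i : ZMod n ⊕ ZMod n) : 0 ≤ coordCov ringCoord P X t i i := by
  have hJ := ring_isSkewJumpSystem n
  have h2 : Integrable (fun ω => ringCoord (X t ω) i ^ 2) P := by
    simpa only [sq] using hJ.integrable_mul hX ht i i
  have := (integral_sub_sq (hJ.integrable_coord hX ht i) h2
    (∫ ω, ringCoord (X t ω) i ∂P)).2
  rw [sub_self, zero_pow two_ne_zero, add_zero] at this
  rw [coordCov_self, ← this]
  exact integral_nonneg fun _ => sq_nonneg _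

lemma IsWaveData.measurable_velocity (h : IsWaveData φ ψ K) (t : ℝ) :
    Measurable fun x => waveVelocity φ ψ x t :=
  (h.continuous_velocity.comp (by fun_prop : Continuous fun x : ℝ => (x, t))).measurable

lemma IsWaveData.measurable_strain (h : IsWaveData φ ψ K) (t : ℝ) :
    Measurable fun x => waveStrain φ ψ x t :=
  (h.continuous_strain.comp (by fun_prop : Continuous fun x : ℝ => (x, t))).measurable

lemma lintegral_velocity_error (h : IsWaveData φ ψ K)
    (hX : SolvesDynkin (ringRate n) (ringTransition n) x₀ P X) {t : ℝ} (ht : 0 ≤ t) :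
    ∫⁻ ω, normSqH (fun x => velocityField n N (X t ω) x - waveVelocity φ ψ x t) ∂P =
      ENNReal.ofReal ((∑ k, coordCov ringCoord P X t (Sum.inl k) (Sum.inl k)) / (n * N ^ 2) +
        ∫ x in Ico (0 : ℝ) 1,
          (coordMean ringCoord P X t (Sum.inl (site n x)) / N - waveVelocity φ ψ x t) ^ 2) :=
  hX.lintegral_normSqH_ring ht Sum.inl (h.measurable_velocity t) fun x => h.abs_velocity_le x t

/-- The mean square error is the sum of the total variance and of the squared bias. -/
lemma meanSqError_eq {u : ℝ → ℝ → ℝ} (hu : IsClassicalWaveSolution φ ψ u) (h : IsWaveData φ ψ K)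
    {X : ℝ≥0 → Ω → State (ZMod n) (ZMod n)}
    (hX : SolvesDynkin (ringRate n) (ringTransition n) x₀ P fun t ω => X t.toNNReal ω) (t : ℝ≥0) :
    meanSqError u n N P X t =
      ENNReal.ofReal (totalVariance n N P (fun t ω => X t.toNNReal ω) t +
        meanBias φ ψ n N P (fun t ω => X t.toNNReal ω) t) := by
  have ht : (0 : ℝ) ≤ t := t.2
  simp only [meanSqError, hu.timeDeriv_eq_waveVelocity _ ht, hu.spaceDeriv_eq_waveStrain _ ht]
  have e1 := lintegral_velocity_error (N := N) h hX ht
  have e2 : ∫⁻ ω, normSqH (fun x => strainField n N (X (t : ℝ).toNNReal ω) x -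
      waveStrain φ ψ x t) ∂P = _ :=
    hX.lintegral_normSqH_ring (N := N) ht Sum.inr (h.measurable_strain t)
      fun x => h.abs_strain_le x t
  simp only [Real.toNNReal_coe] at e1 e2
  have hpos : ∀ ι : ZMod n → ZMod n ⊕ ZMod n, 0 ≤ (∑ k, coordCov ringCoord P
      (fun t ω => X t.toNNReal ω) t (ι k) (ι k)) / (n * (N : ℝ) ^ 2) := fun ι =>
    div_nonneg (Finset.sum_nonneg fun k _ => IsSkewJumpSystem.cov_self_nonneg hX ht _)
      (by positivity)
  rw [e1, e2, ← ENNReal.ofReal_add (add_nonneg (hpos Sum.inl) (integral_nonneg fun _ => sq_nonneg _))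
    (add_nonneg (hpos Sum.inr) (integral_nonneg fun _ => sq_nonneg _)), totalVariance, meanBias,
    Fintype.sum_sum_type]
  congr 1
  ring

/-- The grid values `z` are inserted between the step function `m` and `g`: the scheme controls m -
z, while z - g is the oscillation of `g` on a cell. -/
lemma setIntegral_sub_sq_le {m : ZMod n → ℝ} {z : ZMod n → ℝ} {g : ℝ → ℝ} (hg : Measurable g)
    {M L : ℝ} (hM : ∀ x, |g x| ≤ M) (hL : ∀ k, ∀ x ∈ siteCell n k, |z k - g x| ≤ L) :
    ∫ x in Ico (0 : ℝ) 1, (m (site n x) - g x) ^ 2 ≤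
      2 * ((∑ k, (m k - z k) ^ 2) / n) + 2 * L ^ 2 := by
  have hI1 : IntegrableOn (fun x => (m (site n x) - g x) ^ 2) (Ico 0 1) := by
    refine integrableOn_of_bounded_Ico (((measurable_comp_site m).sub hg).pow_const 2)
      (M := (∑ k, |m k| + M) ^ 2) fun x => ?_
    rw [abs_pow]
    exact pow_le_pow_left₀ (abs_nonneg _)
      ((abs_sub _ _).trans (add_le_add (abs_comp_site_le m x) (hM x))) 2
  have hI2 := integrableOn_of_bounded_Ico
    (measurable_comp_site (n := n) fun k => (m k - z k) ^ 2)
    (abs_comp_site_le fun k => (m k - z k) ^ 2)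
  have hI3 : IntegrableOn (fun _ : ℝ => 2 * L ^ 2) (Ico 0 1) := integrableOn_const (by simp)
  calc ∫ x in Ico (0 : ℝ) 1, (m (site n x) - g x) ^ 2
      ≤ ∫ x in Ico (0 : ℝ) 1, (2 * (m (site n x) - z (site n x)) ^ 2 + 2 * L ^ 2) := by
        refine setIntegral_mono_on hI1 ((hI2.const_mul 2).add hI3) measurableSet_Ico fun x hx => ?_
        have := hL (site n x) x ⟨hx, rfl⟩
        have h2 : (z (site n x) - g x) ^ 2 ≤ L ^ 2 := sq_le_sq' (abs_le.1 this).1 (abs_le.1 this).2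
        nlinarith [sq_nonneg (m (site n x) - z (site n x) - (z (site n x) - g x))]
    _ = _ := by
        rw [integral_add (hI2.const_mul 2) hI3, integral_const_mul,
          setIntegral_comp_site fun k => (m k - z k) ^ 2]
        simp

/-- A quantitative bound of the bias. -/
lemma meanBias_le (h : IsWaveData φ ψ K) (hN : 0 < N)
    (hX : SolvesDynkin (ringRate n) (ringTransition n) (ringInitial φ ψ n N) P X) {t : ℝ}
    (ht : 0 ≤ t) :
    meanBias φ ψ n N P X t ≤
      2 * ((2 * (1 / N + K / n) ^ 2 + 8 * (K / n) ^ 2 * t) * Real.exp t) + 16 * (K / n) ^ 2 := by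
  have hn : (0 : ℝ) < n := Nat.cast_pos.2 (NeZero.pos n)
  have hL : ∀ (k : ZMod n), ∀ x ∈ siteCell n k, 2 * K * |(k.val : ℝ) / n - x| ≤ 2 * (K / n) :=
    fun k x hx => by
      have := mul_le_mul_of_nonneg_left (abs_val_div_sub_le hx) (mul_nonneg zero_le_two h.nonneg)
      calc _ ≤ _ := this
        _ = _ := by ring
  have h1 := setIntegral_sub_sq_le (n := n) (m := fun k => coordMean ringCoord P X t (Sum.inl k) / N)
    (z := fun k => gridWave φ ψ n t (Sum.inl k)) (h.measurable_velocity t) (L := 2 * (K / n))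
    (fun x => h.abs_velocity_le x t)
    fun k x hx => (h.abs_velocity_sub_le _ x t).trans (hL k x hx)
  have h2 := setIntegral_sub_sq_le (n := n) (m := fun k => coordMean ringCoord P X t (Sum.inr k) / N)
    (z := fun k => gridWave φ ψ n t (Sum.inr k)) (h.measurable_strain t) (L := 2 * (K / n))
    (fun x => h.abs_strain_le x t)
    fun k x hx => (h.abs_strain_sub_le _ x t).trans (hL k x hx)
  have h3 := sum_mean_error_le h hN hX ht
  rw [Fintype.sum_sum_type] at h3
  have h4 : (2 * n * (1 / N + K / n) ^ 2 + 8 * K ^ 2 / n * t) * Real.exp t =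
      n * ((2 * (1 / N + K / n) ^ 2 + 8 * (K / n) ^ 2 * t) * Real.exp t) := by
    field_simp
  rw [h4, ← div_le_iff₀' hn, add_div] at h3
  rw [meanBias]
  linarith

end MeanSquare

/-! ### The displacement field -/

section Displacement

variable {φ ψ : ℝ → ℝ} {K : ℝ} {n : ℕ} [NeZero n] {N : ℕ} {Ω : Type*} [MeasurableSpace Ω]
  {P : Measure Ω} [IsProbabilityMeasure P] {X : ℝ → Ω → State (ZMod n) (ZMod n)}
  {x₀ : State (ZMod n) (ZMod n)}

/-- The difference of the velocity field and of the velocity of the d'Alembert solution. -/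
noncomputable def velocityError (φ ψ : ℝ → ℝ) (n N : ℕ) (X : ℝ → Ω → State (ZMod n) (ZMod n))
    (s : ℝ) (ω : Ω) (x : ℝ) : ℝ :=
  velocityField n N (X s ω) x - waveVelocity φ ψ x s

lemma measurable_velocityError (h : IsWaveData φ ψ K)
    (hX : SolvesDynkin (ringRate n) (ringTransition n) x₀ P X) :
    Measurable (fun p : ℝ × ℝ × Ω => velocityError φ ψ n N X p.2.1 p.2.2 p.1) := by
  have h1 : Measurable (fun p : ℝ × ℝ × Ω =>
      ringCoord (X p.2.1 p.2.2) (Sum.inl (site n p.1)) / (N : ℝ)) :=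
    measurable_site_comp (f := fun k (q : ℝ × Ω) => ringCoord (X q.1 q.2) (Sum.inl k) / (N : ℝ))
      fun k => (hX.measurable_comp fun x => ringCoord x (Sum.inl k)).div_const _
  have h2 : Measurable (fun p : ℝ × ℝ × Ω => waveVelocity φ ψ p.1 p.2.1) :=
    h.continuous_velocity.measurable.comp (measurable_fst.prodMk (measurable_fst.comp measurable_snd))
  exact h1.sub h2

lemma measurable_velocityError_time (h : IsWaveData φ ψ K)
    (hX : SolvesDynkin (ringRate n) (ringTransition n) x₀ P X) (ω : Ω) (x : ℝ) :
    Measurable (fun s => velocityError φ ψ n N X s ω x) := by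
  have h1 : Measurable (fun s : ℝ => (x, s, ω)) :=
    measurable_const.prodMk (measurable_id.prodMk measurable_const)
  exact (measurable_velocityError (N := N) h hX).comp h1

lemma measurable_velocityError_path (h : IsWaveData φ ψ K)
    (hX : SolvesDynkin (ringRate n) (ringTransition n) x₀ P X) (ω : Ω) :
    Measurable (fun p : ℝ × ℝ => velocityError φ ψ n N X p.2 ω p.1) := by
  have h1 : Measurable (fun p : ℝ × ℝ => (p.1, p.2, ω)) :=
    measurable_fst.prodMk (measurable_snd.prodMk measurable_const)
  exact (measurable_velocityError (N := N) h hX).comp h1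

lemma measurable_velocityError_prod (h : IsWaveData φ ψ K)
    (hX : SolvesDynkin (ringRate n) (ringTransition n) x₀ P X) :
    Measurable (fun q : (Ω × ℝ) × ℝ => velocityError φ ψ n N X q.1.2 q.1.1 q.2) := by
  have h1 : Measurable (fun q : (Ω × ℝ) × ℝ => (q.2, q.1.2, q.1.1)) :=
    measurable_snd.prodMk
      ((measurable_snd.comp measurable_fst).prodMk (measurable_fst.comp measurable_fst))
  exact (measurable_velocityError (N := N) h hX).comp h1

/-- Tonelli and the bound of the first absolute moments. Integrability of the paths is what allows
the Bochner integrals in the displacement to be split and interchanged. -/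
lemma ae_integrableOn_coord (hX : SolvesDynkin (ringRate n) (ringTransition n) x₀ P X) (T : ℝ) :
    ∀ᵐ ω ∂P, ∀ i, IntegrableOn (fun s => ringCoord (X s ω) i) (Ioc 0 T) := by
  rw [ae_all_iff]
  intro i
  have hJ := ring_isSkewJumpSystem n
  obtain ⟨M, hM⟩ := hX.exists_abs_expectation_le hJ.isLyapunov
    (IsSkewJumpSystem.polyGrowth_abs_coord ringCoord i) T
  have hmeas : Measurable (fun p : ℝ × Ω => ‖ringCoord (X p.1 p.2) i‖ₑ) :=
    (hX.measurable_comp fun x => ringCoord x i).enorm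
  have hfin : ∫⁻ ω, (∫⁻ s in Ioc 0 T, ‖ringCoord (X s ω) i‖ₑ) ∂P < ∞ := by
    rw [lintegral_lintegral_swap (f := fun ω s => ‖ringCoord (X s ω) i‖ₑ)
      (hmeas.comp measurable_swap).aemeasurable]
    calc ∫⁻ s in Ioc 0 T, ∫⁻ ω, ‖ringCoord (X s ω) i‖ₑ ∂P
        ≤ ∫⁻ _s in Ioc 0 T, ENNReal.ofReal M := by
          refine setLIntegral_mono measurable_const fun s hs => ?_
          rw [← ofReal_integral_norm_eq_lintegral_enorm (hJ.integrable_coord hX hs.1.le i)]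
          exact ENNReal.ofReal_le_ofReal ((le_abs_self _).trans (hM s ⟨hs.1.le, hs.2⟩))
      _ < ∞ := by simp [ENNReal.mul_lt_top]
  have hm2 : Measurable fun ω => ∫⁻ s in Ioc 0 T, ‖ringCoord (X s ω) i‖ₑ :=
    hmeas.lintegral_prod_left'
  filter_upwards [ae_lt_top hm2 hfin.ne] with ω hω
  refine ⟨?_, hω⟩
  exact ((hX.measurable_comp fun x => ringCoord x i).comp measurable_prodMk_right).aestronglyMeasurable

lemma displacement_sub_eq {u : ℝ → ℝ → ℝ} (hu : IsClassicalWaveSolution φ ψ u)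
    (h : IsWaveData φ ψ K) {X : ℝ≥0 → Ω → State (ZMod n) (ZMod n)} {T : ℝ≥0} {ω : Ω}
    (hω : ∀ i, IntegrableOn (fun s : ℝ => ringCoord (X s.toNNReal ω) i) (Ioc 0 T)) {t : ℝ≥0}
    (ht : t ≤ T) (x : ℝ) :
    displacementField φ n N (fun s => X s ω) x t - u x t =
      ∫ s in Ioc (0 : ℝ) t, velocityError φ ψ n N (fun s ω => X s.toNNReal ω) s ω x := by
  have hc : ∀ x, Continuous fun t => waveVelocity φ ψ x t := fun x =>
    h.continuous_velocity.comp (by fun_prop : Continuous fun t : ℝ => (x, t))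
  have h1 : IntegrableOn (fun s : ℝ => velocityField n N (X s.toNNReal ω) x) (Ioc 0 t) :=
    ((hω (Sum.inl (site n x))).mono_set (Ioc_subset_Ioc_right (by exact_mod_cast ht))).div_const _
  have h2 : IntegrableOn (fun s : ℝ => waveVelocity φ ψ x s) (Ioc 0 t) :=
    ((hc x).integrableOn_Icc).mono_set Ioc_subset_Icc_self
  rw [hu.eq_add_integral hc x t.coe_nonneg, displacementField,
    intervalIntegral.integral_of_le t.coe_nonneg, intervalIntegral.integral_of_le t.coe_nonneg]
  simp only [velocityError]
  rw [integral_sub h1 h2]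
  ring

/-- Cauchy–Schwarz in time. The right-hand side does not depend on `t`, so a supremum over t ≤ T
costs nothing and no maximal inequality is needed. -/
lemma enorm_sq_setIntegral_le {f : ℝ → ℝ} (hf : Measurable f) {t T : ℝ≥0} (ht : t ≤ T) :
    ‖∫ s in Ioc (0 : ℝ) t, f s‖ₑ ^ 2 ≤ T * ∫⁻ s in Ioc (0 : ℝ) T, ‖f s‖ₑ ^ 2 := by
  calc ‖∫ s in Ioc (0 : ℝ) t, f s‖ₑ ^ 2 ≤ (∫⁻ s in Ioc (0 : ℝ) t, ‖f s‖ₑ) ^ 2 := by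
        gcongr; exact enorm_integral_le_lintegral_enorm _
    _ ≤ volume.restrict (Ioc (0 : ℝ) t) univ * ∫⁻ s in Ioc (0 : ℝ) t, ‖f s‖ₑ ^ 2 :=
        sq_lintegral_le hf.enorm.aemeasurable
    _ = t * ∫⁻ s in Ioc (0 : ℝ) t, ‖f s‖ₑ ^ 2 := by simp
    _ ≤ T * ∫⁻ s in Ioc (0 : ℝ) T, ‖f s‖ₑ ^ 2 := by
        gcongr

lemma setLIntegral_Ioc_le {f : ℝ → ℝ≥0∞} {T : ℝ≥0} {B : ℝ≥0∞}
    (hB : ∀ s : ℝ≥0, s ≤ T → f s ≤ B) : ∫⁻ s in Ioc (0 : ℝ) T, f s ≤ B * T := by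
  calc ∫⁻ s in Ioc (0 : ℝ) T, f s ≤ ∫⁻ _s in Ioc (0 : ℝ) T, B :=
        setLIntegral_mono measurable_const fun s hs =>
          hB ⟨s, hs.1.le⟩ (by exact_mod_cast hs.2)
    _ = _ := by simp

/-- The displacement is close to the solution in `H` if the velocity is. -/
lemma lintegral_iSup_normSqH_le {u : ℝ → ℝ → ℝ} (hu : IsClassicalWaveSolution φ ψ u)
    (h : IsWaveData φ ψ K) {X : ℝ≥0 → Ω → State (ZMod n) (ZMod n)}
    (hX : SolvesDynkin (ringRate n) (ringTransition n) x₀ P fun t ω => X t.toNNReal ω) {T : ℝ≥0}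
    {B : ℝ≥0∞} (hB : ∀ s : ℝ≥0, s ≤ T →
      ∫⁻ ω, normSqH (velocityError φ ψ n N (fun t ω => X t.toNNReal ω) s ω) ∂P ≤ B) :
    ∫⁻ ω, ⨆ t ∈ Icc 0 T,
      normSqH (fun x => displacementField φ n N (fun s => X s ω) x t - u x t) ∂P ≤
        T * (B * T) := by
  set E := velocityError φ ψ n N (fun t ω => X t.toNNReal ω) with hE
  have hm : Measurable (fun q : (Ω × ℝ) × ℝ => E q.1.2 q.1.1 q.2) :=
    measurable_velocityError_prod h hX
  -- The pathwise bound dominates the uncountable supremum by a measurable function; monotonicity of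
  -- the lower integral needs no measurability of the supremum itself.
  have hsup : ∀ᵐ ω ∂P, ⨆ t ∈ Icc 0 T,
      normSqH (fun x => displacementField φ n N (fun s => X s ω) x t - u x t) ≤
        T * ∫⁻ s in Ioc (0 : ℝ) T, normSqH (E s ω) := by
    filter_upwards [ae_integrableOn_coord hX T] with ω hω
    refine iSup₂_le fun t ht => ?_
    have hmω : Measurable (fun p : ℝ × ℝ => ‖E p.2 ω p.1‖ₑ ^ 2) :=
      (measurable_velocityError_path h hX ω).enorm.pow_const 2
    calc normSqH (fun x => displacementField φ n N (fun s => X s ω) x t - u x t)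
        ≤ ∫⁻ x in Ico (0 : ℝ) 1, T * ∫⁻ s in Ioc (0 : ℝ) T, ‖E s ω x‖ₑ ^ 2 := by
          refine lintegral_mono fun x => ?_
          beta_reduce
          rw [displacement_sub_eq hu h hω ht.2]
          exact enorm_sq_setIntegral_le (measurable_velocityError_time h hX ω x) ht.2
      _ = T * ∫⁻ s in Ioc (0 : ℝ) T, normSqH (E s ω) := by
          rw [lintegral_const_mul' _ _ ENNReal.coe_ne_top,
            lintegral_lintegral_swap (f := fun x s => ‖E s ω x‖ₑ ^ 2) hmω.aemeasurable]
          rfl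
  refine (lintegral_mono_ae hsup).trans ?_
  rw [lintegral_const_mul' _ _ ENNReal.coe_ne_top]
  gcongr
  have hm2 : Measurable (fun p : Ω × ℝ => normSqH (E p.2 p.1)) := by
    have : Measurable (fun q : (Ω × ℝ) × ℝ => ‖E q.1.2 q.1.1 q.2‖ₑ ^ 2) :=
      hm.enorm.pow_const 2
    exact this.lintegral_prod_right'
  rw [lintegral_lintegral_swap (f := fun ω s => normSqH (E s ω)) hm2.aemeasurable]
  exact setLIntegral_Ioc_le hB

lemma MemLp.restrict_siteCell {η : ℝ → ℝ} (hη : MemLp η 2 (volume.restrict (Ico (0 : ℝ) 1)))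
    (k : ZMod n) : MemLp η 2 (volume.restrict (siteCell n k)) :=
  hη.mono_measure (Measure.restrict_mono (fun _ hx => hx.1) le_rfl)

lemma integrableOn_of_memLp {η : ℝ → ℝ} (hη : MemLp η 2 (volume.restrict (Ico (0 : ℝ) 1))) :
    IntegrableOn η (Ico 0 1) :=
  hη.integrable (by norm_num)

lemma integrableOn_bounded_mul {η f : ℝ → ℝ} (hη : MemLp η 2 (volume.restrict (Ico (0 : ℝ) 1)))
    (hf : Measurable f) {M : ℝ} (hM : ∀ x, |f x| ≤ M) :
    IntegrableOn (fun x => f x * η x) (Ico 0 1) :=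
  (integrableOn_of_memLp hη).bdd_mul hf.aestronglyMeasurable (ae_of_all _ hM)

lemma setIntegral_comp_site_mul {η : ℝ → ℝ} (hη : MemLp η 2 (volume.restrict (Ico (0 : ℝ) 1)))
    (f : ZMod n → ℝ) :
    ∫ x in Ico (0 : ℝ) 1, f (site n x) * η x = ∑ k, f k * ∫ x in siteCell n k, η x := by
  rw [setIntegral_eq_sum_siteCell (n := n)
    (integrableOn_bounded_mul hη (measurable_comp_site f) (abs_comp_site_le f))]
  refine Finset.sum_congr rfl fun k _ => ?_
  rw [← integral_const_mul]
  exact setIntegral_congr_fun (measurableSet_siteCell k) fun x hx => by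
    simp only [show site n x = k from hx.2]

/-- Cauchy–Schwarz on each cell of length 1/n. The gain 1/n matches the normalisation nN² of the
covariance. -/
lemma sum_setIntegral_siteCell_sq_le {η : ℝ → ℝ}
    (hη : MemLp η 2 (volume.restrict (Ico (0 : ℝ) 1))) :
    ∑ k : ZMod n, (∫ x in siteCell n k, η x) ^ 2 ≤ (∫ x in Ico (0 : ℝ) 1, η x ^ 2) / n := by
  rw [setIntegral_eq_sum_siteCell (n := n) hη.integrable_sq, Finset.sum_div]
  refine Finset.sum_le_sum fun k _ => ?_
  have hfin : IsFiniteMeasure (volume.restrict (siteCell n k)) :=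
    ⟨by rw [Measure.restrict_apply_univ]; exact (volume_siteCell_ne_top k).lt_top⟩
  have h1 := sq_integral_mul_le (MemLp.restrict_siteCell hη k)
    (memLp_const (μ := volume.restrict (siteCell n k)) (p := 2) (1 : ℝ))
  simp only [mul_one, one_pow, integral_const, smul_eq_mul] at h1
  rw [measureReal_restrict_apply_univ, volume_real_siteCell] at h1
  rw [div_eq_mul_one_div]
  exact h1

/-- The fluctuations of the velocity in a fixed direction are controlled by the Hilbert–Schmidt norm
of the covariance matrix. -/
lemma lintegral_innerH_sq_le (h : IsWaveData φ ψ K)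
    (hX : SolvesDynkin (ringRate n) (ringTransition n) x₀ P X) {s : ℝ} (hs : 0 ≤ s) {η : ℝ → ℝ}
    (hη : MemLp η 2 (volume.restrict (Ico (0 : ℝ) 1))) {D : ℝ} (hD : 0 ≤ D)
    (hC : ∑ i, ∑ j, coordCov ringCoord P X s i j ^ 2 ≤ D ^ 2) :
    ∫⁻ ω, ENNReal.ofReal (innerH (velocityError φ ψ n N X s ω) η ^ 2) ∂P ≤
      ENNReal.ofReal ((D / (n * N ^ 2) + meanBias φ ψ n N P X s) *
        ∫ x in Ico (0 : ℝ) 1, η x ^ 2) := by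
  have hJ := ring_isSkewJumpSystem n
  set c : ZMod n → ℝ := fun k => ∫ x in siteCell n k, η x with hc
  set α : ℝ := ∫ x in Ico (0 : ℝ) 1, waveVelocity φ ψ x s * η x with hα
  have hA := integrableOn_bounded_mul hη (h.measurable_velocity s) fun x => h.abs_velocity_le x s
  have hsub : ∀ f : ZMod n → ℝ, ∫ x in Ico (0 : ℝ) 1,
      (f (site n x) / N - waveVelocity φ ψ x s) * η x = ∑ k, f k / N * c k - α := fun f => by
    simp only [sub_mul]
    rw [integral_sub (integrableOn_bounded_mul hη (measurable_comp_site fun k => f k / (N : ℝ))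
      (abs_comp_site_le fun k => f k / (N : ℝ))) hA,
      setIntegral_comp_site_mul hη fun k => f k / (N : ℝ)]
  have hinner : ∀ ω, innerH (velocityError φ ψ n N X s ω) η =
      ∑ k, ringCoord (X s ω) (Sum.inl k) / N * c k - α := fun ω =>
    hsub fun k => ringCoord (X s ω) (Sum.inl k)
  simp only [hinner]
  have hi1 : ∀ k : ZMod n, Integrable (fun ω => ringCoord (X s ω) (Sum.inl k) / N * c k) P :=
    fun k => ((hJ.integrable_coord hX hs _).div_const _).mul_const _
  have hY1 : Integrable (fun ω => ∑ k, ringCoord (X s ω) (Sum.inl k) / N * c k) P :=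
    integrable_finsetSum _ fun k _ => hi1 k
  have hsq : ∀ ω, (∑ k, ringCoord (X s ω) (Sum.inl k) / N * c k) ^ 2 =
      ∑ k, ∑ l, ringCoord (X s ω) (Sum.inl k) * ringCoord (X s ω) (Sum.inl l) *
        (c k * c l / N ^ 2) := fun ω => by
    rw [sq, Finset.sum_mul_sum]
    exact Finset.sum_congr rfl fun k _ => Finset.sum_congr rfl fun l _ => by ring
  have hi2 : ∀ k l : ZMod n, Integrable (fun ω => ringCoord (X s ω) (Sum.inl k) *
      ringCoord (X s ω) (Sum.inl l) * (c k * c l / N ^ 2)) P := fun k l =>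
    (hJ.integrable_mul hX hs _ _).mul_const _
  have hY2 : Integrable (fun ω => (∑ k, ringCoord (X s ω) (Sum.inl k) / N * c k) ^ 2) P := by
    simp only [hsq]
    exact integrable_finsetSum _ fun k _ => integrable_finsetSum _ fun l _ => hi2 k l
  obtain ⟨hint, heq⟩ := integral_sub_sq hY1 hY2 α
  rw [← ofReal_integral_eq_lintegral_ofReal hint (ae_of_all _ fun ω => sq_nonneg _)]
  apply ENNReal.ofReal_le_ofReal
  rw [heq, add_mul]
  have hEY : ∫ ω, ∑ k, ringCoord (X s ω) (Sum.inl k) / N * c k ∂P =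
      ∑ k, coordMean ringCoord P X s (Sum.inl k) / N * c k := by
    rw [integral_finsetSum _ fun k _ => hi1 k]
    simp only [integral_mul_const, integral_div, coordMean]
  refine add_le_add ?_ ?_
  -- Only velocities are tested, so the test vector is extended by zero to the edges and the
  -- Hilbert–Schmidt bound of the full covariance matrix applies.
  · set c' : ZMod n ⊕ ZMod n → ℝ := Sum.elim c fun _ => 0 with hc'
    have hvar : ∫ ω, (∑ k, ringCoord (X s ω) (Sum.inl k) / N * c k) ^ 2 ∂P -
        (∫ ω, ∑ k, ringCoord (X s ω) (Sum.inl k) / N * c k ∂P) ^ 2 =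
        (∑ i, ∑ j, c' i * c' j * coordCov ringCoord P X s i j) / N ^ 2 := by
      rw [hEY]
      simp only [hsq]
      rw [integral_finsetSum _ fun k _ => integrable_finsetSum _ fun l _ => hi2 k l,
        sq (∑ k, coordMean ringCoord P X s (Sum.inl k) / (N : ℝ) * c k),
        Finset.sum_mul_sum, ← Finset.sum_sub_distrib, Fintype.sum_sum_type]
      simp only [Fintype.sum_sum_type, hc', Sum.elim_inl, Sum.elim_inr, mul_zero, zero_mul,
        Finset.sum_const_zero, add_zero, Finset.sum_div]
      refine Finset.sum_congr rfl fun k _ => ?_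
      rw [integral_finsetSum _ fun l _ => hi2 k l, ← Finset.sum_sub_distrib]
      refine Finset.sum_congr rfl fun l _ => ?_
      rw [integral_mul_const, coordCov, coordMoment]
      ring
    rw [hvar]
    have h1 := IsSkewJumpSystem.sum_cov_mul_le c' s hD hC
    have h2 : ∑ i, c' i ^ 2 ≤ (∫ x in Ico (0 : ℝ) 1, η x ^ 2) / n := by
      rw [Fintype.sum_sum_type]
      simpa [hc'] using sum_setIntegral_siteCell_sq_le (n := n) hη
    calc _ ≤ (D * ((∫ x in Ico (0 : ℝ) 1, η x ^ 2) / n)) / (N : ℝ) ^ 2 := by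
          gcongr
          exact h1.trans (mul_le_mul_of_nonneg_left h2 hD)
      _ = _ := by ring
  · rw [hEY, ← hsub fun k => coordMean ringCoord P X s (Sum.inl k)]
    have hmem : MemLp (fun x => coordMean ringCoord P X s (Sum.inl (site n x)) / N -
        waveVelocity φ ψ x s) 2 (volume.restrict (Ico (0 : ℝ) 1)) := by
      refine MemLp.of_bound (C := ∑ k : ZMod n, |coordMean ringCoord P X s (Sum.inl k) / N| + 2 * K)
        (((measurable_comp_site fun k : ZMod n =>
          coordMean ringCoord P X s (Sum.inl k) / (N : ℝ)).sub
          (h.measurable_velocity s)).aestronglyMeasurable) (ae_of_all _ fun x => ?_)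
      refine (norm_sub_le _ _).trans (add_le_add ?_ (h.abs_velocity_le x s))
      exact abs_comp_site_le (fun k : ZMod n => coordMean ringCoord P X s (Sum.inl k) / (N : ℝ)) x
    refine (sq_integral_mul_le hmem hη).trans ?_
    refine mul_le_mul_of_nonneg_right ?_ (integral_nonneg fun _ => sq_nonneg _)
    exact le_add_of_nonneg_right (integral_nonneg fun _ => sq_nonneg _)

/-- Fubini in space and time along a fixed path. The integrand is dominated by |η(x)| times the sum
over all sites of the rescaled velocities at time s, plus 2K|η(x)|; both are products of integrable
functions of one variable. -/
lemma innerH_displacement_eq {u : ℝ → ℝ → ℝ} (hu : IsClassicalWaveSolution φ ψ u)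
    (h : IsWaveData φ ψ K) {X : ℝ≥0 → Ω → State (ZMod n) (ZMod n)}
    (hX : SolvesDynkin (ringRate n) (ringTransition n) x₀ P fun t ω => X t.toNNReal ω)
    {T : ℝ≥0} {ω : Ω}
    (hω : ∀ i, IntegrableOn (fun s : ℝ => ringCoord (X s.toNNReal ω) i) (Ioc 0 T)) {t : ℝ≥0}
    (ht : t ≤ T) {η : ℝ → ℝ} (hη : MemLp η 2 (volume.restrict (Ico (0 : ℝ) 1)))
    (hηm : Measurable η) :
    innerH (fun x => displacementField φ n N (fun s => X s ω) x t - u x t) η =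
      ∫ s in Ioc (0 : ℝ) t,
        innerH (velocityError φ ψ n N (fun s ω => X s.toNNReal ω) s ω) η := by
  classical
  simp only [innerH, displacement_sub_eq hu h hω ht, ← integral_mul_const]
  refine integral_integral_swap (f := fun x s =>
    velocityError φ ψ n N (fun s ω => X s.toNNReal ω) s ω x * η x) ?_
  have hηi : Integrable η (volume.restrict (Ico (0 : ℝ) 1)) := integrableOn_of_memLp hη
  have hmE : Measurable (fun p : ℝ × ℝ =>
      velocityError φ ψ n N (fun s ω => X s.toNNReal ω) p.2 ω p.1 * η p.1) :=
    (measurable_velocityError_path h hX ω).mul (hηm.comp measurable_fst)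
  have hi : ∀ k : ZMod n, Integrable
      (fun p : ℝ × ℝ => |η p.1| * |ringCoord (X p.2.toNNReal ω) (Sum.inl k) / N|)
      ((volume.restrict (Ico (0 : ℝ) 1)).prod (volume.restrict (Ioc (0 : ℝ) t))) := fun k =>
    hηi.abs.mul_prod ((((hω (Sum.inl k)).mono_set
      (Ioc_subset_Ioc_right (by exact_mod_cast ht))).div_const (N : ℝ)).abs)
  have hi2 : Integrable (fun p : ℝ × ℝ => |η p.1| * (2 * K))
      ((volume.restrict (Ico (0 : ℝ) 1)).prod (volume.restrict (Ioc (0 : ℝ) t))) :=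
    hηi.abs.mul_prod (integrable_const _)
  refine ((integrable_finsetSum Finset.univ fun k _ => hi k).add hi2).mono'
    hmE.aestronglyMeasurable (ae_of_all _ fun p => ?_)
  change |velocityError φ ψ n N (fun s ω => X s.toNNReal ω) p.2 ω p.1 * η p.1| ≤
    ∑ k : ZMod n, |η p.1| * |ringCoord (X p.2.toNNReal ω) (Sum.inl k) / N| + |η p.1| * (2 * K)
  rw [abs_mul, ← Finset.mul_sum, ← mul_add, mul_comm]
  refine mul_le_mul_of_nonneg_left ?_ (abs_nonneg _)
  refine (abs_sub _ _).trans (add_le_add ?_ (h.abs_velocity_le _ _))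
  exact abs_comp_site_le
    (fun k : ZMod n => ringCoord (X p.2.toNNReal ω) (Sum.inl k) / (N : ℝ)) p.1

/-- The displacement is weakly close to the solution if the velocity is. -/
lemma lintegral_iSup_innerH_le_of_measurable {u : ℝ → ℝ → ℝ} (hu : IsClassicalWaveSolution φ ψ u)
    (h : IsWaveData φ ψ K) {X : ℝ≥0 → Ω → State (ZMod n) (ZMod n)}
    (hX : SolvesDynkin (ringRate n) (ringTransition n) x₀ P fun t ω => X t.toNNReal ω) {T : ℝ≥0}
    {η : ℝ → ℝ} (hη : MemLp η 2 (volume.restrict (Ico (0 : ℝ) 1))) (hηm : Measurable η)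
    {B : ℝ≥0∞} (hB : ∀ s : ℝ≥0, s ≤ T → ∫⁻ ω, ENNReal.ofReal
      (innerH (velocityError φ ψ n N (fun t ω => X t.toNNReal ω) s ω) η ^ 2) ∂P ≤ B) :
    ∫⁻ ω, ⨆ t ∈ Icc 0 T, ENNReal.ofReal
      (innerH (fun x => displacementField φ n N (fun s => X s ω) x t - u x t) η ^ 2) ∂P ≤
        T * (B * T) := by
  set E := velocityError φ ψ n N (fun t ω => X t.toNNReal ω) with hE
  have hm : Measurable (fun q : (Ω × ℝ) × ℝ => E q.1.2 q.1.1 q.2) :=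
    measurable_velocityError_prod h hX
  have hmI : Measurable (fun p : Ω × ℝ => innerH (E p.2 p.1) η) := by
    have : StronglyMeasurable (fun q : (Ω × ℝ) × ℝ => E q.1.2 q.1.1 q.2 * η q.2) :=
      (hm.mul (hηm.comp measurable_snd)).stronglyMeasurable
    exact this.integral_prod_right'.measurable
  have hsup : ∀ᵐ ω ∂P, ⨆ t ∈ Icc 0 T, ENNReal.ofReal
      (innerH (fun x => displacementField φ n N (fun s => X s ω) x t - u x t) η ^ 2) ≤
        T * ∫⁻ s in Ioc (0 : ℝ) T, ENNReal.ofReal (innerH (E s ω) η ^ 2) := by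
    filter_upwards [ae_integrableOn_coord hX T] with ω hω
    refine iSup₂_le fun t ht => ?_
    rw [innerH_displacement_eq hu h hX hω ht.2 hη hηm]
    simp only [← enorm_sq_eq_ofReal]
    exact enorm_sq_setIntegral_le (hmI.comp (measurable_const.prodMk measurable_id)) ht.2
  refine (lintegral_mono_ae hsup).trans ?_
  rw [lintegral_const_mul' _ _ ENNReal.coe_ne_top]
  gcongr
  rw [lintegral_lintegral_swap (f := fun ω s => ENNReal.ofReal (innerH (E s ω) η ^ 2))
    (hmI.pow_const 2).ennreal_ofReal.aemeasurable]
  exact setLIntegral_Ioc_le hB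

lemma lintegral_iSup_innerH_le {u : ℝ → ℝ → ℝ} (hu : IsClassicalWaveSolution φ ψ u)
    (h : IsWaveData φ ψ K) {X : ℝ≥0 → Ω → State (ZMod n) (ZMod n)}
    (hX : SolvesDynkin (ringRate n) (ringTransition n) x₀ P fun t ω => X t.toNNReal ω) {T : ℝ≥0}
    {η : ℝ → ℝ} (hη : MemLp η 2 (volume.restrict (Ico (0 : ℝ) 1)))
    {B : ℝ≥0∞} (hB : ∀ s : ℝ≥0, s ≤ T → ∫⁻ ω, ENNReal.ofReal
      (innerH (velocityError φ ψ n N (fun t ω => X t.toNNReal ω) s ω) η ^ 2) ∂P ≤ B) :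
    ∫⁻ ω, ⨆ t ∈ Icc 0 T, ENNReal.ofReal
      (innerH (fun x => displacementField φ n N (fun s => X s ω) x t - u x t) η ^ 2) ∂P ≤
        T * (B * T) := by
  -- The inner product ignores null sets, so η may be replaced by a measurable representative, as
  -- joint measurability requires.
  have hae := hη.1.ae_eq_mk
  have hinner : ∀ f : ℝ → ℝ, innerH f η = innerH f (hη.1.mk η) := fun f =>
    integral_congr_ae (hae.mono fun x hx => by simp only [hx])
  simp only [hinner] at hB ⊢
  exact lintegral_iSup_innerH_le_of_measurable hu h hX (hη.ae_eq hae)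
    hη.1.stronglyMeasurable_mk.measurable hB

end Displacement

/-! ### Quantitative bounds of the mean square error -/

/-- A bound of the rescaled expected energy up to time `T`, where `ρ = n / N`. -/
noncomputable def energyBound (K ρ T : ℝ) : ℝ :=
  (2 * (1 + 3 * K) ^ 2 + 2 * ρ * T) * Real.exp (ρ * T)

/-- A bound of the squared error of the mean at the sites of the ring up to time `T`. -/
noncomputable def gridErrorBound (T a b : ℝ) : ℝ :=
  (2 * (a + b) ^ 2 + 8 * b ^ 2 * T) * Real.exp T

section Bounds

variable {φ ψ : ℝ → ℝ} {K : ℝ} {n : ℕ} [NeZero n] {N : ℕ} {Ω : Type*} [MeasurableSpace Ω]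
  {P : Measure Ω} [IsProbabilityMeasure P] {X : ℝ → Ω → State (ZMod n) (ZMod n)}

lemma sum_moment_le_energyBound (h : IsWaveData φ ψ K) (hN : 0 < N)
    (hX : SolvesDynkin (ringRate n) (ringTransition n) (ringInitial φ ψ n N) P X) {t T : ℝ}
    (ht : 0 ≤ t) (htT : t ≤ T) :
    ∑ i, coordMoment ringCoord P X t i i ≤ n * (N : ℝ) ^ 2 * energyBound K (n / N) T := by
  refine (sum_ring_moment_le h hN hX ht).trans ?_
  rw [energyBound]
  have hT : 0 ≤ T := ht.trans htT
  gcongr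

lemma totalVariance_le (h : IsWaveData φ ψ K) (hN : 0 < N)
    (hX : SolvesDynkin (ringRate n) (ringTransition n) (ringInitial φ ψ n N) P X) {t T : ℝ}
    (ht : 0 ≤ t) (htT : t ≤ T) :
    totalVariance n N P X t ≤ n / N * (energyBound K (n / N) T + 2) * T := by
  have hn : (0 : ℝ) < n := Nat.cast_pos.2 (NeZero.pos n)
  have hN' : (0 : ℝ) < N := Nat.cast_pos.2 hN
  have hT : 0 ≤ T := ht.trans htT
  have hb : 0 ≤ energyBound K (n / N) T := by unfold energyBound; positivity
  have := (ring_isSkewJumpSystem n).sum_cov_le hX ht hN'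
    fun s hs hst => sum_moment_le_energyBound h hN hX hs (hst.trans htT)
  rw [card_ring_sum] at this
  rw [totalVariance, div_le_iff₀ (by positivity)]
  refine this.trans ?_
  calc _ ≤ (n : ℝ) * (n * N ^ 2 * energyBound K (n / N) T / N + N * ((2 * n : ℕ) : ℝ)) * T := by
        gcongr
    _ = _ := by
        push_cast
        field_simp

lemma sum_mean_error_le_gridErrorBound (h : IsWaveData φ ψ K) (hN : 0 < N)
    (hX : SolvesDynkin (ringRate n) (ringTransition n) (ringInitial φ ψ n N) P X) {t T : ℝ}
    (ht : 0 ≤ t) (htT : t ≤ T) :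
    ∑ i, (coordMean ringCoord P X t i / N - gridWave φ ψ n t i) ^ 2 ≤
      n * gridErrorBound T (1 / N) (K / n) := by
  have hn : (0 : ℝ) < n := Nat.cast_pos.2 (NeZero.pos n)
  have hT : 0 ≤ T := ht.trans htT
  refine (sum_mean_error_le h hN hX ht).trans ?_
  calc _ ≤ (2 * n * (1 / N + K / n) ^ 2 + 8 * K ^ 2 / n * T) * Real.exp T := by gcongr
    _ = _ := by
        rw [gridErrorBound]
        field_simp

/-- A bound of the bias up to time `T`. -/
noncomputable def biasBound (K T : ℝ) (n N : ℕ) : ℝ :=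
  2 * gridErrorBound T (1 / N) (K / n) + 16 * (K / n) ^ 2

lemma meanBias_le_biasBound (h : IsWaveData φ ψ K) (hN : 0 < N)
    (hX : SolvesDynkin (ringRate n) (ringTransition n) (ringInitial φ ψ n N) P X) {t T : ℝ}
    (ht : 0 ≤ t) (htT : t ≤ T) : meanBias φ ψ n N P X t ≤ biasBound K T n N := by
  refine (meanBias_le h hN hX ht).trans ?_
  have hT : 0 ≤ T := ht.trans htT
  rw [biasBound, gridErrorBound]
  gcongr

lemma lintegral_velocityError_le {u : ℝ → ℝ → ℝ} (hu : IsClassicalWaveSolution φ ψ u)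
    {X : ℝ≥0 → Ω → State (ZMod n) (ZMod n)} (t : ℝ≥0) :
    ∫⁻ ω, normSqH (velocityError φ ψ n N (fun t ω => X t.toNNReal ω) t ω) ∂P ≤
      meanSqError u n N P X t := by
  rw [meanSqError]
  refine le_trans (le_of_eq ?_) le_self_add
  refine lintegral_congr fun ω => congrArg normSqH (funext fun x => ?_)
  simp only [hu.timeDeriv_eq_waveVelocity _ t.coe_nonneg, velocityError, Real.toNNReal_coe]

/-- The energy of the initial data. -/
noncomputable def initialEnergy (φ ψ : ℝ → ℝ) : ℝ :=
  (∫ x in Ico (0 : ℝ) 1, waveVelocity φ ψ x 0 ^ 2) + ∫ x in Ico (0 : ℝ) 1, waveStrain φ ψ x 0 ^ 2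

lemma setIntegral_sq_le_sum {f : ZMod n → ℝ} {g : ℝ → ℝ} (hg : Measurable g) {M : ℝ}
    (hM : ∀ x, |g x| ≤ M) :
    ∫ x in Ico (0 : ℝ) 1, g x ^ 2 ≤
      2 * ((∑ k, f k ^ 2) / n) + 2 * ∫ x in Ico (0 : ℝ) 1, (f (site n x) - g x) ^ 2 := by
  have hI1 := integrableOn_of_bounded_Ico (hg.pow_const 2) (M := M ^ 2) fun x => by
    rw [abs_pow]; exact pow_le_pow_left₀ (abs_nonneg _) (hM x) 2
  have hI2 := integrableOn_of_bounded_Ico (measurable_comp_site (n := n) fun k => f k ^ 2)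
    (abs_comp_site_le fun k => f k ^ 2)
  have hI3 : IntegrableOn (fun x => (f (site n x) - g x) ^ 2) (Ico 0 1) := by
    refine integrableOn_of_bounded_Ico (((measurable_comp_site f).sub hg).pow_const 2)
      (M := (∑ k, |f k| + M) ^ 2) fun x => ?_
    rw [abs_pow]
    exact pow_le_pow_left₀ (abs_nonneg _)
      ((abs_sub _ _).trans (add_le_add (abs_comp_site_le f x) (hM x))) 2
  rw [← setIntegral_comp_site fun k => f k ^ 2, ← integral_const_mul, ← integral_const_mul,
    ← integral_add (hI2.const_mul 2) (hI3.const_mul 2)]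
  refine integral_mono hI1 ((hI2.const_mul 2).add (hI3.const_mul 2)) fun x => ?_
  change g x ^ 2 ≤ 2 * f (site n x) ^ 2 + 2 * (f (site n x) - g x) ^ 2
  nlinarith [sq_nonneg (2 * f (site n x) - g x)]

/-- At time 0 the mean is the deterministic initial state, so the bias measures its distance from
the initial wave; the inequality bounds the discrete initial energy from below. -/
lemma initialEnergy_le (h : IsWaveData φ ψ K)
    (hX : SolvesDynkin (ringRate n) (ringTransition n) (ringInitial φ ψ n N) P X) :
    initialEnergy φ ψ ≤ 2 * ((∑ i, (ringCoord (ringInitial φ ψ n N) i / N) ^ 2) / n) +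
      2 * meanBias φ ψ n N P X 0 := by
  have hJ := ring_isSkewJumpSystem n
  have h1 := setIntegral_sq_le_sum (n := n)
    (f := fun k => ringCoord (ringInitial φ ψ n N) (Sum.inl k) / N)
    (h.measurable_velocity 0) fun x => h.abs_velocity_le x 0
  have h2 := setIntegral_sq_le_sum (n := n)
    (f := fun k => ringCoord (ringInitial φ ψ n N) (Sum.inr k) / N)
    (h.measurable_strain 0) fun x => h.abs_strain_le x 0
  rw [initialEnergy, meanBias, Fintype.sum_sum_type, add_div]
  simp only [hJ.mean_zero hX]
  linarith

/-- A lower bound of the expected number of particles. -/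
lemma le_sum_absMean (h : IsWaveData φ ψ K) (hN : 0 < N)
    (hX : SolvesDynkin (ringRate n) (ringTransition n) (ringInitial φ ψ n N) P X) {t T : ℝ}
    (ht : 0 ≤ t) (htT : t ≤ T) :
    n * N * ((initialEnergy φ ψ / 2 - biasBound K T n N - gridErrorBound T (1 / N) (K / n)) /
      (2 * (2 * K + 1))) ≤ ∑ i, coordAbsMean ringCoord P X t i := by
  have hn : (0 : ℝ) < n := Nat.cast_pos.2 (NeZero.pos n)
  have hN' : (0 : ℝ) < N := Nat.cast_pos.2 hN
  have hK := h.nonneg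
  have hJ := ring_isSkewJumpSystem n
  have h1 := initialEnergy_le h hX
  have h2 := meanBias_le_biasBound h hN hX le_rfl (ht.trans htT)
  have h3 := sum_mean_error_le_gridErrorBound h hN hX ht htT
  have h4 : ∑ i, (coordMean ringCoord P X t i / N) ^ 2 =
      ∑ i, (ringCoord (ringInitial φ ψ n N) i / N) ^ 2 := by
    simp only [div_pow, ← Finset.sum_div, hJ.sum_mean_sq_eq hX ht]
  -- The bound 2K would suffice; adding 1 makes the later divisor positive.
  have hZ : ∀ i : ZMod n ⊕ ZMod n, |gridWave φ ψ n t i| ≤ 2 * K + 1 := fun i => by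
    rcases i with k | k
    · exact (h.abs_velocity_le _ _).trans (by linarith)
    · exact (h.abs_strain_le _ _).trans (by linarith)
  -- With μ = m/N and z the wave, μ² - (μ - z)² = 2μz - z² ≤ 2|μ||z|. Thus the conserved energy of
  -- the mean, less its squared error, bounds the number of particles from below.
  have h5 : ∀ i, (coordMean ringCoord P X t i / N) ^ 2 -
      (coordMean ringCoord P X t i / N - gridWave φ ψ n t i) ^ 2 ≤
      coordAbsMean ringCoord P X t i * (2 * (2 * K + 1) / N) := fun i => by
    have a1 : coordMean ringCoord P X t i * gridWave φ ψ n t i ≤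
        coordAbsMean ringCoord P X t i * (2 * K + 1) := by
      refine (le_abs_self _).trans ?_
      rw [abs_mul]
      exact mul_le_mul (abs_coordMean_le t i) (hZ i) (abs_nonneg _) (coordAbsMean_nonneg t i)
    calc _ ≤ 2 / N * (coordMean ringCoord P X t i * gridWave φ ψ n t i) := by
          have := sq_nonneg (gridWave φ ψ n t i)
          have e : 2 / N * (coordMean ringCoord P X t i * gridWave φ ψ n t i) =
            2 * (coordMean ringCoord P X t i / N) * gridWave φ ψ n t i := by ring
          rw [e]
          nlinarith
      _ ≤ 2 / N * (coordAbsMean ringCoord P X t i * (2 * K + 1)) := by gcongr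
      _ = _ := by ring
  have h6 := Finset.sum_le_sum fun i (_ : i ∈ Finset.univ) => h5 i
  rw [Finset.sum_sub_distrib, h4, ← Finset.sum_mul] at h6
  set A := ∑ i, (ringCoord (ringInitial φ ψ n N) i / (N : ℝ)) ^ 2
  set G := ∑ i, coordAbsMean ringCoord P X t i
  have h7 : initialEnergy φ ψ / 2 - biasBound K T n N ≤ A / n := by linarith
  rw [le_div_iff₀ hn] at h7
  have h8 : n * (initialEnergy φ ψ / 2 - biasBound K T n N -
      gridErrorBound T (1 / N) (K / n)) ≤ G * (2 * (2 * K + 1) / N) := by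
    linarith
  rw [← mul_div_assoc, div_le_iff₀ (by positivity)]
  rw [← mul_div_assoc, le_div_iff₀ hN'] at h8
  linarith

/-- A lower bound of the total variance. -/
lemma le_totalVariance (h : IsWaveData φ ψ K) (hn2 : 2 ≤ n) (hN : 0 < N)
    (hX : SolvesDynkin (ringRate n) (ringTransition n) (ringInitial φ ψ n N) P X) {t : ℝ}
    (ht : 0 ≤ t) :
    n / N * ((initialEnergy φ ψ / 2 - biasBound K t n N - gridErrorBound t (1 / N) (K / n)) /
      (2 * K + 1) * t) ≤ totalVariance n N P X t := by
  have hn : (0 : ℝ) < n := Nat.cast_pos.2 (NeZero.pos n)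
  have hN' : (0 : ℝ) < N := Nat.cast_pos.2 hN
  have hK := h.nonneg
  have := (ring_isSkewJumpSystem n).le_sum_cov hX (sum_ringJump_sq hn2) ht
    fun s hs hst => le_sum_absMean h hN hX hs hst
  rw [totalVariance, le_div_iff₀ (by positivity)]
  refine le_trans (le_of_eq ?_) this
  field_simp

/-- A bound of the velocity error in a fixed direction. -/
lemma lintegral_innerH_sq_le_bound (h : IsWaveData φ ψ K) (hN : 0 < N)
    (hX : SolvesDynkin (ringRate n) (ringTransition n) (ringInitial φ ψ n N) P X) {t T : ℝ}
    (ht : 0 ≤ t) (htT : t ≤ T) {η : ℝ → ℝ}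
    (hη : MemLp η 2 (volume.restrict (Ico (0 : ℝ) 1))) :
    ∫⁻ ω, ENNReal.ofReal (innerH (velocityError φ ψ n N X t ω) η ^ 2) ∂P ≤
      ENNReal.ofReal ((√(n / N * energyBound K (n / N) T * T * Real.exp (8 * T) * (1 / N)) +
        biasBound K T n N) * ∫ x in Ico (0 : ℝ) 1, η x ^ 2) := by
  have hn : (0 : ℝ) < n := Nat.cast_pos.2 (NeZero.pos n)
  have hN' : (0 : ℝ) < N := Nat.cast_pos.2 hN
  have hT : 0 ≤ T := ht.trans htT
  have hb : 0 ≤ energyBound K (n / N) T := by unfold energyBound; positivity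
  set q := n / N * energyBound K (n / N) T * T * Real.exp (8 * T) * (1 / N) with hq
  have hq0 : 0 ≤ q := by positivity
  have hC := (ring_isSkewJumpSystem n).sum_cov_sq_le hX ht
    fun s hs hst => sum_moment_le_energyBound h hN hX hs (hst.trans htT)
  -- The bound n² · nN² · (energy bound) · T e^(8T) is rewritten as (nN²)² q; the factor (n/N)(1/N)
  -- in q makes it vanish in the critical scaling.
  have hC' : ∑ i, ∑ j, coordCov ringCoord P X t i j ^ 2 ≤ (n * (N : ℝ) ^ 2 * √q) ^ 2 := by
    refine hC.trans ?_
    rw [mul_pow, Real.sq_sqrt hq0, hq]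
    calc _ ≤ (n : ℝ) ^ 2 * (n * N ^ 2 * energyBound K (n / N) T) * T * Real.exp (8 * T) := by gcongr
      _ = _ := by field_simp
  refine (lintegral_innerH_sq_le h hX ht hη (by positivity) hC').trans ?_
  refine ENNReal.ofReal_le_ofReal
    (mul_le_mul_of_nonneg_right ?_ (integral_nonneg fun _ => sq_nonneg _))
  refine add_le_add (le_of_eq ?_) (meanBias_le_biasBound h hN hX ht htT)
  field_simp

end Bounds

/-! ### Positivity of the initial energy, limits of the bounds and the three scalings -/

lemma initialEnergy_pos {φ ψ : ℝ → ℝ} {K : ℝ} (h : IsWaveData φ ψ K)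
    (hφ_per : Function.Periodic φ 1) (hψ_per : Function.Periodic ψ 1)
    (hnontrivial : ∃ x, deriv φ x ^ 2 + ψ x ^ 2 ≠ 0) : 0 < initialEnergy φ ψ := by
  have hc1 : Continuous fun x => waveVelocity φ ψ x 0 :=
    h.continuous_velocity.comp (by fun_prop : Continuous fun x : ℝ => (x, (0 : ℝ)))
  have hc2 : Continuous fun x => waveStrain φ ψ x 0 :=
    h.continuous_strain.comp (by fun_prop : Continuous fun x : ℝ => (x, (0 : ℝ)))
  have e1 : ∀ x, waveVelocity φ ψ x 0 = ψ x := fun x => by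
    simp only [waveVelocity, leftProfile, rightProfile, add_zero, sub_zero]; ring
  have e2 : ∀ x, waveStrain φ ψ x 0 = deriv φ x := fun x => by
    simp only [waveStrain, leftProfile, rightProfile, add_zero, sub_zero]; ring
  obtain ⟨x, hx⟩ := hnontrivial
  obtain ⟨y, hy, hxy⟩ :=
    (show Function.Periodic (fun x => deriv φ x ^ 2 + ψ x ^ 2) 1 from fun x => by
      simp only [periodic_deriv hφ_per x, hψ_per x]).exists_mem_Ico₀ one_pos x
  rw [hxy] at hx
  have hpos := intervalIntegral.integral_pos (f := fun x => waveVelocity φ ψ x 0 ^ 2 +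
    waveStrain φ ψ x 0 ^ 2) zero_lt_one ((hc1.pow 2).add (hc2.pow 2)).continuousOn
    (fun x _ => by positivity) ⟨y, ⟨hy.1, hy.2.le⟩, by
      rw [e1, e2, add_comm]
      exact lt_of_le_of_ne (by positivity) (Ne.symm hx)⟩
  rw [intervalIntegral.integral_of_le zero_le_one, integral_Ioc_eq_integral_Ioo,
    ← integral_Ico_eq_integral_Ioo] at hpos
  rw [initialEnergy, ← integral_add]
  · exact hpos
  · exact ((hc1.pow 2).integrableOn_Icc).mono_set Ico_subset_Icc_self
  · exact ((hc2.pow 2).integrableOn_Icc).mono_set Ico_subset_Icc_self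

lemma tendsto_gridErrorBound {n N : ℕ → ℕ} (hn : Tendsto n atTop atTop)
    (hN : Tendsto N atTop atTop) (K T : ℝ) :
    Tendsto (fun j => gridErrorBound T (1 / N j) (K / n j)) atTop (𝓝 0) := by
  have h1 : Tendsto (fun j => (1 : ℝ) / N j) atTop (𝓝 0) :=
    (tendsto_const_div_atTop_nhds_zero_nat 1).comp hN
  have h2 : Tendsto (fun j => K / n j) atTop (𝓝 0) :=
    (tendsto_const_div_atTop_nhds_zero_nat K).comp hn
  have := (((h1.add h2).pow 2).const_mul 2).add (((h2.pow 2).const_mul 8).mul_const T)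
    |>.mul_const (Real.exp T)
  simpa [gridErrorBound] using this

lemma tendsto_biasBound {n N : ℕ → ℕ} (hn : Tendsto n atTop atTop)
    (hN : Tendsto N atTop atTop) (K T : ℝ) :
    Tendsto (fun j => biasBound K T (n j) (N j)) atTop (𝓝 0) := by
  have h2 : Tendsto (fun j => K / n j) atTop (𝓝 0) :=
    (tendsto_const_div_atTop_nhds_zero_nat K).comp hn
  have := ((tendsto_gridErrorBound hn hN K T).const_mul 2).add ((h2.pow 2).const_mul 16)
  simpa [biasBound] using this

lemma continuous_energyBound (K T : ℝ) : Continuous fun ρ => energyBound K ρ T := by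
  unfold energyBound
  fun_prop

theorem mainTheorem2
    -- the Cauchy problem and its classical solution
    (φ ψ : ℝ → ℝ) (hφ : ContDiff ℝ (⊤ : ℕ∞) φ) (hψ : ContDiff ℝ (⊤ : ℕ∞) ψ)
    (hφ_per : Function.Periodic φ 1) (hψ_per : Function.Periodic ψ 1)
    (hnontrivial : ∃ x, deriv φ x ^ 2 + ψ x ^ 2 ≠ 0)
    (u : ℝ → ℝ → ℝ) (hu : IsClassicalWaveSolution φ ψ u)
    -- numbers of sites and of particles per site, both tending to infinity
    (n N : ℕ → ℕ) [∀ j, NeZero (n j)] (hN_pos : ∀ j, 0 < N j)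
    (hn : Tendsto n atTop atTop) (hN : Tendsto N atTop atTop)
    -- the particle systems on the rings
    {Ω : ℕ → Type*} [∀ j, MeasurableSpace (Ω j)]
    (P : ∀ j, Measure (Ω j)) [∀ j, IsProbabilityMeasure (P j)]
    (X : ∀ j, ℝ≥0 → Ω j → WeightedGraph.State (ZMod (n j)) (ZMod (n j)))
    (hX : ∀ j, (ringGraph (n j)).IsIPS (ringInitial φ ψ (n j) (N j)) (P j) (X j)) :
    -- supercritical scaling
    (Tendsto (fun j => (N j : ℝ) / n j) atTop atTop →
      ∀ T : ℝ≥0,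
        Tendsto (fun j => ⨆ t ∈ Icc 0 T, meanSqError u (n j) (N j) (P j) (X j) t) atTop (𝓝 0) ∧
        Tendsto (fun j => ∫⁻ ω, ⨆ t ∈ Icc 0 T,
          normSqH (fun x => displacementField φ (n j) (N j) (fun s => X j s ω) x t - u x t) ∂(P j))
          atTop (𝓝 0)) ∧
    -- critical scaling
    (∀ C : ℝ, 0 < C → Tendsto (fun j => (N j : ℝ) / n j) atTop (𝓝 C) →
      (∀ t : ℝ≥0, ∃ B : ℝ≥0, ∀ j, meanSqError u (n j) (N j) (P j) (X j) t ≤ B) ∧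
      (∀ t : ℝ≥0, 0 < t →
        ¬ Tendsto (fun j => meanSqError u (n j) (N j) (P j) (X j) t) atTop (𝓝 0)) ∧
      ∀ η : ℝ → ℝ, MemLp η 2 (volume.restrict (Ico (0 : ℝ) 1)) → ∀ T : ℝ≥0,
        Tendsto (fun j => ∫⁻ ω, ⨆ t ∈ Icc 0 T,
          ENNReal.ofReal (innerH (fun x =>
            displacementField φ (n j) (N j) (fun s => X j s ω) x t - u x t) η ^ 2) ∂(P j))
          atTop (𝓝 0)) ∧
    -- subcritical scaling
    (Tendsto (fun j => (N j : ℝ) / n j) atTop (𝓝 0) →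
      ∀ t : ℝ≥0, 0 < t →
        (∀ j, meanSqError u (n j) (N j) (P j) (X j) t < ∞) ∧
        ¬ ∃ B : ℝ≥0, ∀ j, meanSqError u (n j) (N j) (P j) (X j) t ≤ B) := by
  obtain ⟨K, h⟩ := exists_isWaveData hφ hψ hφ_per hψ_per
  have hK := h.nonneg
  have hD : ∀ j, SolvesDynkin (ringRate (n j)) (ringTransition (n j))
      (ringInitial φ ψ (n j) (N j)) (P j) fun t ω => X j t.toNNReal ω :=
    fun j => ringGraph_isIPS_solvesDynkin (hX j)
  have hE := initialEnergy_pos h hφ_per hψ_per hnontrivial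
  have herr := fun j => meanSqError_eq (N := N j) hu h (hD j)
  -- Upper bound of the error on [0, T]. The variance part is n/N times a continuous function of
  -- n/N, so it converges whenever n/N does; the bias part always tends to 0.
  set U : ℝ → ℕ → ℝ := fun T j => (n j : ℝ) / N j * (energyBound K (n j / N j) T + 2) * T +
    biasBound K T (n j) (N j) with hU
  have hupper : ∀ j (t T : ℝ≥0), t ≤ T →
      meanSqError u (n j) (N j) (P j) (X j) t ≤ ENNReal.ofReal (U T j) := fun j t T htT => by
    rw [herr]
    refine ENNReal.ofReal_le_ofReal (add_le_add ?_ ?_)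
    · exact totalVariance_le h (hN_pos j) (hD j) t.coe_nonneg (NNReal.coe_le_coe.2 htT)
    · exact meanBias_le_biasBound h (hN_pos j) (hD j) t.coe_nonneg (NNReal.coe_le_coe.2 htT)
  have hUlim : ∀ T ρ : ℝ, Tendsto (fun j => (n j : ℝ) / N j) atTop (𝓝 ρ) →
      Tendsto (U T) atTop (𝓝 (ρ * (energyBound K ρ T + 2) * T + 0)) := fun T ρ hρ =>
    ((hρ.mul ((((continuous_energyBound K T).tendsto ρ).comp hρ).add_const 2)).mul_const T).add
      (tendsto_biasBound hn hN K T)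
  -- The error is at least (n/N) L(t), where L(t) tends to a positive multiple of the initial energy
  -- for t > 0.
  set L : ℝ → ℕ → ℝ := fun t j => (initialEnergy φ ψ / 2 - biasBound K t (n j) (N j) -
    gridErrorBound t (1 / N j) (K / n j)) / (2 * K + 1) * t with hL
  have hlower : ∀ t : ℝ≥0, ∀ᶠ j in atTop,
      ENNReal.ofReal ((n j : ℝ) / N j * L t j) ≤ meanSqError u (n j) (N j) (P j) (X j) t :=
    fun t => by
      -- The ring with one site is discarded, since its jumps cancel and create no variance.
      filter_upwards [hn.eventually_ge_atTop 2] with j hj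
      rw [herr]
      refine ENNReal.ofReal_le_ofReal (le_add_of_le_of_nonneg ?_ (meanBias_nonneg _))
      exact le_totalVariance h hj (hN_pos j) (hD j) t.coe_nonneg
  have hLlim : ∀ t : ℝ, Tendsto (L t) atTop (𝓝 (initialEnergy φ ψ / 2 / (2 * K + 1) * t)) :=
    fun t => by
      have := (((tendsto_biasBound hn hN K t).const_sub (initialEnergy φ ψ / 2)).sub
        (tendsto_gridErrorBound hn hN K t)).div_const (2 * K + 1) |>.mul_const t
      simpa only [sub_zero] using this
  have hLpos : ∀ t : ℝ≥0, 0 < t → 0 < initialEnergy φ ψ / 2 / (2 * K + 1) * (t : ℝ) :=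
    fun t ht => by
      have : (0 : ℝ) < t := ht
      positivity
  have hinv : ∀ j, ((N j : ℝ) / n j)⁻¹ = (n j : ℝ) / N j := fun j => inv_div _ _
  refine ⟨fun hlim T => ?_, fun C hC hlim => ⟨fun t => ?_, fun t ht hzero => ?_, fun η hη T => ?_⟩,
    fun hlim t ht => ⟨fun j => ?_, ?_⟩⟩
  · have hρ : Tendsto (fun j => (n j : ℝ) / N j) atTop (𝓝 0) := by
      simpa only [Function.comp_def, hinv] using tendsto_inv_atTop_zero.comp hlim
    have hU0 : Tendsto (fun j => ENNReal.ofReal (U T j)) atTop (𝓝 0) := by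
      have := ENNReal.tendsto_ofReal (hUlim T 0 hρ)
      simpa using this
    constructor
    · exact tendsto_of_tendsto_of_tendsto_of_le_of_le tendsto_const_nhds hU0
        (fun j => zero_le) fun j => iSup₂_le fun t ht => hupper j t T ht.2
    · have hU1 : Tendsto (fun j => (T : ℝ≥0∞) * (ENNReal.ofReal (U T j) * T)) atTop (𝓝 0) := by
        have := ENNReal.Tendsto.const_mul (ENNReal.Tendsto.mul_const hU0
          (Or.inr (ENNReal.coe_ne_top (r := T)))) (Or.inr (ENNReal.coe_ne_top (r := T)))
        simpa using this
      exact tendsto_of_tendsto_of_tendsto_of_le_of_le tendsto_const_nhds hU1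
        (fun j => zero_le) fun j => lintegral_iSup_normSqH_le hu h (hD j) fun s hs =>
          (lintegral_velocityError_le hu s).trans (hupper j s T hs)
  · have hρ : Tendsto (fun j => (n j : ℝ) / N j) atTop (𝓝 C⁻¹) := by
      simpa only [hinv] using hlim.inv₀ hC.ne'
    obtain ⟨B, hB⟩ := (hUlim t _ hρ).bddAbove_range
    exact ⟨B.toNNReal, fun j => (hupper j t t le_rfl).trans
      (ENNReal.ofReal_le_ofReal (hB (mem_range_self j)))⟩
  · have hρ : Tendsto (fun j => (n j : ℝ) / N j) atTop (𝓝 C⁻¹) := by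
      simpa only [hinv] using hlim.inv₀ hC.ne'
    -- Convergence of the error to 0 would force the limit of the lower bound, C⁻¹ times a positive
    -- number, to be nonpositive.
    have h1 := ENNReal.tendsto_ofReal (hρ.mul (hLlim t))
    have h2 := le_of_tendsto_of_tendsto h1 hzero (hlower t)
    rw [nonpos_iff_eq_zero, ENNReal.ofReal_eq_zero] at h2
    exact absurd h2 (not_le.2 (mul_pos (inv_pos.2 hC) (hLpos t ht)))
  · have hρ : Tendsto (fun j => (n j : ℝ) / N j) atTop (𝓝 C⁻¹) := by
      simpa only [hinv] using hlim.inv₀ hC.ne'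
    set I := ∫ x in Ico (0 : ℝ) 1, η x ^ 2 with hI
    set W : ℕ → ℝ := fun j => (√(n j / N j * energyBound K (n j / N j) T * T * Real.exp (8 * T) *
      (1 / N j)) + biasBound K T (n j) (N j)) * I with hW
    -- Everything under the root converges except for the extra factor 1/N, which tends to 0.
    have hW0 : Tendsto W atTop (𝓝 0) := by
      have h1 : Tendsto (fun j => (1 : ℝ) / N j) atTop (𝓝 0) :=
        (tendsto_const_div_atTop_nhds_zero_nat 1).comp hN
      have h2 := ((((hρ.mul (((continuous_energyBound K T).tendsto _).comp hρ)).mul_const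
        (T : ℝ)).mul_const (Real.exp (8 * T))).mul h1)
      have h3 := ((h2.sqrt).add (tendsto_biasBound hn hN K T)).mul_const I
      simp only [mul_zero, Real.sqrt_zero, add_zero, zero_mul] at h3
      exact h3
    have hU1 : Tendsto (fun j => (T : ℝ≥0∞) * (ENNReal.ofReal (W j) * T)) atTop (𝓝 0) := by
      have := ENNReal.Tendsto.const_mul (ENNReal.Tendsto.mul_const (ENNReal.tendsto_ofReal hW0)
        (Or.inr (ENNReal.coe_ne_top (r := T)))) (Or.inr (ENNReal.coe_ne_top (r := T)))
      simpa using this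
    exact tendsto_of_tendsto_of_tendsto_of_le_of_le tendsto_const_nhds hU1
      (fun j => zero_le) fun j => lintegral_iSup_innerH_le hu h (hD j) hη fun s hs =>
        lintegral_innerH_sq_le_bound h (hN_pos j) (hD j) s.coe_nonneg (NNReal.coe_le_coe.2 hs) hη
  · rw [herr]
    exact ENNReal.ofReal_lt_top
  · rintro ⟨B, hB⟩
    have hρ : Tendsto (fun j => (n j : ℝ) / N j) atTop atTop := by
      have hpos : ∀ j, (0 : ℝ) < (N j : ℝ) / n j := fun j =>
        div_pos (Nat.cast_pos.2 (hN_pos j)) (Nat.cast_pos.2 (NeZero.pos (n j)))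
      have := tendsto_inv_nhdsGT_zero.comp
        (tendsto_nhdsWithin_iff.2 ⟨hlim, Eventually.of_forall hpos⟩)
      simpa only [Function.comp_def, hinv] using this
    -- Here n/N diverges while L(t) has a positive limit, so the lower bound exceeds any constant.
    have h1 := hρ.atTop_mul_pos (hLpos t ht) (hLlim t)
    obtain ⟨j, hj1, hj2⟩ := ((h1.eventually_gt_atTop (B : ℝ)).and (hlower t)).exists
    have h2 := hj2.trans (hB j)
    rw [ENNReal.ofReal_le_iff_le_toReal ENNReal.coe_ne_top, ENNReal.coe_toReal] at h2
    linarith
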